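/- Let $d\ge 1$, let $B_r=\{x\in\mathbb R^d:\|x\|\le r\}$, let $S_+^{d-1}$ be the set of unit vectors of $\mathbb R^d$ with nonnegative last coordinate, and put $H(p,v)=\{x\in\mathbb R^d:\langle x,v\rangle=p\}$ for $(p,v)\in\mathbb R\times S_+^{d-1}$. Let $\Phi$ be a stationary Poisson hyperplane process in $\mathbb R^d$ with intensity $\lambda>0$ and orientation distribution $\Theta$. That is, $\Phi$ consists of the hyperplanes $H(P_i,V_i)$, $i\ge1$, where $\sum_{i\ge1}\delta_{(P_i,V_i)}$ is a Poisson process on $\mathbb R\times S_+^{d-1}$ with intensity measure $\lambda\,dp\otimes\Theta(dv)$, and $\Theta$ is a probability measure on $S_+^{d-1}$. Assume that $\Theta$ is nondegenerate: $\Theta(L\cap S_+^{d-1})<1$ for every linear subspace $L$ of dimension $d-1$. For $k=0,\dots,d-1$ let $\Psi_k(B_r)$ be $\frac1{(d-k)!}$ times the number of $(d-k)$-tuples of pairwise distinct hyperplanes of $\Phi$ whose intersection is a $k$-flat that hits $B_r$. Let $\zeta_k(B_r)=\frac1{(d-k)!}\sum\nu_k(H_1\cap\dots\cap H_{d-k}\cap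 B_r)$, the sum running over all $(d-k)$-tuples of pairwise distinct hyperplanes of $\Phi$, where $\nu_k$ is $k$-dimensional volume ($\nu_0$ is counting measure). These variables are square integrable for every $r>0$. Put $$Z_{k,r}(\chi)=\frac{(d-k-1)!}{(2\lambda r)^{d-k-1/2}}\bigl(\Psi_k(B_r)-\mathbb E\Psi_k(B_r)\bigr),\qquad Z_{k,r}(\nu)=\frac{(d-k-1)!\,r^{-k}}{(2\lambda r)^{d-k-1/2}}\bigl(\zeta_k(B_r)-\mathbb E\zeta_k(B_r)\bigr).$$ Let $\chi(K)=1$ if $K\ne\emptyset$ and $\chi(\emptyset)=0$. For $\rho>0$ let $X,X_1,X_2,\dots$ be independent random elements of $[-\rho,\rho]\times S_+^{d-1}$ whose common law is the product of the uniform distribution on $[-\rho,\rho]$ and $\Theta$. Put $$g_{\chi,k}(x)=\mathbb E\,\chi\bigl(H(X_1)\cap\dots\cap H(X_{d-k-1})\cap H(x)\cap B_\rho\bigr),\qquad g_{\nu,k}(x)=\rho^{-k}\,\mathbb E\,\nu_k\bigl(H(X_1)\cap\dots\cap H(X_{d-k-1})\cap H(x)\cap B_\rho\bigr),$$ $$\Sigma(\chi)=\bigl(\mathbb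 E[g_{\chi,k}(X)g_{\chi,l}(X)]\bigr)_{k,l=0}^{d-1},\qquad \Sigma(\nu)=\bigl(\mathbb E[g_{\nu,k}(X)g_{\nu,l}(X)]\bigr)_{k,l=0}^{d-1}.$$ Then, for every choice of $\rho>0$, the matrices $\Sigma(\chi)$ and $\Sigma(\nu)$ are positive semidefinite and, as $r\to\infty$, $$(Z_{k,r}(\chi))_{k=0}^{d-1}\xrightarrow{d}\mathcal N(o,\Sigma(\chi)),\qquad (Z_{k,r}(\nu))_{k=0}^{d-1}\xrightarrow{d}\mathcal N(o,\Sigma(\nu)),$$ where $\mathcal N(o,\Sigma)$ is the $d$-dimensional centred Gaussian law with covariance matrix $\Sigma$. The entries of the two matrices are the limits of the mixed moments: for $k,l=0,\dots,d-1$, $$\lim_{r\to\infty}\mathbb E\bigl(Z_{k,r}(\chi)Z_{l,r}(\chi)\bigr)=\Sigma(\chi)_{k,l},\qquad \lim_{r\to\infty}\mathbb E\bigl(Z_{k,r}(\nu)Z_{l,r}(\nu)\bigr)=\Sigma(\nu)_{k,l}.$$ -/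

import Mathlib

open MeasureTheory ProbabilityTheory Filter Topology
open scoped ENNReal NNReal Nat

noncomputable section

namespace PoissonFlats

/-- The `d`-dimensional Euclidean space. -/
abbrev Space (d : ℕ) : Type := EuclideanSpace ℝ (Fin d)

/-- The upper unit hemisphere: unit vectors whose last coordinate is nonnegative. -/
def upperHemisphere (d : ℕ) : Set (Space d) :=
  {v | ‖v‖ = 1 ∧ ∀ i : Fin d, (i : ℕ) + 1 = d → 0 ≤ v i}

/-- Parameters `(p, v)` of hyperplanes: signed distance from the origin and orientation vector. -/
abbrev Mark (d : ℕ) : Type := ℝ × upperHemisphere d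

/-- The hyperplane `H(p, v) = {x : ⟨x, v⟩ = p}`. -/
def hyperplane {d : ℕ} (x : Mark d) : AffineSubspace ℝ (Space d) where
  carrier := {y | inner ℝ y (x.2 : Space d) = x.1}
  smul_vsub_vadd_mem' := by
    intro c a b e ha hb he
    simp only [Set.mem_ofPred_eq, vsub_eq_sub, vadd_eq_add] at *
    rw [inner_add_left, inner_smul_left, inner_sub_left, ha, hb, he]
    simp

/-- `𝒜ₖᵈ`, the set of `k`-flats: nonempty affine subspaces of dimension `k`. -/
def kFlats (d k : ℕ) : Set (AffineSubspace ℝ (Space d)) :=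
  {L | (L : Set (Space d)).Nonempty ∧ Module.finrank ℝ L.direction = k}

/-- The random counting measure `∑ i, δ_(X i ω)` of a sequence of random points. -/
def countingMeasure {Ω S : Type*} [MeasurableSpace S] (X : ℕ → Ω → S) (ω : Ω) : Measure S :=
  Measure.sum fun i => Measure.dirac (X i ω)

/-- The random points `X 0, X 1, …` are the atoms (listed with multiplicity) of a Poisson point
process with intensity measure `Λ`: the number of points in a measurable set of finite intensity
`Λ A` is Poisson distributed with mean `Λ A`, and the numbers of points in finitely many pairwise
disjoint measurable sets are independent. -/
structure IsPoissonProcess {Ω S : Type*} [MeasurableSpace Ω] [MeasurableSpace S]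
    (P : Measure Ω) (X : ℕ → Ω → S) (Λ : Measure S) : Prop where
  measurable : ∀ i, Measurable (X i)
  law_count : ∀ A : Set S, MeasurableSet A → Λ A ≠ ∞ →
    P.map (fun ω => countingMeasure X ω A) =
      (poissonMeasure (Λ A).toNNReal).map (fun n : ℕ => (n : ℝ≥0∞))
  indep_count : ∀ (n : ℕ) (A : Fin n → Set S), (∀ i, MeasurableSet (A i)) →
    Pairwise (fun i j => Disjoint (A i) (A j)) →
    iIndepFun (fun i ω => countingMeasure X ω (A i)) P

/-- A stationary Poisson hyperplane process with intensity `lam` and spherical orientation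
distribution `Θ`, in its representation as a stationary, independently marked Poisson process
`∑ i, δ_(Pᵢ, Vᵢ)` on the line with intensity `lam` and mark distribution `Θ`; equivalently, as a
Poisson process on `ℝ × S₊ᵈ⁻¹` with intensity measure `lam · (Lebesgue ⊗ Θ)`. -/
def IsPoissonHyperplaneProcess {d : ℕ} {Ω : Type*} [MeasurableSpace Ω] (P : Measure Ω)
    (X : ℕ → Ω → Mark d) (lam : ℝ) (Θ : Measure (upperHemisphere d)) : Prop :=
  IsPoissonProcess P X (ENNReal.ofReal lam • (volume : Measure ℝ).prod Θ)

/-- The support of the hyperplane process: the set of its hyperplanes. -/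
def hyperplanes {d : ℕ} {Ω : Type*} (X : ℕ → Ω → Mark d) (ω : Ω) :
    Set (AffineSubspace ℝ (Space d)) :=
  Set.range fun i => hyperplane (X i ω)

/-- `1 / (d - k)!` times the sum of `f (H₁ ∩ ⋯ ∩ H_{d-k})` over all `(d - k)`-tuples of pairwise
distinct hyperplanes in `Φ`. -/
def flatSum {d : ℕ} (k : ℕ) (Φ : Set (AffineSubspace ℝ (Space d)))
    (f : AffineSubspace ℝ (Space d) → ℝ≥0∞) : ℝ≥0∞ :=
  ((d - k)! : ℝ≥0∞)⁻¹ *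
    ∑' H : {H : Fin (d - k) → AffineSubspace ℝ (Space d) //
      Function.Injective H ∧ ∀ i, H i ∈ Φ}, f (⨅ i, H.1 i)

/-- The number `Ψₖ(B_rᵈ) = Φₖ({L ∈ 𝒜ₖᵈ : L ∩ B_rᵈ ≠ ∅})` of `k`-flats of the induced `k`-flat
intersection process that hit the closed ball of radius `r`. -/
def flatCount {d : ℕ} {Ω : Type*} (X : ℕ → Ω → Mark d) (k : ℕ) (r : ℝ) (ω : Ω) : ℝ :=
  (flatSum k (hyperplanes X ω)
    ({L | L ∈ kFlats d k ∧ ((L : Set (Space d)) ∩ Metric.closedBall 0 r).Nonempty}.indicator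
      1)).toReal

/-- The total `k`-volume `ζₖ(B_rᵈ)` of the induced `k`-flats in the closed ball of radius `r`;
`μHE[k]` is the `k`-dimensional Hausdorff measure normalized to agree with Lebesgue measure. -/
def flatVolume {d : ℕ} {Ω : Type*} (X : ℕ → Ω → Mark d) (k : ℕ) (r : ℝ) (ω : Ω) : ℝ :=
  (flatSum k (hyperplanes X ω)
    (fun L => μHE[k] ((L : Set (Space d)) ∩ Metric.closedBall 0 r))).toReal

/-- The normalized `k`-flat counts `Z_{k,r}(χ)`, `k = 0, …, d - 1`. -/
def ZCount {d : ℕ} {Ω : Type*} [MeasurableSpace Ω] (P : Measure Ω) (X : ℕ → Ω → Mark d)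
    (lam r : ℝ) (ω : Ω) : Space d :=
  WithLp.toLp 2 fun k : Fin d =>
    ((d - (k : ℕ) - 1)! : ℝ) / (2 * lam * r : ℝ) ^ ((d : ℝ) - (k : ℕ) - 1 / 2) *
      (flatCount X k r ω - ∫ ω', flatCount X k r ω' ∂P)

/-- The normalized `k`-volumes `Z_{k,r}(ν)`, `k = 0, …, d - 1`. -/
def ZVolume {d : ℕ} {Ω : Type*} [MeasurableSpace Ω] (P : Measure Ω) (X : ℕ → Ω → Mark d)
    (lam r : ℝ) (ω : Ω) : Space d :=
  WithLp.toLp 2 fun k : Fin d =>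
    ((d - (k : ℕ) - 1)! : ℝ) * (r ^ (k : ℕ))⁻¹ / (2 * lam * r : ℝ) ^ ((d : ℝ) - (k : ℕ) - 1 / 2) *
      (flatVolume X k r ω - ∫ ω', flatVolume X k r ω' ∂P)

/-- The law of a random mark `(P, V)` with independent components, `P` uniformly distributed on
`[-r, r]` and `V` distributed according to `Θ`. -/
def markLaw {d : ℕ} (Θ : Measure (upperHemisphere d)) (r : ℝ) : Measure (Mark d) :=
  (cond (volume : Measure ℝ) (Set.Icc (-r) r)).prod Θ

open Classical in
/-- `χ(K) = 1` for nonempty `K` and `χ(∅) = 0`. -/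
def chi {d : ℕ} (K : Set (Space d)) : ℝ := if K.Nonempty then 1 else 0

/-- `g_{χ,k}(x) = E χ(H(X₁) ∩ ⋯ ∩ H(X_{d-k-1}) ∩ H(x) ∩ B_rᵈ)` for independent `Xᵢ` with law
`markLaw Θ r`. -/
def gCount {d : ℕ} (Θ : Measure (upperHemisphere d)) (r : ℝ) (k : ℕ) (x : Mark d) : ℝ :=
  ∫ y : Fin (d - k - 1) → Mark d,
    chi ((((⨅ i, hyperplane (y i)) ⊓ hyperplane x : AffineSubspace ℝ (Space d)) :
      Set (Space d)) ∩ Metric.closedBall 0 r) ∂(Measure.pi fun _ => markLaw Θ r)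

/-- `g_{ν,k}(x) = r⁻ᵏ E νₖ(H(X₁) ∩ ⋯ ∩ H(X_{d-k-1}) ∩ H(x) ∩ B_rᵈ)` for independent `Xᵢ` with law
`markLaw Θ r`. -/
def gVolume {d : ℕ} (Θ : Measure (upperHemisphere d)) (r : ℝ) (k : ℕ) (x : Mark d) : ℝ :=
  (r ^ k)⁻¹ * ∫ y : Fin (d - k - 1) → Mark d,
    (μHE[k] ((((⨅ i, hyperplane (y i)) ⊓ hyperplane x : AffineSubspace ℝ (Space d)) :
      Set (Space d)) ∩ Metric.closedBall 0 r)).toReal ∂(Measure.pi fun _ => markLaw Θ r)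

/-- `Σ(χ)`, the matrix of the mixed second moments `E (g_{χ,k}(X) g_{χ,l}(X))`, computed with
radius `r`. -/
def covCount {d : ℕ} (Θ : Measure (upperHemisphere d)) (r : ℝ) : Matrix (Fin d) (Fin d) ℝ :=
  fun k l => ∫ x, gCount Θ r k x * gCount Θ r l x ∂(markLaw Θ r)

/-- `Σ(ν)`, the matrix of the mixed second moments `E (g_{ν,k}(X) g_{ν,l}(X))`, computed with
radius `r`. -/
def covVolume {d : ℕ} (Θ : Measure (upperHemisphere d)) (r : ℝ) : Matrix (Fin d) (Fin d) ℝ :=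
  fun k l => ∫ x, gVolume Θ r k x * gVolume Θ r l x ∂(markLaw Θ r)

end PoissonFlats

end

noncomputable section

namespace PoissonFlats

/-! ### Moments of the Poisson distribution -/

lemma poissonMeasure_singleton_succ_mul (r : ℝ≥0) (n : ℕ) :
    poissonMeasure r {n + 1} * ((n + 1 : ℕ) : ℝ≥0∞) = r * poissonMeasure r {n} := by
  rw [poissonMeasure_singleton, poissonMeasure_singleton, ← ENNReal.ofReal_natCast,
    ← ENNReal.ofReal_mul (by positivity), ← ENNReal.ofReal_coe_nnreal,
    ← ENNReal.ofReal_mul (by positivity)]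
  congr 1
  rw [Nat.factorial_succ]
  push_cast
  field_simp
  ring

lemma lintegral_natCast_poissonMeasure (r : ℝ≥0) :
    ∫⁻ n : ℕ, (n : ℝ≥0∞) ∂(poissonMeasure r) = r := by
  have h1 : ∑' n : ℕ, poissonMeasure r {n} = 1 := by
    have := lintegral_countable' (μ := poissonMeasure r) (fun _ : ℕ => (1 : ℝ≥0∞))
    simpa using this.symm
  rw [lintegral_countable', tsum_eq_zero_add' ENNReal.summable]
  simp_rw [mul_comm _ (poissonMeasure r _), poissonMeasure_singleton_succ_mul,
    ENNReal.tsum_mul_left, h1]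
  simp

lemma poissonMeasure_two_le (r : ℝ≥0) :
    poissonMeasure r {n : ℕ | 2 ≤ n} ≤ (r : ℝ≥0∞) ^ 2 := by
  have h1 : ∑' n : ℕ, poissonMeasure r {n} = 1 := by
    have := lintegral_countable' (μ := poissonMeasure r) (fun _ : ℕ => (1 : ℝ≥0∞))
    simpa using this.symm
  have h2 : ∀ n, poissonMeasure r {n + 1} ≤ r * poissonMeasure r {n} := fun n => by
    rw [← poissonMeasure_singleton_succ_mul]
    exact le_mul_of_one_le_right' (by exact_mod_cast Nat.succ_le_succ n.zero_le)
  have h3 : {n : ℕ | 2 ≤ n} ⊆ ⋃ n : ℕ, {n + 2} := fun n hn => by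
    simp only [Set.mem_iUnion, Set.mem_singleton_iff]
    exact ⟨n - 2, by simp at hn; omega⟩
  calc poissonMeasure r {n : ℕ | 2 ≤ n} ≤ ∑' n : ℕ, poissonMeasure r {n + 2} :=
        (measure_mono h3).trans (measure_iUnion_le _)
    _ ≤ ∑' n : ℕ, (r : ℝ≥0∞) ^ 2 * poissonMeasure r {n} := by
        refine ENNReal.tsum_le_tsum fun n => (h2 (n + 1)).trans ?_
        rw [pow_two, mul_assoc]
        exact mul_le_mul_right (h2 n) _
    _ = (r : ℝ≥0∞) ^ 2 := by rw [ENNReal.tsum_mul_left, h1, mul_one]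

/-! ### Sums over tuples of points -/

section Tuples

variable {Ω S ι : Type*}

instance [Finite ι] : Countable (ι ↪ ℕ) :=
  Function.Injective.countable (f := fun I : ι ↪ ℕ => (I : ι → ℕ)) DFunLike.coe_injective

/-- The sum of `f (Y (I ·))` over all tuples `I` of pairwise distinct indices. -/
def tupleSum (Y : ℕ → Ω → S) (f : (ι → S) → ℝ≥0∞) (ω : Ω) : ℝ≥0∞ :=
  ∑' I : ι ↪ ℕ, f (fun a => Y (I a) ω)

lemma measurable_tupleSum [Finite ι] [MeasurableSpace Ω] [MeasurableSpace S] {Y : ℕ → Ω → S}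
    (hY : ∀ i, Measurable (Y i)) {f : (ι → S) → ℝ≥0∞} (hf : Measurable f) :
    Measurable (tupleSum Y f) :=
  Measurable.tsum fun I => hf.comp (measurable_pi_lambda _ fun a => hY (I a))

lemma prod_tsum_fin (n : ℕ) (g : Fin n → ℕ → ℝ≥0∞) :
    ∏ a, ∑' i, g a i = ∑' I : Fin n → ℕ, ∏ a, g a (I a) := by
  induction n with
  | zero => simp
  | succ n ih =>
    rw [Fin.prod_univ_succ, ih, ← (Fin.consEquiv fun _ => ℕ).tsum_eq, ENNReal.tsum_prod',
      ← ENNReal.tsum_mul_right]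
    refine tsum_congr fun i => ?_
    rw [← ENNReal.tsum_mul_left]
    refine tsum_congr fun I => ?_
    simp [Fin.consEquiv, Fin.prod_univ_succ]

lemma prod_tsum [Fintype ι] (g : ι → ℕ → ℝ≥0∞) :
    ∏ a, ∑' i, g a i = ∑' I : ι → ℕ, ∏ a, g a (I a) := by
  let e := Fintype.equivFin ι
  rw [← e.symm.prod_comp, prod_tsum_fin, ← (e.arrowCongr (Equiv.refl ℕ)).tsum_eq]
  refine tsum_congr fun I => ?_
  rw [← e.symm.prod_comp]
  simp

lemma countingMeasure_apply [MeasurableSpace S] (Y : ℕ → Ω → S) (ω : Ω) {A : Set S}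
    (hA : MeasurableSet A) :
    countingMeasure Y ω A = ∑' i, A.indicator (fun _ => (1 : ℝ≥0∞)) (Y i ω) := by
  rw [countingMeasure, Measure.sum_apply _ hA]
  exact tsum_congr fun i => by rw [Measure.dirac_apply' _ hA]; rfl

lemma tupleSum_rectangle [Fintype ι] [MeasurableSpace S] (Y : ℕ → Ω → S) (ω : Ω)
    {A : ι → Set S} (hA : ∀ a, MeasurableSet (A a))
    (hd : Pairwise fun a b => Disjoint (A a) (A b)) :
    tupleSum Y ((Set.univ.pi A).indicator fun _ => 1) ω = ∏ a, countingMeasure Y ω (A a) := by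
  classical
  simp_rw [countingMeasure_apply Y ω (hA _)]
  rw [prod_tsum, tupleSum]
  have key : ∀ I : ι → ℕ, (Set.univ.pi A).indicator (fun _ => (1 : ℝ≥0∞)) (fun a => Y (I a) ω) =
      ∏ a, (A a).indicator (fun _ => (1 : ℝ≥0∞)) (Y (I a) ω) := by
    intro I
    by_cases h : ∀ a, Y (I a) ω ∈ A a
    · rw [Set.indicator_of_mem (by simpa using h)]
      exact (Finset.prod_eq_one fun a _ => Set.indicator_of_mem (h a) _).symm
    · rw [Set.indicator_of_notMem (by simpa using h)]
      push Not at h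
      obtain ⟨a, ha⟩ := h
      exact (Finset.prod_eq_zero (Finset.mem_univ a) (Set.indicator_of_notMem ha _)).symm
  simp_rw [key]
  refine Function.Injective.tsum_eq (f := fun I : ι → ℕ =>
    ∏ a, (A a).indicator (fun _ => (1 : ℝ≥0∞)) (Y (I a) ω)) (g := fun I : ι ↪ ℕ => (I : ι → ℕ))
    DFunLike.coe_injective ?_
  intro I hI
  rw [Function.mem_support, ← key I] at hI
  have hI' := Set.mem_of_indicator_ne_zero hI
  refine ⟨⟨I, fun a b hab => by_contra fun hne => ?_⟩, rfl⟩
  have h1 : Y (I a) ω ∈ A a := hI' a trivial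
  have h2 : Y (I b) ω ∈ A b := hI' b trivial
  rw [← hab] at h2
  exact (hd hne).le_bot ⟨h1, h2⟩

end Tuples

/-! ### Counts of a Poisson process -/

namespace IsPoissonProcess

variable {Ω S : Type*} [MeasurableSpace Ω] [MeasurableSpace S] {P : Measure Ω}
  {X : ℕ → Ω → S} {Λ : Measure S}

lemma measurable_count (hX : IsPoissonProcess P X Λ) {A : Set S} (hA : MeasurableSet A) :
    Measurable fun ω => countingMeasure X ω A := by
  simp_rw [countingMeasure_apply X _ hA]
  exact Measurable.tsum fun i =>
    (measurable_const.indicator hA).comp (hX.measurable i)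

lemma lintegral_comp_count (hX : IsPoissonProcess P X Λ) {A : Set S} (hA : MeasurableSet A)
    (hfin : Λ A ≠ ∞) {g : ℝ≥0∞ → ℝ≥0∞} (hg : Measurable g) :
    ∫⁻ ω, g (countingMeasure X ω A) ∂P =
      ∫⁻ n : ℕ, g n ∂(poissonMeasure (Λ A).toNNReal) := by
  rw [← lintegral_map hg (hX.measurable_count hA), hX.law_count A hA hfin,
    lintegral_map hg .of_discrete]

lemma lintegral_count (hX : IsPoissonProcess P X Λ) {A : Set S} (hA : MeasurableSet A)
    (hfin : Λ A ≠ ∞) : ∫⁻ ω, countingMeasure X ω A ∂P = Λ A := by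
  have h := hX.lintegral_comp_count hA hfin measurable_id
  simpa [lintegral_natCast_poissonMeasure, hfin] using h

lemma ae_count_lt_top (hX : IsPoissonProcess P X Λ) {A : Set S} (hA : MeasurableSet A)
    (hfin : Λ A ≠ ∞) : ∀ᵐ ω ∂P, countingMeasure X ω A < ∞ :=
  ae_lt_top (hX.measurable_count hA) (by rwa [hX.lintegral_count hA hfin])

lemma measure_two_le_count (hX : IsPoissonProcess P X Λ) {A : Set S} (hA : MeasurableSet A)
    (hfin : Λ A ≠ ∞) : P {ω | 2 ≤ countingMeasure X ω A} ≤ Λ A ^ 2 := by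
  have h : MeasurableSet {x : ℝ≥0∞ | 2 ≤ x} := measurableSet_Ici
  have h2 : {ω | 2 ≤ countingMeasure X ω A} =
      (fun ω => countingMeasure X ω A) ⁻¹' {x : ℝ≥0∞ | 2 ≤ x} := rfl
  rw [h2, ← Measure.map_apply (hX.measurable_count hA) h, hX.law_count A hA hfin,
    Measure.map_apply .of_discrete h]
  have h3 : (fun n : ℕ => (n : ℝ≥0∞)) ⁻¹' {x : ℝ≥0∞ | 2 ≤ x} = {n | 2 ≤ n} := by
    ext n
    simp only [Set.mem_preimage, Set.mem_ofPred_eq]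
    exact_mod_cast Iff.rfl
  rw [h3]
  refine (poissonMeasure_two_le _).trans ?_
  rw [ENNReal.coe_toNNReal hfin]

lemma iIndepFun_count (hX : IsPoissonProcess P X Λ) {ι : Type*} [Fintype ι] {A : ι → Set S}
    (hA : ∀ a, MeasurableSet (A a)) (hd : Pairwise fun a b => Disjoint (A a) (A b)) :
    iIndepFun (fun a ω => countingMeasure X ω (A a)) P := by
  let e := Fintype.equivFin ι
  have := hX.indep_count _ (fun i => A (e.symm i)) (fun i => hA _)
    fun i j hij => hd (e.symm.injective.ne hij)
  have h := this.precomp e.injective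
  simpa using h

lemma lintegral_tupleSum_rectangle (hX : IsPoissonProcess P X Λ) {ι : Type*} [Fintype ι]
    {A : ι → Set S} (hA : ∀ a, MeasurableSet (A a))
    (hd : Pairwise fun a b => Disjoint (A a) (A b)) (hfin : ∀ a, Λ (A a) ≠ ∞) :
    ∫⁻ ω, tupleSum X ((Set.univ.pi A).indicator fun _ => 1) ω ∂P = ∏ a, Λ (A a) := by
  simp_rw [tupleSum_rectangle X _ hA hd]
  rw [lintegral_prod_eq_prod_lintegral_of_indepFun _ _ (hX.iIndepFun_count hA hd)
    fun a => hX.measurable_count (hA a)]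
  exact Finset.prod_congr rfl fun a _ => hX.lintegral_count (hA a) (hfin a)

end IsPoissonProcess

/-! ### Factorial moment measures -/

/-- The half-open slab `{c ≤ n q < c + 1}` of a real function `q`. -/
def slab {S : Type*} (q : S → ℝ) (n : ℕ) (c : ℤ) : Set S := {x | ⌊(n : ℝ) * q x⌋ = c}

lemma measurableSet_slab {S : Type*} [MeasurableSpace S] {q : S → ℝ} (hq : Measurable q) (n : ℕ)
    (c : ℤ) : MeasurableSet (slab q n c) :=
  (Int.measurable_floor.comp (measurable_const.mul hq)) (measurableSet_singleton c)

/-- The level sets of `q` are null sets of `Λ`, in a quantitative form. -/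
structure IsDiffuseFor {S : Type*} [MeasurableSpace S] (Λ : Measure S) (q : S → ℝ) : Prop where
  measurable : Measurable q
  exists_bound : ∃ K : ℝ≥0, ∀ (n : ℕ) (c : ℤ), Λ (slab q (n + 1) c) ≤ K / (n + 1 : ℕ)

lemma tendsto_const_div_succ {K : ℝ≥0∞} (hK : K ≠ ∞) :
    Tendsto (fun n : ℕ => K / (n + 1 : ℕ)) atTop (𝓝 0) :=
  (ENNReal.Tendsto.const_div (f := atTop) ENNReal.tendsto_nat_nhds_top (Or.inr hK)).comp
    (tendsto_add_atTop_nat 1) |>.trans (by simp)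

namespace IsDiffuseFor

variable {S : Type*} [MeasurableSpace S] {Λ : Measure S} {q : S → ℝ}

lemma measure_slab_ne_top (h : IsDiffuseFor Λ q) (n : ℕ) (c : ℤ) : Λ (slab q (n + 1) c) ≠ ∞ := by
  obtain ⟨K, hK⟩ := h.exists_bound
  exact ((hK n c).trans_lt (ENNReal.div_lt_top ENNReal.coe_ne_top (by positivity))).ne

lemma measure_level (h : IsDiffuseFor Λ q) (s : ℝ) : Λ (q ⁻¹' {s}) = 0 := by
  obtain ⟨K, hK⟩ := h.exists_bound
  refine le_antisymm (ge_of_tendsto' (tendsto_const_div_succ (K := K) ENNReal.coe_ne_top)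
    fun n => (measure_mono ?_).trans (hK n ⌊((n + 1 : ℕ) : ℝ) * s⌋)) zero_le
  rintro x rfl
  rfl

lemma ae_pi_injective (h : IsDiffuseFor Λ q) [SigmaFinite Λ] (ι : Type*) [Fintype ι] :
    ∀ᵐ x ∂(Measure.pi fun _ : ι => Λ), Function.Injective fun a => q (x a) := by
  classical
  have key : ∀ a b : ι, a ≠ b → ∀ᵐ x ∂(Measure.pi fun _ : ι => Λ), q (x a) ≠ q (x b) := by
    intro a b hab
    let e := MeasurableEquiv.piEquivPiSubtypeProd (fun _ : ι => S) (fun i => i ≠ a)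
    have he := measurePreserving_piEquivPiSubtypeProd (fun _ : ι => Λ) (fun i => i ≠ a)
    let b' : {i // i ≠ a} := ⟨b, hab.symm⟩
    let a' : {i // ¬ i ≠ a} := ⟨a, by simp⟩
    let T : Set (({i // i ≠ a} → S) × ({i // ¬ i ≠ a} → S)) := {z | q (z.2 a') = q (z.1 b')}
    have hT : MeasurableSet T := by
      refine measurableSet_eq_fun (h.measurable.comp ?_) (h.measurable.comp ?_)
      · exact (measurable_pi_apply a').comp measurable_snd
      · exact (measurable_pi_apply b').comp measurable_fst
    have h0 : (Measure.pi fun _ : {i // i ≠ a} => Λ).prod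
        (Measure.pi fun _ : {i // ¬ i ≠ a} => Λ) T = 0 := by
      rw [Measure.measure_prod_null hT]
      refine Filter.Eventually.of_forall fun y => ?_
      exact Measure.pi_eval_preimage_null (fun _ : {i // ¬ i ≠ a} => Λ) (i := a')
        (h.measure_level (q (y b')))
    rw [← he.measure_preimage hT.nullMeasurableSet] at h0
    rw [ae_iff]
    convert! h0 using 2
    ext x
    simp [T, MeasurableEquiv.piEquivPiSubtypeProd, Equiv.piEquivPiSubtypeProd, a', b']
  have := fun a b => ae_all_iff.2 fun hab : a ≠ b => key a b hab
  filter_upwards [ae_all_iff.2 fun a => ae_all_iff.2 fun b => this a b] with x hx a b hab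
  by_contra hne
  exact hx a b hne hab

end IsDiffuseFor

lemma two_le_count {Ω S : Type*} [MeasurableSpace S] (X : ℕ → Ω → S) (ω : Ω)
    {A : Set S} (hA : MeasurableSet A) {i j : ℕ}
    (hij : i ≠ j) (hi : X i ω ∈ A) (hj : X j ω ∈ A) : 2 ≤ countingMeasure X ω A := by
  rw [countingMeasure_apply X ω hA]
  refine le_trans ?_ (ENNReal.sum_le_tsum {i, j})
  rw [Finset.sum_pair hij, Set.indicator_of_mem hi, Set.indicator_of_mem hj]
  norm_num

namespace IsPoissonProcess

variable {Ω S : Type*} [MeasurableSpace Ω] [MeasurableSpace S] {P : Measure Ω}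
  {X : ℕ → Ω → S} {Λ : Measure S} {q : S → ℝ}

lemma ae_injective (hX : IsPoissonProcess P X Λ) (hq : IsDiffuseFor Λ q) :
    ∀ᵐ ω ∂P, Function.Injective fun i => q (X i ω) := by
  obtain ⟨K, hK⟩ := hq.exists_bound
  have key : ∀ R : ℕ, ∀ᵐ ω ∂P, ∀ i j, i ≠ j → |q (X i ω)| < R → q (X i ω) ≠ q (X j ω) := by
    intro R
    rw [ae_iff]
    refine le_antisymm (ge_of_tendsto' (tendsto_const_div_succ (K := 2 * R * (K : ℝ≥0∞) ^ 2)
      (by finiteness)) fun n => ?_) zero_le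
    let c : Finset ℤ := Finset.Ico (-(((n + 1) * R : ℕ) : ℤ)) (((n + 1) * R : ℕ) : ℤ)
    calc P {ω | ¬ ∀ i j, i ≠ j → |q (X i ω)| < R → q (X i ω) ≠ q (X j ω)}
        ≤ P (⋃ k ∈ c, {ω | 2 ≤ countingMeasure X ω (slab q (n + 1) k)}) := by
          refine measure_mono fun ω hω => ?_
          simp only [Set.mem_ofPred_eq, not_forall, not_not] at hω
          obtain ⟨i, j, hij, hR, h⟩ := hω
          simp only [Set.mem_iUnion, exists_prop]
          refine ⟨⌊((n + 1 : ℕ) : ℝ) * q (X i ω)⌋, ?_,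
            two_le_count X ω (measurableSet_slab hq.measurable _ _) hij rfl (by rw [h]; rfl)⟩
          have hn : (0 : ℝ) < ((n + 1 : ℕ) : ℝ) := by positivity
          rw [abs_lt] at hR
          rw [Finset.mem_Ico, Int.le_floor, Int.floor_lt]
          push_cast at hn ⊢
          constructor <;> nlinarith
      _ ≤ ∑ k ∈ c, P {ω | 2 ≤ countingMeasure X ω (slab q (n + 1) k)} :=
          measure_biUnion_finset_le _ _
      _ ≤ ∑ k ∈ c, ((K : ℝ≥0∞) / (n + 1 : ℕ)) ^ 2 := by
          refine Finset.sum_le_sum fun k _ => ?_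
          refine (hX.measure_two_le_count (measurableSet_slab hq.measurable _ _)
            (hq.measure_slab_ne_top n k)).trans ?_
          gcongr
          exact hK n k
      _ = 2 * R * (K : ℝ≥0∞) ^ 2 / (n + 1 : ℕ) := by
          have hc : c.card = 2 * ((n + 1) * R) := by simp only [c, Int.card_Ico]; omega
          rw [Finset.sum_const, hc, nsmul_eq_mul]
          have hn0 : ((n + 1 : ℕ) : ℝ≥0∞) ≠ 0 := by positivity
          have hn1 : ((n + 1 : ℕ) : ℝ≥0∞) ≠ ∞ := ENNReal.natCast_ne_top _
          rw [div_eq_mul_inv, div_eq_mul_inv, mul_pow, pow_two ((n + 1 : ℕ) : ℝ≥0∞)⁻¹]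
          push_cast
          push_cast at hn0 hn1
          calc (2 * (((n : ℝ≥0∞) + 1) * R)) * ((K : ℝ≥0∞) ^ 2 * (((n : ℝ≥0∞) + 1)⁻¹ * ((n : ℝ≥0∞) + 1)⁻¹))
              = (2 * R * (K : ℝ≥0∞) ^ 2 * ((n : ℝ≥0∞) + 1)⁻¹) * (((n : ℝ≥0∞) + 1) * ((n : ℝ≥0∞) + 1)⁻¹) := by ring
            _ = _ := by rw [ENNReal.mul_inv_cancel hn0 hn1, mul_one]
  filter_upwards [ae_all_iff.2 key] with ω hω i j hij
  by_contra hne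
  obtain ⟨R, hR⟩ := exists_nat_gt |q (X i ω)|
  exact hω R i j hne hR hij

/-- **Campbell's formula** for the factorial moment measures of a Poisson process. -/
theorem lintegral_tupleSum (hX : IsPoissonProcess P X Λ) [SigmaFinite Λ] (hq : IsDiffuseFor Λ q)
    {ι : Type*} [Fintype ι] {f : (ι → S) → ℝ≥0∞} (hf : Measurable f) :
    ∫⁻ ω, tupleSum X f ω ∂P = ∫⁻ x, f x ∂(Measure.pi fun _ => Λ) := by
  have hmeas : ∀ I : ι ↪ ℕ, Measurable fun ω a => X (I a) ω := fun I =>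
    measurable_pi_lambda _ fun a => hX.measurable (I a)
  let M : Measure (ι → S) := Measure.sum fun I : ι ↪ ℕ => P.map fun ω a => X (I a) ω
  have hM : ∀ g : (ι → S) → ℝ≥0∞, Measurable g → ∫⁻ x, g x ∂M = ∫⁻ ω, tupleSum X g ω ∂P := by
    intro g hg
    simp only [M, tupleSum]
    rw [lintegral_sum_measure, lintegral_tsum (f := fun (I : ι ↪ ℕ) ω => g fun a => X (I a) ω)
      fun I => (hg.comp (hmeas I)).aemeasurable]
    exact tsum_congr fun I => lintegral_map hg (hmeas I)
  rw [← hM f hf]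
  suffices h : M = Measure.pi fun _ => Λ by rw [h]
  let T := ℕ × (ι ↪ ℤ)
  have : Countable (ι ↪ ℤ) :=
    Function.Injective.countable (f := fun I : ι ↪ ℤ => (I : ι → ℤ)) DFunLike.coe_injective
  let R : T → Set (ι → S) := fun t => Set.univ.pi fun a => slab q (t.1 + 1) (t.2 a)
  have hR : ∀ x : ι → S, (Function.Injective fun a => q (x a)) → x ∈ ⋃ t, R t := by
    intro x hx
    obtain ⟨n, hn⟩ : ∃ n : ℕ, ∀ a b, a ≠ b → 1 < ((n + 1 : ℕ) : ℝ) * |q (x a) - q (x b)| := by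
      have hab : ∀ p : ι × ι, ∀ᶠ n : ℕ in atTop,
          p.1 ≠ p.2 → 1 < ((n + 1 : ℕ) : ℝ) * |q (x p.1) - q (x p.2)| := by
        rintro ⟨a, b⟩
        by_cases hne : a = b
        · simp [hne]
        · have hpos : 0 < |q (x a) - q (x b)| := abs_pos.2 (sub_ne_zero.2 (hx.ne hne))
          have := ((tendsto_natCast_atTop_atTop (R := ℝ)).comp
            (tendsto_add_atTop_nat 1)).atTop_mul_const hpos
          filter_upwards [this.eventually_gt_atTop 1] with n hn _
          exact hn
      obtain ⟨n, hn⟩ := (eventually_all.2 hab).exists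
      exact ⟨n, fun a b hne => hn (a, b) hne⟩
    refine Set.mem_iUnion.2 ⟨⟨n, ⟨fun a => ⌊((n + 1 : ℕ) : ℝ) * q (x a)⌋, ?_⟩⟩, fun a _ => rfl⟩
    intro a b hab
    by_contra hne
    have h1 := Int.abs_sub_lt_one_of_floor_eq_floor hab
    rw [← mul_sub, abs_mul, abs_of_pos (by positivity)] at h1
    exact absurd (hn a b hne) (not_lt.2 h1.le)
  have hres : M.restrict (⋃ t, R t) = (Measure.pi fun _ => Λ).restrict (⋃ t, R t) := by
    rw [Measure.restrict_iUnion_congr]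
    rintro ⟨n, c⟩
    have hs := fun a => measurableSet_slab hq.measurable (n + 1) (c a)
    simp only [R]
    rw [Measure.restrict_pi_pi]
    symm
    refine Measure.pi_eq fun s hs' => ?_
    rw [Measure.restrict_apply (MeasurableSet.univ_pi hs'), ← Set.pi_inter_distrib,
      ← lintegral_indicator_one (MeasurableSet.univ_pi fun a => (hs' a).inter (hs a)),
      hM _ (measurable_one.indicator (MeasurableSet.univ_pi fun a => (hs' a).inter (hs a)))]
    simp_rw [Measure.restrict_apply (hs' _)]
    refine hX.lintegral_tupleSum_rectangle (fun a => (hs' a).inter (hs a)) (fun a b hab => ?_)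
      fun a => ne_top_of_le_ne_top (hq.measure_slab_ne_top n (c a))
        (measure_mono Set.inter_subset_right)
    refine Set.disjoint_left.2 fun x hxa hxb => hab (c.injective ?_)
    exact (hxa.2 : _ = _).symm.trans hxb.2
  rw [Measure.restrict_eq_self_of_ae_mem, Measure.restrict_eq_self_of_ae_mem] at hres
  · exact hres
  · filter_upwards [hq.ae_pi_injective ι] with x hx using hR x hx
  · simp only [M]
    rw [Measure.ae_sum_iff']
    · intro I
      have hD : MeasurableSet (⋃ t, R t) := MeasurableSet.iUnion fun t =>
        MeasurableSet.univ_pi fun a => measurableSet_slab hq.measurable _ _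
      refine (ae_map_iff (p := fun x => x ∈ ⋃ t, R t) (hmeas I).aemeasurable hD).2 ?_
      filter_upwards [hX.ae_injective hq] with ω hω
      exact hR _ fun a b hab => I.injective (hω hab)
    · exact MeasurableSet.iUnion fun t =>
        MeasurableSet.univ_pi fun a => measurableSet_slab hq.measurable _ _

end IsPoissonProcess

/-! ### The characteristic functional -/

section FiniteWindow

variable {Ω S : Type*} {X : ℕ → Ω → S} {ω : Ω} {W : Set S}

lemma finite_setOf_mem_of_count_ne_top [MeasurableSpace S]
    (hW : MeasurableSet W) (h : countingMeasure X ω W ≠ ∞) :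
    {j | X j ω ∈ W}.Finite := by
  rw [countingMeasure_apply X ω hW] at h
  refine (ENNReal.finite_const_le_of_tsum_ne_top h one_ne_zero).subset fun j hj => ?_
  simp only [Set.mem_ofPred_eq] at hj ⊢
  rw [Set.indicator_of_mem hj]

lemma tsum_eq_sum_window {E : Type*} [AddCommMonoid E] [TopologicalSpace E] {G : S → E}
    (hG : ∀ x, x ∉ W → G x = 0) (h : {j | X j ω ∈ W}.Finite) :
    ∑' j, G (X j ω) = ∑ j ∈ h.toFinset, G (X j ω) :=
  tsum_eq_sum fun j hj => hG _ (by simpa using hj)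

lemma toReal_countingMeasure [MeasurableSpace S] {A : Set S} (hA : MeasurableSet A) (hAW : A ⊆ W)
    (h : {j | X j ω ∈ W}.Finite) :
    (countingMeasure X ω A).toReal =
      ∑ j ∈ h.toFinset, A.indicator (fun _ => (1 : ℝ)) (X j ω) := by
  rw [countingMeasure_apply X ω hA, tsum_eq_sum_window (W := W) _ h,
    ENNReal.toReal_sum]
  · refine Finset.sum_congr rfl fun j _ => ?_
    by_cases hj : X j ω ∈ A <;> simp [hj]
  · intro j _
    by_cases hj : X j ω ∈ A <;> simp [hj]
  · exact fun x hx => Set.indicator_of_notMem (fun h => hx (hAW h)) _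

end FiniteWindow

namespace IsPoissonProcess

variable {Ω S : Type*} [MeasurableSpace Ω] [MeasurableSpace S] {P : Measure Ω}
  {X : ℕ → Ω → S} {Λ : Measure S} {W : Set S}

lemma integral_exp_count (hX : IsPoissonProcess P X Λ) {A : Set S} (hA : MeasurableSet A)
    (hfin : Λ A ≠ ∞) (s : ℝ) :
    ∫ ω, Complex.exp (((s * (countingMeasure X ω A).toReal : ℝ) : ℂ) * Complex.I) ∂P =
      Complex.exp ((Λ A).toReal * (Complex.exp (s * Complex.I) - 1)) := by
  have hm : Measurable fun x : ℝ≥0∞ => Complex.exp (((s * x.toReal : ℝ) : ℂ) * Complex.I) := by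
    fun_prop
  refine (integral_map (f := fun x : ℝ≥0∞ => Complex.exp (((s * x.toReal : ℝ) : ℂ) * Complex.I))
    (hX.measurable_count hA).aemeasurable hm.aestronglyMeasurable).symm.trans ?_
  rw [hX.law_count A hA hfin, integral_map .of_discrete hm.aestronglyMeasurable]
  have h := charFun_map_cast_poissonMeasure (Λ A).toNNReal s
  rw [charFun_apply, integral_map .of_discrete (by fun_prop)] at h
  simp only [Real.inner_apply] at h
  convert h using 4 with n
  · simp [mul_comm]
  · rfl

lemma measurable_tsum_comp (hX : IsPoissonProcess P X Λ) {G : S → ℝ} (hG : Measurable G) :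
    Measurable fun ω => ∑' j, G (X j ω) :=
  Measurable.tsum fun j => hG.comp (hX.measurable j)

lemma integral_exp_tsum_simpleFunc [IsProbabilityMeasure P] (hX : IsPoissonProcess P X Λ)
    (hW : MeasurableSet W) (hΛW : Λ W ≠ ∞) (G : SimpleFunc S ℝ) (hG : ∀ x, x ∉ W → G x = 0) :
    ∫ ω, Complex.exp (((∑' j, G (X j ω) : ℝ) : ℂ) * Complex.I) ∂P =
      Complex.exp (∫ x, (Complex.exp ((G x : ℂ) * Complex.I) - 1) ∂Λ) := by
  classical
  let V := G.range.filter (· ≠ 0)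
  let A : V → Set S := fun v => G ⁻¹' {(v : ℝ)}
  have hA : ∀ v, MeasurableSet (A v) := fun v => G.measurableSet_fiber v
  have hAW : ∀ v, A v ⊆ W := by
    intro v x hx
    by_contra hxW
    have hv := (Finset.mem_filter.1 v.2).2
    exact hv ((show G x = v from hx) ▸ hG x hxW)
  have hAfin : ∀ v, Λ (A v) ≠ ∞ := fun v => ne_top_of_le_ne_top hΛW (measure_mono (hAW v))
  have hd : Pairwise fun a b => Disjoint (A a) (A b) := by
    intro a b hab
    refine Set.disjoint_left.2 fun x hxa hxb => hab (Subtype.ext ?_)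
    exact (show G x = a from hxa).symm.trans hxb
  have hexp : ∀ (F : ℝ → ℂ), F 0 = 0 → ∀ x,
      F (G x) = ∑ v : V, (A v).indicator (fun _ => F v) x := by
    intro F hF x
    by_cases hx : G x = 0
    · rw [hx, hF]
      refine (Finset.sum_eq_zero fun v _ => Set.indicator_of_notMem (fun hxv => ?_) _).symm
      exact (Finset.mem_filter.1 v.2).2 ((show G x = v from hxv) ▸ hx)
    · let v : V := ⟨G x, Finset.mem_filter.2 ⟨G.mem_range_self x, hx⟩⟩
      rw [Finset.sum_eq_single_of_mem v (Finset.mem_univ _), Set.indicator_of_mem (show x ∈ A v from rfl)]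
      intro b _ hb
      exact Set.indicator_of_notMem (fun hxb => hb (Subtype.ext (show G x = b from hxb).symm)) _
  have hsum : ∀ᵐ ω ∂P, Complex.exp (((∑' j, G (X j ω) : ℝ) : ℂ) * Complex.I) =
      ∏ v : V, Complex.exp ((((v : ℝ) * (countingMeasure X ω (A v)).toReal : ℝ) : ℂ) *
        Complex.I) := by
    filter_upwards [hX.ae_count_lt_top hW hΛW] with ω hω
    have hF := finite_setOf_mem_of_count_ne_top hW hω.ne
    rw [← Complex.exp_sum, ← Finset.sum_mul, tsum_eq_sum_window hG hF]
    congr 2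
    push_cast
    simp_rw [toReal_countingMeasure (hA _) (hAW _) hF]
    push_cast
    simp_rw [Finset.mul_sum]
    rw [Finset.sum_comm]
    refine Finset.sum_congr rfl fun j _ => ?_
    rw [hexp (fun x => (x : ℂ)) (by simp) (X j ω)]
    refine Finset.sum_congr rfl fun v _ => ?_
    by_cases hj : X j ω ∈ A v <;> simp [hj]
  have hind : iIndepFun (fun (v : V) ω =>
      Complex.exp ((((v : ℝ) * (countingMeasure X ω (A v)).toReal : ℝ) : ℂ) * Complex.I)) P :=
    (hX.iIndepFun_count hA hd).comp
      (fun v x => Complex.exp ((((v : ℝ) * x.toReal : ℝ) : ℂ) * Complex.I)) fun v => by fun_prop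
  have hm : ∀ v : V, AEStronglyMeasurable (fun ω =>
      Complex.exp ((((v : ℝ) * (countingMeasure X ω (A v)).toReal : ℝ) : ℂ) * Complex.I)) P := by
    intro v
    have := hX.measurable_count (hA v)
    exact Measurable.aestronglyMeasurable (by fun_prop)
  rw [integral_congr_ae hsum, hind.integral_fun_prod_eq_prod_integral hm]
  simp_rw [hX.integral_exp_count (hA _) (hAfin _)]
  rw [← Complex.exp_sum]
  congr 1
  simp_rw [hexp (fun x => Complex.exp ((x : ℂ) * Complex.I) - 1) (by simp)]
  rw [integral_finsetSum]
  · refine Finset.sum_congr rfl fun v _ => ?_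
    rw [integral_indicator_const _ (hA v), Measure.real, Complex.real_smul]
  · intro v _
    exact (integrable_indicator_iff (hA v)).2 (integrableOn_const (hAfin v))

/-- The characteristic functional of a Poisson process. -/
theorem integral_exp_tsum [IsProbabilityMeasure P] (hX : IsPoissonProcess P X Λ)
    (hW : MeasurableSet W) (hΛW : Λ W ≠ ∞) {G : S → ℝ} (hGm : Measurable G)
    (hG : ∀ x, x ∉ W → G x = 0) :
    ∫ ω, Complex.exp (((∑' j, G (X j ω) : ℝ) : ℂ) * Complex.I) ∂P =
      Complex.exp (∫ x, (Complex.exp ((G x : ℂ) * Complex.I) - 1) ∂Λ) := by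
  let Gn : ℕ → SimpleFunc S ℝ := fun n =>
    SimpleFunc.approxOn G hGm Set.univ 0 (Set.mem_univ 0) n
  have hlim : ∀ x, Tendsto (fun n => Gn n x) atTop (𝓝 (G x)) := fun x =>
    SimpleFunc.tendsto_approxOn hGm (Set.mem_univ 0) (by simp)
  have hGn : ∀ n x, x ∉ W → Gn n x = 0 := by
    intro n x hx
    have := SimpleFunc.norm_approxOn_zero_le hGm (Set.mem_univ 0) x n
    rw [hG x hx] at this
    simpa using this
  have h1 : Tendsto (fun n => ∫ ω, Complex.exp (((∑' j, Gn n (X j ω) : ℝ) : ℂ) * Complex.I) ∂P)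
      atTop (𝓝 (∫ ω, Complex.exp (((∑' j, G (X j ω) : ℝ) : ℂ) * Complex.I) ∂P)) := by
    refine tendsto_integral_of_dominated_convergence (fun _ => 1) (fun n => ?_)
      (integrable_const _) (fun n => ?_) ?_
    · have := hX.measurable_tsum_comp (Gn n).measurable
      exact Measurable.aestronglyMeasurable (by fun_prop)
    · exact .of_forall fun ω => (Complex.norm_exp_ofReal_mul_I _).le
    · filter_upwards [hX.ae_count_lt_top hW hΛW] with ω hω
      have hF := finite_setOf_mem_of_count_ne_top hW hω.ne
      rw [tsum_eq_sum_window hG hF]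
      simp_rw [tsum_eq_sum_window (hGn _) hF]
      refine Tendsto.cexp (Tendsto.mul_const _ ?_)
      exact (Complex.continuous_ofReal.tendsto _).comp
        (tendsto_finsetSum _ fun j _ => hlim (X j ω))
  have h2 : Tendsto (fun n => ∫ x, (Complex.exp ((Gn n x : ℂ) * Complex.I) - 1) ∂Λ) atTop
      (𝓝 (∫ x, (Complex.exp ((G x : ℂ) * Complex.I) - 1) ∂Λ)) := by
    refine tendsto_integral_of_dominated_convergence (W.indicator fun _ => 2) (fun n => ?_)
      ((integrable_indicator_iff hW).2 (integrableOn_const hΛW)) (fun n => ?_) ?_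
    · have := (Gn n).measurable
      exact Measurable.aestronglyMeasurable (by fun_prop)
    · refine .of_forall fun x => ?_
      by_cases hx : x ∈ W
      · rw [Set.indicator_of_mem hx]
        refine (norm_sub_le _ _).trans ?_
        rw [Complex.norm_exp_ofReal_mul_I, norm_one]
        norm_num
      · simp [hx, hGn n x hx]
    · refine .of_forall fun x => ?_
      refine Tendsto.sub_const (Tendsto.cexp (Tendsto.mul_const _ ?_)) _
      exact (Complex.continuous_ofReal.tendsto _).comp (hlim x)
  refine tendsto_nhds_unique h1 ?_
  simp_rw [hX.integral_exp_tsum_simpleFunc hW hΛW (Gn _) (hGn _)]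
  exact h2.cexp

end IsPoissonProcess

/-! ### Products of sums over tuples -/

section Products

variable {Ω S : Type*}

/-- The tensor product of two kernels. -/
def tensorKernel {ι κ : Type*} (f : (ι → S) → ℝ≥0∞) (h : (κ → S) → ℝ≥0∞)
    (x : ι ⊕ κ → S) : ℝ≥0∞ :=
  f (fun a => x (.inl a)) * h (fun b => x (.inr b))

/-- The product of two kernels after identification of argument `a` of the first one with
argument `b` of the second one. -/
def contractKernel {ι : Type*} {n : ℕ} (f : (ι → S) → ℝ≥0∞) (h : (Fin (n + 1) → S) → ℝ≥0∞)
    (a : ι) (b : Fin (n + 1)) (x : ι ⊕ Fin n → S) : ℝ≥0∞ :=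
  f (fun i => x (.inl i)) * h (b.insertNth (x (.inl a)) fun j => x (.inr j))

/-- The pairs of arguments in which two tuples of indices coincide. -/
def coincidences {ι κ : Type*} [Fintype ι] [Fintype κ] (p : (ι ↪ ℕ) × (κ ↪ ℕ)) :
    Finset (ι × κ) :=
  Finset.univ.filter fun c => p.1 c.1 = p.2 c.2

lemma mem_coincidences {ι κ : Type*} [Fintype ι] [Fintype κ] {p : (ι ↪ ℕ) × (κ ↪ ℕ)}
    {c : ι × κ} : c ∈ coincidences p ↔ p.1 c.1 = p.2 c.2 := by
  simp [coincidences]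

lemma tsum_coincidences_empty {ι κ : Type*} [Fintype ι] [Fintype κ] (Y : ℕ → Ω → S)
    (f : (ι → S) → ℝ≥0∞) (h : (κ → S) → ℝ≥0∞) (ω : Ω) :
    ∑' p : (ι ↪ ℕ) × (κ ↪ ℕ), {p | coincidences p = ∅}.indicator
      (fun p => f (fun a => Y (p.1 a) ω) * h (fun b => Y (p.2 b) ω)) p =
      tupleSum Y (tensorKernel f h) ω := by
  let g : (ι ⊕ κ ↪ ℕ) → (ι ↪ ℕ) × (κ ↪ ℕ) := fun u =>
    (Function.Embedding.inl.trans u, Function.Embedding.inr.trans u)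
  have hg : Function.Injective g := by
    intro u v huv
    simp only [g, Prod.mk.injEq, DFunLike.ext_iff] at huv
    ext (a | b)
    · exact huv.1 a
    · exact huv.2 b
  have hmem : ∀ u, coincidences (g u) = ∅ := by
    intro u
    refine Finset.eq_empty_of_forall_notMem fun c hc => ?_
    rw [mem_coincidences] at hc
    exact Sum.inl_ne_inr (u.injective hc)
  rw [← hg.tsum_eq]
  · refine tsum_congr fun u => ?_
    rw [Set.indicator_of_mem (s := {p | coincidences p = ∅}) (hmem u)]
    rfl
  · intro p hp
    have hp0 : coincidences p = ∅ :=
      Set.mem_of_indicator_ne_zero (s := {p | coincidences p = ∅}) (Function.mem_support.1 hp)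
    have hne : ∀ a b, p.1 a ≠ p.2 b := fun a b hab =>
      Finset.notMem_empty (a, b) (hp0 ▸ mem_coincidences.2 hab)
    refine ⟨⟨Sum.elim p.1 p.2, ?_⟩, rfl⟩
    exact p.1.injective.sumElim p.2.injective hne

lemma tsum_coincidences_singleton {ι : Type*} [Fintype ι] {n : ℕ} (Y : ℕ → Ω → S)
    (f : (ι → S) → ℝ≥0∞) (h : (Fin (n + 1) → S) → ℝ≥0∞) (a : ι) (b : Fin (n + 1)) (ω : Ω) :
    ∑' p : (ι ↪ ℕ) × (Fin (n + 1) ↪ ℕ), {p | coincidences p = {(a, b)}}.indicator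
      (fun p => f (fun a => Y (p.1 a) ω) * h (fun b => Y (p.2 b) ω)) p =
      tupleSum Y (contractKernel f h a b) ω := by
  have hinj : ∀ u : ι ⊕ Fin n ↪ ℕ, Function.Injective
      (b.insertNth (u (.inl a)) fun j => u (.inr j) : Fin (n + 1) → ℕ) := by
    intro u i j
    refine Fin.succAboveCases b ?_ (fun k => ?_) i <;>
      refine Fin.succAboveCases b ?_ (fun k' => ?_) j <;> simp
  let g : (ι ⊕ Fin n ↪ ℕ) → (ι ↪ ℕ) × (Fin (n + 1) ↪ ℕ) := fun u =>
    (Function.Embedding.inl.trans u, ⟨_, hinj u⟩)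
  have hg : Function.Injective g := by
    intro u v huv
    simp only [g, Prod.mk.injEq, DFunLike.ext_iff] at huv
    ext (i | j)
    · exact huv.1 i
    · have := huv.2 (b.succAbove j)
      simpa using this
  have hmem : ∀ u, coincidences (g u) = {(a, b)} := by
    intro u
    ext ⟨i, j⟩
    rw [mem_coincidences, Finset.mem_singleton]
    simp only [g, Function.Embedding.trans_apply, Function.Embedding.inl_apply,
      Function.Embedding.coeFn_mk, Prod.mk.injEq]
    refine Fin.succAboveCases b ?_ (fun k => ?_) j
    · simp
    · simp
  rw [← hg.tsum_eq]
  · refine tsum_congr fun u => ?_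
    rw [Set.indicator_of_mem (s := {p | coincidences p = {(a, b)}}) (hmem u)]
    simp only [g, contractKernel, Function.Embedding.trans_apply, Function.Embedding.inl_apply,
      Function.Embedding.coeFn_mk]
    congr 2
    ext j
    refine Fin.succAboveCases b ?_ (fun k => ?_) j
    · simp
    · simp
  · intro p hp
    have hp0 : coincidences p = {(a, b)} :=
      Set.mem_of_indicator_ne_zero (s := {p | coincidences p = {(a, b)}})
        (Function.mem_support.1 hp)
    have hiff : ∀ i j, p.1 i = p.2 j ↔ i = a ∧ j = b := fun i j => by
      rw [← mem_coincidences (p := p) (c := (i, j)), hp0]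
      simp
    refine ⟨⟨Sum.elim p.1 fun j => p.2 (b.succAbove j), ?_⟩, ?_⟩
    · refine p.1.injective.sumElim (p.2.injective.comp Fin.succAbove_right_injective) ?_
      intro i j hij
      exact Fin.succAbove_ne b j ((hiff i _).1 hij).2
    · refine Prod.ext rfl ?_
      ext j
      refine Fin.succAboveCases b ?_ (fun k => ?_) j
      · simpa [g] using (hiff a b).2 ⟨rfl, rfl⟩
      · simp [g]

lemma one_eq_sum_indicator_coincidences {ι κ : Type*} [Fintype ι] [Fintype κ]
    (F : (ι ↪ ℕ) × (κ ↪ ℕ) → ℝ≥0∞) (p : (ι ↪ ℕ) × (κ ↪ ℕ)) :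
    F p = {p | coincidences p = ∅}.indicator F p +
      ∑ c : ι × κ, {p | coincidences p = {c}}.indicator F p +
      {p | 1 < (coincidences p).card}.indicator F p := by
  classical
  rcases Nat.lt_trichotomy 1 (coincidences p).card with h | h | h
  · rw [Set.indicator_of_mem (s := {p | 1 < (coincidences p).card}) h,
      Set.indicator_of_notMem, Finset.sum_eq_zero]
    · simp
    · refine fun c _ => Set.indicator_of_notMem (fun hc => ?_) _
      rw [Set.mem_ofPred_eq] at hc
      simp [hc] at h
    · intro hc
      rw [Set.mem_ofPred_eq] at hc
      simp [hc] at h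
  · obtain ⟨c, hc⟩ := Finset.card_eq_one.1 h.symm
    rw [Finset.sum_eq_single_of_mem c (Finset.mem_univ _),
      Set.indicator_of_mem (s := {p | coincidences p = {c}}) hc, Set.indicator_of_notMem,
      Set.indicator_of_notMem]
    · simp
    · simp [hc]
    · simp [hc]
    · intro c' _ hne
      refine Set.indicator_of_notMem (fun hc' => hne ?_) _
      rw [Set.mem_ofPred_eq, hc] at hc'
      exact (Finset.singleton_injective hc').symm
  · have h0 : coincidences p = ∅ := Finset.card_eq_zero.1 (by omega)
    rw [Set.indicator_of_mem (s := {p | coincidences p = ∅}) h0, Finset.sum_eq_zero,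
      Set.indicator_of_notMem]
    · simp
    · simp [h0]
    · intro c _
      refine Set.indicator_of_notMem (fun hc => ?_) _
      rw [Set.mem_ofPred_eq, h0] at hc
      exact Finset.singleton_ne_empty c hc.symm

lemma tupleSum_mul_tupleSum {ι : Type*} [Fintype ι] {n : ℕ} (Y : ℕ → Ω → S)
    (f : (ι → S) → ℝ≥0∞) (h : (Fin (n + 1) → S) → ℝ≥0∞) (ω : Ω) :
    tupleSum Y f ω * tupleSum Y h ω = tupleSum Y (tensorKernel f h) ω +
      ∑ c : ι × Fin (n + 1), tupleSum Y (contractKernel f h c.1 c.2) ω +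
      ∑' p : (ι ↪ ℕ) × (Fin (n + 1) ↪ ℕ), {p | 1 < (coincidences p).card}.indicator
        (fun p => f (fun a => Y (p.1 a) ω) * h (fun b => Y (p.2 b) ω)) p := by
  rw [← tsum_coincidences_empty]
  simp_rw [← tsum_coincidences_singleton]
  rw [← Summable.tsum_finsetSum fun _ _ => ENNReal.summable, ← ENNReal.tsum_add,
    ← ENNReal.tsum_add]
  simp_rw [← one_eq_sum_indicator_coincidences]
  rw [ENNReal.tsum_prod']
  simp_rw [ENNReal.tsum_mul_left, ENNReal.tsum_mul_right]
  rfl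

variable {ι : Type*} [Fintype ι] {Y : ℕ → Ω → S} {ω : Ω} {W : Set S}

/-- The index pairs with two prescribed coincidences. -/
lemma card_two_coincidences_le {n : ℕ} (A : Finset ℕ) (a a' : ι) (b b' : Fin (n + 1))
    (hb : b ≠ b') :
    ∃ Q : Finset ((ι → ℕ) × (Fin (n + 1) → ℕ)),
      (∀ I J, (∀ i, I i ∈ A) → (∀ j, J j ∈ A) → I a = J b → I a' = J b' → (I, J) ∈ Q) ∧
      Q.card = A.card ^ (Fintype.card ι + n - 1) := by
  classical
  let B : (ι → ℕ) → Fin (n + 1) → Finset ℕ := fun I j =>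
    if j ∈ ({b, b'} : Finset _) then {if j = b then I a else I a'} else A
  have hB : ∀ I, (Fintype.piFinset (B I)).card = A.card ^ (n - 1) := by
    intro I
    rw [Fintype.card_piFinset]
    have : ∀ j, (B I j).card = if j ∈ ({b, b'} : Finset _) then 1 else A.card := by
      intro j
      simp only [B]
      split_ifs <;> simp
    simp_rw [this]
    rw [Finset.prod_ite, Finset.prod_const_one, one_mul, Finset.prod_const]
    congr 1
    rw [← Finset.compl_filter, Finset.card_compl, Finset.filter_mem_eq_inter,
      Finset.univ_inter, Finset.card_pair hb, Fintype.card_fin]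
    omega
  let Q := ((Fintype.piFinset fun _ : ι => A).sigma fun I => Fintype.piFinset (B I)).map
    (Equiv.sigmaEquivProd _ _).toEmbedding
  refine ⟨Q, fun I J hI hJ h1 h2 => ?_, ?_⟩
  · rw [Finset.mem_map]
    refine ⟨⟨I, J⟩, ?_, rfl⟩
    simp only [Finset.mem_sigma, Fintype.mem_piFinset]
    refine ⟨hI, fun j => ?_⟩
    simp only [B]
    split_ifs with hj hjb
    · subst hjb; simp [h1]
    · have : j = b' := by simpa [hjb] using hj
      subst this
      simp [h2]
    · exact hJ j
  · have hn : n ≠ 0 := by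
      rintro rfl
      exact hb (Subsingleton.elim (α := Fin 1) _ _)
    rw [show Fintype.card ι + n - 1 = Fintype.card ι + (n - 1) by omega, pow_add]
    simp [Q, Finset.card_sigma, hB, Fintype.card_piFinset]

lemma tsum_indicator_finset {ι : Type*} (R : Finset ι) (c : ℝ≥0∞) :
    ∑' z, (R : Set ι).indicator (fun _ => c) z = c * R.card := by
  rw [← tsum_subtype, Finset.tsum_subtype' R fun _ => c, Finset.sum_const, nsmul_eq_mul, mul_comm]

lemma tsum_one_lt_coincidences_le {n : ℕ} {f : (ι → S) → ℝ≥0∞} {h : (Fin (n + 1) → S) → ℝ≥0∞}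
    {C D : ℝ≥0∞} (hf : ∀ x, f x ≤ C) (hh : ∀ x, h x ≤ D)
    (hfW : ∀ x, (∃ i, x i ∉ W) → f x = 0) (hhW : ∀ x, (∃ i, x i ∉ W) → h x = 0)
    (A : Finset ℕ) (hA : ∀ j, Y j ω ∈ W → j ∈ A) :
    ∑' p : (ι ↪ ℕ) × (Fin (n + 1) ↪ ℕ), {p | 1 < (coincidences p).card}.indicator
        (fun p => f (fun a => Y (p.1 a) ω) * h (fun b => Y (p.2 b) ω)) p ≤
      C * D * ((Fintype.card ι ^ 2 * (n + 1) ^ 2 *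
        A.card ^ (Fintype.card ι + n - 1) : ℕ) : ℝ≥0∞) := by
  classical
  let T := {c : (ι × ι) × (Fin (n + 1) × Fin (n + 1)) // c.2.1 ≠ c.2.2}
  choose Q hQ hQc using fun c : T =>
    card_two_coincidences_le A c.1.1.1 c.1.1.2 c.1.2.1 c.1.2.2 c.2
  let R : Finset ((ι → ℕ) × (Fin (n + 1) → ℕ)) := Finset.univ.biUnion Q
  have hR : R.card ≤ Fintype.card ι ^ 2 * (n + 1) ^ 2 *
      A.card ^ (Fintype.card ι + n - 1) := by
    refine Finset.card_biUnion_le.trans ?_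
    simp_rw [hQc]
    rw [Finset.sum_const, smul_eq_mul, Finset.card_univ]
    refine Nat.mul_le_mul_right _ ((Fintype.card_subtype_le _).trans ?_)
    simp [pow_two]
  let g : (ι ↪ ℕ) × (Fin (n + 1) ↪ ℕ) → (ι → ℕ) × (Fin (n + 1) → ℕ) := fun p => (p.1, p.2)
  have hg : Function.Injective g := by
    intro p p' hp
    simp only [g, Prod.mk.injEq, DFunLike.coe_fn_eq] at hp
    exact Prod.ext hp.1 hp.2
  calc _ ≤ ∑' p, (R : Set _).indicator (fun _ => C * D) (g p) := by
        refine ENNReal.tsum_le_tsum fun p => ?_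
        by_cases hp : p ∈ {p : (ι ↪ ℕ) × (Fin (n + 1) ↪ ℕ) | 1 < (coincidences p).card}
        swap
        · rw [Set.indicator_of_notMem hp]; exact zero_le
        rw [Set.indicator_of_mem hp]
        by_cases h1 : ∀ i, Y (p.1 i) ω ∈ W
        swap
        · rw [hfW _ (by simpa using h1), zero_mul]; exact zero_le
        by_cases h2 : ∀ i, Y (p.2 i) ω ∈ W
        swap
        · rw [hhW _ (by simpa using h2), mul_zero]; exact zero_le
        have hmem : g p ∈ (R : Set _) := by
          obtain ⟨⟨a, b⟩, hab, ⟨a', b'⟩, hab', hne⟩ := Finset.one_lt_card.1 hp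
          rw [mem_coincidences] at hab hab'
          have hb : b ≠ b' := by
            rintro rfl
            exact hne (Prod.ext (p.1.injective (hab.trans hab'.symm)) rfl)
          rw [Finset.mem_coe, Finset.mem_biUnion]
          exact ⟨⟨((a, a'), (b, b')), hb⟩, Finset.mem_univ _,
            hQ ⟨((a, a'), (b, b')), hb⟩ _ _ (fun i => hA _ (h1 i)) (fun j => hA _ (h2 j))
              hab hab'⟩
        rw [Set.indicator_of_mem hmem]
        exact mul_le_mul' (hf _) (hh _)
    _ ≤ ∑' z, (R : Set ((ι → ℕ) × (Fin (n + 1) → ℕ))).indicator (fun _ => C * D) z :=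
        ENNReal.tsum_comp_le_tsum_of_injective hg _
    _ = C * D * R.card := tsum_indicator_finset R _
    _ ≤ _ := by gcongr

lemma tupleSum_le {f : (ι → S) → ℝ≥0∞} {C : ℝ≥0∞} (hf : ∀ x, f x ≤ C)
    (hfW : ∀ x, (∃ i, x i ∉ W) → f x = 0) (A : Finset ℕ) (hA : ∀ j, Y j ω ∈ W → j ∈ A) :
    tupleSum Y f ω ≤ C * (A.card : ℝ≥0∞) ^ Fintype.card ι := by
  classical
  calc _ ≤ ∑' I : ι ↪ ℕ, ((Fintype.piFinset fun _ : ι => A : Finset (ι → ℕ)) :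
        Set (ι → ℕ)).indicator (fun _ => C) (I : ι → ℕ) := by
        refine ENNReal.tsum_le_tsum fun I => ?_
        by_cases h1 : ∀ i, Y (I i) ω ∈ W
        · rw [Set.indicator_of_mem]
          · exact hf _
          · simpa using fun i => hA _ (h1 i)
        · rw [hfW _ (by simpa using h1)]; exact zero_le
    _ ≤ ∑' I : ι → ℕ, ((Fintype.piFinset fun _ : ι => A : Finset (ι → ℕ)) :
        Set (ι → ℕ)).indicator (fun _ => C) I :=
        ENNReal.tsum_comp_le_tsum_of_injective DFunLike.coe_injective _
    _ = _ := by
        rw [tsum_indicator_finset]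
        simp

lemma card_pow_le (A : Finset ℕ) (hA : ∀ j ∈ A, Y j ω ∈ W) (p : ℕ) :
    (A.card : ℝ≥0∞) ^ p ≤ ((2 * p) ^ p : ℕ) +
      2 ^ p * tupleSum Y ((Set.univ.pi fun _ : Fin p => W).indicator fun _ => 1) ω := by
  classical
  have h1 : ((A.card.descFactorial p : ℕ) : ℝ≥0∞) ≤
      tupleSum Y ((Set.univ.pi fun _ : Fin p => W).indicator fun _ => 1) ω := by
    let g : (Fin p ↪ A) → (Fin p ↪ ℕ) := fun u => u.trans (Function.Embedding.subtype _)
    have hg : Function.Injective g := by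
      intro u v huv
      ext i
      exact DFunLike.congr_fun huv i
    refine le_trans ?_ (ENNReal.tsum_comp_le_tsum_of_injective hg _)
    have : ∀ u : Fin p ↪ A, (Set.univ.pi fun _ : Fin p => W).indicator (fun _ => (1 : ℝ≥0∞))
        (fun a => Y (g u a) ω) = 1 := fun u =>
      Set.indicator_of_mem (s := Set.univ.pi fun _ : Fin p => W) (fun i _ => hA _ (u i).2) _
    simp_rw [this]
    rw [tsum_fintype, Finset.sum_const, Finset.card_univ, Fintype.card_embedding_eq]
    simp
  have h2 : A.card ^ p ≤ (2 * p) ^ p + 2 ^ p * A.card.descFactorial p := by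
    rcases le_total A.card (2 * p) with h | h
    · exact (Nat.pow_le_pow_left h p).trans (Nat.le_add_right _ _)
    · refine le_trans ?_ (Nat.le_add_left _ _)
      refine le_trans ?_ (Nat.mul_le_mul_left _ (Nat.pow_sub_le_descFactorial _ _))
      rw [← mul_pow]
      exact Nat.pow_le_pow_left (by omega) p
  calc (A.card : ℝ≥0∞) ^ p ≤ ((2 * p) ^ p : ℕ) + 2 ^ p * (A.card.descFactorial p : ℕ) := by
        exact_mod_cast h2
    _ ≤ _ := by gcongr

end Products

/-! ### Second moments of `U`-statistics of a Poisson process -/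

/-- `X` is a Poisson process with diffuse intensity measure `Λ`, whose restriction to the window
`W` is `t` times the probability measure `μ`. -/
structure IsPoissonWindow {Ω S : Type*} [MeasurableSpace Ω] [MeasurableSpace S] (P : Measure Ω)
    (X : ℕ → Ω → S) (Λ : Measure S) (W : Set S) (t : ℝ≥0) (μ : Measure S) : Prop where
  process : IsPoissonProcess P X Λ
  diffuse : ∃ q, IsDiffuseFor Λ q
  measurableSet : MeasurableSet W
  restrict : Λ.restrict W = t • μ

/-- A measurable kernel that is bounded by `C` and vanishes unless all arguments are in `W`. -/
structure IsWindowKernel {S ι : Type*} [MeasurableSpace S] (W : Set S) (C : ℝ≥0)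
    (f : (ι → S) → ℝ≥0∞) : Prop where
  measurable : Measurable f
  le : ∀ x, f x ≤ C
  zero : ∀ x, (∃ i, x i ∉ W) → f x = 0

/-- `f₁` is the function obtained from the kernel `f` by integrating all arguments but one. -/
structure IsProjection {S : Type*} [MeasurableSpace S] (μ : Measure S) {n : ℕ}
    (f : (Fin (n + 1) → S) → ℝ≥0∞) (f₁ : S → ℝ≥0∞) : Prop where
  measurable : Measurable f₁
  eq : ∀ a s, ∫⁻ y, f (Fin.insertNth a s y) ∂(Measure.pi fun _ : Fin n => μ) = f₁ s

lemma measurable_insertNth {S : Type*} [MeasurableSpace S] {n : ℕ} (b : Fin (n + 1)) :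
    Measurable fun z : S × (Fin n → S) => (Fin.insertNth b z.1 z.2 : Fin (n + 1) → S) :=
  (MeasurableEquiv.piFinSuccAbove (fun _ => S) b).symm.measurable

section Kernels

variable {S : Type*} [MeasurableSpace S] {μ : Measure S} [IsProbabilityMeasure μ] {W : Set S}

lemma IsProjection.le {n : ℕ} {f : (Fin (n + 1) → S) → ℝ≥0∞} {f₁ : S → ℝ≥0∞} {C : ℝ≥0}
    (h : IsProjection μ f f₁) (hf : ∀ x, f x ≤ C) (s : S) : f₁ s ≤ C := by
  rw [← h.eq 0 s]
  refine (lintegral_mono fun _ => hf _).trans ?_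
  simp

lemma IsProjection.zero {n : ℕ} {f : (Fin (n + 1) → S) → ℝ≥0∞} {f₁ : S → ℝ≥0∞} {C : ℝ≥0}
    (h : IsProjection μ f f₁) (hf : IsWindowKernel W C f) {s : S} (hs : s ∉ W) : f₁ s = 0 := by
  rw [← h.eq 0 s]
  have h0 : ∀ y : Fin n → S, f (Fin.insertNth 0 s y) = 0 := fun y =>
    hf.zero _ ⟨0, by simpa using hs⟩
  simp_rw [h0]
  simp

lemma lintegral_mul_eval {n : ℕ} {f : (Fin (n + 1) → S) → ℝ≥0∞} {f₁ g : S → ℝ≥0∞}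
    (h : IsProjection μ f f₁) (hf : Measurable f) (hg : Measurable g) (a : Fin (n + 1)) :
    ∫⁻ x, f x * g (x a) ∂(Measure.pi fun _ => μ) = ∫⁻ s, f₁ s * g s ∂μ := by
  have he := (measurePreserving_piFinSuccAbove (fun _ : Fin (n + 1) => μ) a).symm
  rw [← he.lintegral_comp (by fun_prop), lintegral_prod _ (by fun_prop)]
  refine lintegral_congr fun s => ?_
  rw [← h.eq a s, ← lintegral_mul_const (g s) (f := fun y => f (Fin.insertNth a s y))
    (hf.comp ((measurable_insertNth a).comp measurable_prodMk_left))]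
  refine lintegral_congr fun y => ?_
  simp [MeasurableEquiv.piFinSuccAbove, Fin.insertNthEquiv]

lemma lintegral_projection {n : ℕ} {f : (Fin (n + 1) → S) → ℝ≥0∞} {f₁ : S → ℝ≥0∞}
    (h : IsProjection μ f f₁) (hf : Measurable f) :
    ∫⁻ s, f₁ s ∂μ = ∫⁻ x, f x ∂(Measure.pi fun _ => μ) := by
  have := lintegral_mul_eval h hf (g := fun _ => 1) measurable_const 0
  simpa using this.symm

lemma lintegral_tensorKernel {ι κ : Type*} [Fintype ι] [Fintype κ] {f : (ι → S) → ℝ≥0∞}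
    {h : (κ → S) → ℝ≥0∞} (hf : Measurable f) (hh : Measurable h) :
    ∫⁻ x, tensorKernel f h x ∂(Measure.pi fun _ : ι ⊕ κ => μ) =
      (∫⁻ x, f x ∂(Measure.pi fun _ => μ)) * ∫⁻ x, h x ∂(Measure.pi fun _ => μ) := by
  have he := measurePreserving_sumPiEquivProdPi (fun _ : ι ⊕ κ => μ)
  rw [← lintegral_prod_mul hf.aemeasurable hh.aemeasurable, ← he.lintegral_comp (by fun_prop)]
  rfl

lemma measurable_contractKernel {ι : Type*} [Fintype ι] {n : ℕ} {f : (ι → S) → ℝ≥0∞}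
    {h : (Fin (n + 1) → S) → ℝ≥0∞} (hf : Measurable f) (hh : Measurable h) (a : ι)
    (b : Fin (n + 1)) : Measurable (contractKernel f h a b) := by
  refine Measurable.mul (by fun_prop) (hh.comp ((measurable_insertNth b).comp
    (f := fun x : ι ⊕ Fin n → S => (x (.inl a), fun j => x (.inr j))) (by fun_prop)))

lemma lintegral_contractKernel {n n' : ℕ} {f : (Fin (n + 1) → S) → ℝ≥0∞}
    {h : (Fin (n' + 1) → S) → ℝ≥0∞} {f₁ h₁ : S → ℝ≥0∞} (hf : Measurable f) (hh : Measurable h)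
    (hf₁ : IsProjection μ f f₁) (hh₁ : IsProjection μ h h₁) (a : Fin (n + 1)) (b : Fin (n' + 1)) :
    ∫⁻ x, contractKernel f h a b x ∂(Measure.pi fun _ : Fin (n + 1) ⊕ Fin n' => μ) =
      ∫⁻ s, f₁ s * h₁ s ∂μ := by
  have he := (measurePreserving_sumPiEquivProdPi (fun _ : Fin (n + 1) ⊕ Fin n' => μ)).symm
  rw [← lintegral_mul_eval hf₁ hf hh₁.measurable a,
    ← he.lintegral_comp (measurable_contractKernel hf hh a b),
    lintegral_prod (fun z => contractKernel f h a b
      ((MeasurableEquiv.sumPiEquivProdPi fun _ : Fin (n + 1) ⊕ Fin n' => S).symm z))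
      ((measurable_contractKernel hf hh a b).comp he.measurable).aemeasurable]
  refine lintegral_congr fun x => ?_
  rw [← hh₁.eq b, ← lintegral_const_mul]
  · rfl
  · exact hh.comp ((measurable_insertNth b).comp measurable_prodMk_left)

end Kernels

namespace IsPoissonWindow

variable {Ω S : Type*} [MeasurableSpace Ω] [MeasurableSpace S] {P : Measure Ω}
  {X : ℕ → Ω → S} {Λ : Measure S} [SigmaFinite Λ] {W : Set S} {t : ℝ≥0} {μ : Measure S}
  [IsProbabilityMeasure μ]

omit [SigmaFinite Λ] in
lemma measure_window (hX : IsPoissonWindow P X Λ W t μ) : Λ W = t := by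
  rw [← Measure.restrict_apply_univ, hX.restrict]
  simp

lemma lintegral_tupleSum (hX : IsPoissonWindow P X Λ W t μ) {ι : Type*} [Fintype ι]
    {f : (ι → S) → ℝ≥0∞} (hf : Measurable f) (hfW : ∀ x, (∃ i, x i ∉ W) → f x = 0) :
    ∫⁻ ω, tupleSum X f ω ∂P =
      (t : ℝ≥0∞) ^ Fintype.card ι * ∫⁻ x, f x ∂(Measure.pi fun _ => μ) := by
  obtain ⟨q, hq⟩ := hX.diffuse
  have h1 : (Measure.pi fun _ : ι => Λ).restrict (Set.univ.pi fun _ => W) =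
      ((t : ℝ≥0∞) ^ Fintype.card ι) • Measure.pi fun _ : ι => μ := by
    rw [Measure.restrict_pi_pi]
    refine Measure.pi_eq fun s hs => ?_
    have h2 : ∀ A, Λ.restrict W A = t * μ A := fun A => by rw [hX.restrict]; rfl
    simp_rw [h2]
    rw [Measure.smul_apply, Measure.pi_pi, Finset.prod_mul_distrib, Finset.prod_const,
      Finset.card_univ, smul_eq_mul]
  rw [hX.process.lintegral_tupleSum hq hf, ← smul_eq_mul, ← lintegral_smul_measure, ← h1,
    ← lintegral_indicator (MeasurableSet.univ_pi fun _ => hX.measurableSet)]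
  refine lintegral_congr fun x => ?_
  by_cases hx : x ∈ Set.univ.pi fun _ : ι => W
  · rw [Set.indicator_of_mem hx]
  · rw [Set.indicator_of_notMem hx, hfW x (by simpa using hx)]

omit [SigmaFinite Λ] in
lemma ae_exists_window (hX : IsPoissonWindow P X Λ W t μ) :
    ∀ᵐ ω ∂P, ∃ A : Finset ℕ, ∀ j, X j ω ∈ W ↔ j ∈ A := by
  filter_upwards [hX.process.ae_count_lt_top hX.measurableSet
    (by rw [hX.measure_window]; exact ENNReal.coe_ne_top)] with ω hω
  have hF := finite_setOf_mem_of_count_ne_top hX.measurableSet hω.ne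
  exact ⟨hF.toFinset, fun j => by simp⟩

/-- The indicator kernel of the window. -/
abbrev windowKernel (W : Set S) (p : ℕ) : (Fin p → S) → ℝ≥0∞ :=
  (Set.univ.pi fun _ : Fin p => W).indicator fun _ => 1

lemma lintegral_windowKernel (hX : IsPoissonWindow P X Λ W t μ) (p : ℕ) :
    ∫⁻ ω, tupleSum X (windowKernel W p) ω ∂P ≤ (t : ℝ≥0∞) ^ p := by
  rw [hX.lintegral_tupleSum (measurable_const.indicator (MeasurableSet.univ_pi fun _ =>
    hX.measurableSet)) fun x hx => Set.indicator_of_notMem (by simpa using hx) _, Fintype.card_fin]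
  calc _ ≤ (t : ℝ≥0∞) ^ p * ∫⁻ x : Fin p → S, 1 ∂(Measure.pi fun _ => μ) := by
        gcongr
        exact Set.indicator_le_self' (by simp) _
    _ = _ := by simp

omit [SigmaFinite Λ] in
lemma ae_mul_le (hX : IsPoissonWindow P X Λ W t μ) {n n' : ℕ}
    {f : (Fin (n + 1) → S) → ℝ≥0∞} {h : (Fin (n' + 1) → S) → ℝ≥0∞} {C D : ℝ≥0}
    (hf : IsWindowKernel W C f) (hh : IsWindowKernel W D h) :
    ∀ᵐ ω ∂P, tupleSum X f ω * tupleSum X h ω ≤ tupleSum X (tensorKernel f h) ω +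
      ∑ c : Fin (n + 1) × Fin (n' + 1), tupleSum X (contractKernel f h c.1 c.2) ω +
      C * D * ((n + 1) ^ 2 * (n' + 1) ^ 2 : ℕ) * (((2 * (n + n')) ^ (n + n') : ℕ) +
        2 ^ (n + n') * tupleSum X (windowKernel W (n + n')) ω) := by
  filter_upwards [hX.ae_exists_window] with ω ⟨A, hA⟩
  rw [tupleSum_mul_tupleSum]
  refine add_le_add_right ?_ _
  refine (tsum_one_lt_coincidences_le hf.le hh.le hf.zero hh.zero A fun j => (hA j).1).trans ?_
  have h1 : Fintype.card (Fin (n + 1)) + n' - 1 = n + n' := by rw [Fintype.card_fin]; omega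
  rw [h1, Fintype.card_fin, Nat.cast_mul, mul_assoc (_ * _)]
  push_cast
  gcongr
  exact_mod_cast card_pow_le A (fun j hj => (hA j).2 hj) (n + n')

/-- The constant in the bound for second moments of `U`-statistics. -/
def momentConst (n n' : ℕ) (C D : ℝ≥0) : ℝ≥0 :=
  C * D * ((n + 1) ^ 2 * (n' + 1) ^ 2 : ℕ)

lemma lintegral_mul_bounds [IsProbabilityMeasure P] (hX : IsPoissonWindow P X Λ W t μ) {n n' : ℕ}
    {f : (Fin (n + 1) → S) → ℝ≥0∞} {h : (Fin (n' + 1) → S) → ℝ≥0∞} {f₁ h₁ : S → ℝ≥0∞} {C D : ℝ≥0}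
    (hf : IsWindowKernel W C f) (hh : IsWindowKernel W D h)
    (hf₁ : IsProjection μ f f₁) (hh₁ : IsProjection μ h h₁) :
    let M := (t : ℝ≥0∞) ^ (n + 1 + (n' + 1)) * ((∫⁻ x, f x ∂(Measure.pi fun _ => μ)) *
      ∫⁻ x, h x ∂(Measure.pi fun _ => μ)) +
      ((n + 1) * (n' + 1) : ℕ) * ((t : ℝ≥0∞) ^ (n + 1 + n') * ∫⁻ s, f₁ s * h₁ s ∂μ)
    M ≤ ∫⁻ ω, tupleSum X f ω * tupleSum X h ω ∂P ∧
    ∫⁻ ω, tupleSum X f ω * tupleSum X h ω ∂P ≤ M + momentConst n n' C D *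
      (((2 * (n + n')) ^ (n + n') : ℕ) + 2 ^ (n + n') * (t : ℝ≥0∞) ^ (n + n')) := by
  intro M
  have hXm := hX.process.measurable
  have hT : Measurable (tensorKernel f h) := by
    have := hf.measurable; have := hh.measurable
    unfold tensorKernel
    fun_prop
  have hC : ∀ c : Fin (n + 1) × Fin (n' + 1), Measurable (contractKernel f h c.1 c.2) :=
    fun c => measurable_contractKernel hf.measurable hh.measurable _ _
  have hK : Measurable (windowKernel W (n + n')) :=
    measurable_const.indicator (MeasurableSet.univ_pi fun _ => hX.measurableSet)
  have h1 : ∫⁻ ω, (tupleSum X (tensorKernel f h) ω +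
      ∑ c : Fin (n + 1) × Fin (n' + 1), tupleSum X (contractKernel f h c.1 c.2) ω) ∂P = M := by
    rw [lintegral_add_left (measurable_tupleSum hXm hT),
      lintegral_finsetSum _ fun c _ => measurable_tupleSum hXm (hC c),
      hX.lintegral_tupleSum hT, lintegral_tensorKernel hf.measurable hh.measurable]
    · congr 1
      · simp
      · rw [Finset.sum_congr rfl (g := fun _ => (t : ℝ≥0∞) ^ (n + 1 + n') * ∫⁻ s, f₁ s * h₁ s ∂μ)]
        · simp
        · intro c _
          rw [hX.lintegral_tupleSum (hC c),
            lintegral_contractKernel hf.measurable hh.measurable hf₁ hh₁]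
          · simp
          · rintro x ⟨i | j, hi⟩
            · rw [contractKernel, hf.zero _ ⟨i, hi⟩, zero_mul]
            · rw [contractKernel, hh.zero _ ⟨c.2.succAbove j, by simpa using hi⟩, mul_zero]
    · rintro x ⟨i | j, hi⟩
      · rw [tensorKernel, hf.zero _ ⟨i, hi⟩, zero_mul]
      · rw [tensorKernel, hh.zero _ ⟨j, hi⟩, mul_zero]
  constructor
  · rw [← h1]
    refine lintegral_mono fun ω => ?_
    rw [tupleSum_mul_tupleSum]
    exact le_self_add
  · refine (lintegral_mono_ae (hX.ae_mul_le hf hh)).trans ?_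
    have hm : Measurable fun ω => tupleSum X (tensorKernel f h) ω +
        ∑ c : Fin (n + 1) × Fin (n' + 1), tupleSum X (contractKernel f h c.1 c.2) ω :=
      (measurable_tupleSum hXm hT).add
        (Finset.measurable_sum _ fun c _ => measurable_tupleSum hXm (hC c))
    rw [lintegral_add_left hm, h1,
      lintegral_const_mul _ ((measurable_tupleSum hXm hK).const_mul _ |>.const_add _),
      lintegral_add_left measurable_const, lintegral_const_mul _ (measurable_tupleSum hXm hK)]
    simp only [momentConst]
    push_cast
    gcongr
    · simp
    · exact hX.lintegral_windowKernel _

end IsPoissonWindow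

/-! ### Normalized `U`-statistics -/

/-- The centred and normalized `U`-statistic with kernel `f` of order `n + 1`. -/
def normalizedSum {Ω S : Type*} [MeasurableSpace Ω] (P : Measure Ω) (X : ℕ → Ω → S) (t : ℝ≥0)
    {n : ℕ} (f : (Fin (n + 1) → S) → ℝ≥0∞) (ω : Ω) : ℝ :=
  ((tupleSum X f ω).toReal - ∫ ω', (tupleSum X f ω').toReal ∂P) / ((n + 1) * (t ^ n * √t))

namespace IsPoissonWindow

/-- The constant in the rate of convergence of second moments. -/
def rateConst (n n' : ℕ) (C D : ℝ≥0) : ℝ≥0 :=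
  momentConst n n' C D * (((2 * (n + n')) ^ (n + n') : ℕ) + 2 ^ (n + n'))

variable {Ω S : Type*} [MeasurableSpace Ω] [MeasurableSpace S] {P : Measure Ω}
  [IsProbabilityMeasure P] {X : ℕ → Ω → S} {Λ : Measure S} [SigmaFinite Λ] {W : Set S} {t : ℝ≥0}
  {μ : Measure S} [IsProbabilityMeasure μ] {n n' : ℕ}
  {f : (Fin (n + 1) → S) → ℝ≥0∞} {h : (Fin (n' + 1) → S) → ℝ≥0∞} {f₁ h₁ : S → ℝ≥0∞} {C D : ℝ≥0}

lemma lintegral_mul_ne_top (hX : IsPoissonWindow P X Λ W t μ)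
    (hf : IsWindowKernel W C f) (hh : IsWindowKernel W D h)
    (hf₁ : IsProjection μ f f₁) (hh₁ : IsProjection μ h h₁) :
    ∫⁻ ω, tupleSum X f ω * tupleSum X h ω ∂P ≠ ∞ := by
  have h1 : ∫⁻ x, f x ∂(Measure.pi fun _ => μ) ≠ ∞ := by
    refine ne_top_of_le_ne_top (ENNReal.coe_ne_top (r := C)) ((lintegral_mono hf.le).trans ?_)
    simp
  have h2 : ∫⁻ x, h x ∂(Measure.pi fun _ => μ) ≠ ∞ := by
    refine ne_top_of_le_ne_top (ENNReal.coe_ne_top (r := D)) ((lintegral_mono hh.le).trans ?_)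
    simp
  have h3 : ∫⁻ s, f₁ s * h₁ s ∂μ ≠ ∞ := by
    refine ne_top_of_le_ne_top (ENNReal.coe_ne_top (r := C * D))
      ((lintegral_mono fun s => mul_le_mul' (hf₁.le hf.le s) (hh₁.le hh.le s)).trans ?_)
    simp
  refine ne_top_of_le_ne_top ?_ (hX.lintegral_mul_bounds hf hh hf₁ hh₁).2
  finiteness

lemma memLp_tupleSum (hX : IsPoissonWindow P X Λ W t μ)
    (hf : IsWindowKernel W C f) (hf₁ : IsProjection μ f f₁) :
    MemLp (fun ω => (tupleSum X f ω).toReal) 2 P := by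
  have hm := measurable_tupleSum hX.process.measurable hf.measurable
  rw [memLp_two_iff_integrable_sq hm.ennreal_toReal.aestronglyMeasurable]
  simp_rw [pow_two, ← ENNReal.toReal_mul]
  exact integrable_toReal_of_lintegral_ne_top (hm.mul hm).aemeasurable
    (hX.lintegral_mul_ne_top hf hf hf₁ hf₁)

omit [IsProbabilityMeasure P] [SigmaFinite Λ] in
lemma ae_tupleSum_lt_top (hX : IsPoissonWindow P X Λ W t μ) (hf : IsWindowKernel W C f) :
    ∀ᵐ ω ∂P, tupleSum X f ω < ∞ := by
  filter_upwards [hX.ae_exists_window] with ω ⟨A, hA⟩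
  refine (tupleSum_le hf.le hf.zero A fun j => (hA j).1).trans_lt ?_
  finiteness

omit [IsProbabilityMeasure P] in
lemma integral_tupleSum (hX : IsPoissonWindow P X Λ W t μ) (hf : IsWindowKernel W C f) :
    ∫ ω, (tupleSum X f ω).toReal ∂P =
      (t : ℝ) ^ (n + 1) * (∫⁻ x, f x ∂(Measure.pi fun _ => μ)).toReal := by
  rw [integral_toReal (measurable_tupleSum hX.process.measurable hf.measurable).aemeasurable
    (hX.ae_tupleSum_lt_top hf), hX.lintegral_tupleSum hf.measurable hf.zero]
  simp

lemma covariance_bound (hX : IsPoissonWindow P X Λ W t μ) (ht : 1 ≤ t)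
    (hf : IsWindowKernel W C f) (hh : IsWindowKernel W D h)
    (hf₁ : IsProjection μ f f₁) (hh₁ : IsProjection μ h h₁) :
    |∫ ω, (tupleSum X f ω).toReal * (tupleSum X h ω).toReal ∂P -
      (∫ ω, (tupleSum X f ω).toReal ∂P) * (∫ ω, (tupleSum X h ω).toReal ∂P) -
      (n + 1) * (n' + 1) * ((t : ℝ) ^ (n + n' + 1) * ∫ s, (f₁ s).toReal * (h₁ s).toReal ∂μ)| ≤
      rateConst n n' C D * (t : ℝ) ^ (n + n') := by
  have hm := measurable_tupleSum hX.process.measurable hf.measurable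
  have hm' := measurable_tupleSum hX.process.measurable hh.measurable
  have hne := hX.lintegral_mul_ne_top hf hh hf₁ hh₁
  have hE : ∫ ω, (tupleSum X f ω).toReal * (tupleSum X h ω).toReal ∂P =
      (∫⁻ ω, tupleSum X f ω * tupleSum X h ω ∂P).toReal := by
    simp_rw [← ENNReal.toReal_mul]
    exact integral_toReal (hm.mul hm').aemeasurable (ae_lt_top (hm.mul hm') hne)
  have hJ : ∫ s, (f₁ s).toReal * (h₁ s).toReal ∂μ = (∫⁻ s, f₁ s * h₁ s ∂μ).toReal := by
    simp_rw [← ENNReal.toReal_mul]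
    refine integral_toReal (hf₁.measurable.mul hh₁.measurable).aemeasurable (.of_forall fun s => ?_)
    exact ENNReal.mul_lt_top ((hf₁.le hf.le s).trans_lt ENNReal.coe_lt_top)
      ((hh₁.le hh.le s).trans_lt ENNReal.coe_lt_top)
  have hb := hX.lintegral_mul_bounds hf hh hf₁ hh₁
  simp only at hb
  have h1 : ∫⁻ x, f x ∂(Measure.pi fun _ => μ) ≠ ∞ := by
    refine ne_top_of_le_ne_top (ENNReal.coe_ne_top (r := C)) ((lintegral_mono hf.le).trans ?_)
    simp
  have h2 : ∫⁻ x, h x ∂(Measure.pi fun _ => μ) ≠ ∞ := by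
    refine ne_top_of_le_ne_top (ENNReal.coe_ne_top (r := D)) ((lintegral_mono hh.le).trans ?_)
    simp
  have h3 : ∫⁻ s, f₁ s * h₁ s ∂μ ≠ ∞ := by
    refine ne_top_of_le_ne_top (ENNReal.coe_ne_top (r := C * D))
      ((lintegral_mono fun s => mul_le_mul' (hf₁.le hf.le s) (hh₁.le hh.le s)).trans ?_)
    simp
  rw [hE, hJ, hX.integral_tupleSum hf, hX.integral_tupleSum hh]
  lift ∫⁻ x, f x ∂(Measure.pi fun _ => μ) to ℝ≥0 using h1 with a
  lift ∫⁻ x, h x ∂(Measure.pi fun _ => μ) to ℝ≥0 using h2 with b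
  lift ∫⁻ s, f₁ s * h₁ s ∂μ to ℝ≥0 using h3 with c
  lift ∫⁻ ω, tupleSum X f ω * tupleSum X h ω ∂P to ℝ≥0 using hne with e
  obtain ⟨hb1, hb2⟩ := hb
  have hb1' : t ^ (n + 1 + (n' + 1)) * (a * b) + ((n + 1) * (n' + 1) : ℕ) *
      (t ^ (n + 1 + n') * c) ≤ e := by exact_mod_cast hb1
  have hb2' : e ≤ t ^ (n + 1 + (n' + 1)) * (a * b) + ((n + 1) * (n' + 1) : ℕ) *
      (t ^ (n + 1 + n') * c) + momentConst n n' C D *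
      (((2 * (n + n')) ^ (n + n') : ℕ) + 2 ^ (n + n') * t ^ (n + n')) := by exact_mod_cast hb2
  have hb3 : momentConst n n' C D *
      (((2 * (n + n')) ^ (n + n') : ℕ) + 2 ^ (n + n') * t ^ (n + n')) ≤
      rateConst n n' C D * t ^ (n + n') := by
    rw [rateConst, mul_assoc, add_mul]
    gcongr
    exact le_mul_of_one_le_right zero_le (one_le_pow₀ ht)
  have hb2'' := hb2'.trans (add_le_add_right hb3 _)
  rw [← NNReal.coe_le_coe] at hb1' hb2''
  push_cast at hb1' hb2''
  simp only [ENNReal.coe_toReal]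
  rw [abs_le]
  have e1 : (t : ℝ) ^ (n + 1 + (n' + 1)) = t ^ (n + 1) * t ^ (n' + 1) := pow_add _ _ _
  have e2 : (t : ℝ) ^ (n + 1 + n') = t ^ (n + n' + 1) := by congr 1; ring
  rw [e1, e2] at hb1' hb2''
  have hK : (0 : ℝ) ≤ rateConst n n' C D * (t : ℝ) ^ (n + n') := by positivity
  constructor <;> nlinarith

lemma memLp_normalizedSum (hX : IsPoissonWindow P X Λ W t μ)
    (hf : IsWindowKernel W C f) (hf₁ : IsProjection μ f f₁) :
    MemLp (normalizedSum P X t f) 2 P := by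
  unfold normalizedSum
  simp_rw [div_eq_inv_mul]
  exact ((hX.memLp_tupleSum hf hf₁).sub (memLp_const _)).const_mul _

lemma integral_normalizedSum_mul_bound (hX : IsPoissonWindow P X Λ W t μ) (ht : 1 ≤ t)
    (hf : IsWindowKernel W C f) (hh : IsWindowKernel W D h)
    (hf₁ : IsProjection μ f f₁) (hh₁ : IsProjection μ h h₁) :
    |∫ ω, normalizedSum P X t f ω * normalizedSum P X t h ω ∂P -
      ∫ s, (f₁ s).toReal * (h₁ s).toReal ∂μ| ≤ rateConst n n' C D / t := by
  have ht0 : (0 : ℝ) < t := by exact_mod_cast zero_lt_one.trans_le ht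
  have hu := hX.memLp_tupleSum hf hf₁
  have hv := hX.memLp_tupleSum hh hh₁
  have hcov := covariance_eq_sub hu hv
  rw [covariance] at hcov
  have hb := hX.covariance_bound ht hf hh hf₁ hh₁
  set u := fun ω => (tupleSum X f ω).toReal with hu_def
  set v := fun ω => (tupleSum X h ω).toReal with hv_def
  have e1 : ∫ ω, normalizedSum P X t f ω * normalizedSum P X t h ω ∂P =
      ((n + 1) * (n' + 1) * (t : ℝ) ^ (n + n' + 1))⁻¹ *
        (∫ ω, u ω * v ω ∂P - (∫ ω, u ω ∂P) * ∫ ω, v ω ∂P) := by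
    have h1 : ∫ ω, u ω * v ω ∂P - (∫ ω, u ω ∂P) * ∫ ω, v ω ∂P =
        ∫ ω, (u ω - ∫ x, u x ∂P) * (v ω - ∫ x, v x ∂P) ∂P := hcov.symm
    rw [h1, ← integral_const_mul]
    refine integral_congr_ae (.of_forall fun ω => ?_)
    simp only [normalizedSum, hu_def, hv_def]
    rw [div_mul_div_comm, inv_mul_eq_div]
    congr 1
    have hs : √(t : ℝ) * √t = t := Real.mul_self_sqrt ht0.le
    calc (n + 1) * ((t : ℝ) ^ n * √t) * ((n' + 1) * (t ^ n' * √t))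
        = (n + 1) * (n' + 1) * (t ^ n * t ^ n' * (√t * √t)) := by ring
      _ = _ := by rw [hs]; ring
  rw [e1]
  set J := ∫ s, (f₁ s).toReal * (h₁ s).toReal ∂μ
  set m := ∫ ω, u ω * v ω ∂P - (∫ ω, u ω ∂P) * ∫ ω, v ω ∂P
  have hpos : (0 : ℝ) < (n + 1) * (n' + 1) * (t : ℝ) ^ (n + n' + 1) := by positivity
  have e2 : ((n + 1) * (n' + 1) * (t : ℝ) ^ (n + n' + 1))⁻¹ * m - J =
      ((n + 1) * (n' + 1) * (t : ℝ) ^ (n + n' + 1))⁻¹ *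
        (m - (n + 1) * (n' + 1) * ((t : ℝ) ^ (n + n' + 1) * J)) := by
    field_simp
  rw [e2, abs_mul, abs_of_pos (inv_pos.2 hpos), inv_mul_eq_div, div_le_div_iff₀ hpos ht0]
  calc _ ≤ rateConst n n' C D * (t : ℝ) ^ (n + n') * t := by gcongr
    _ = rateConst n n' C D * (1 * 1 * (t : ℝ) ^ (n + n' + 1)) := by ring
    _ ≤ _ := by gcongr <;> simp

end IsPoissonWindow

/-! ### The central limit theorem for the linear statistic -/

lemma norm_exp_mul_I_sub_exp_mul_I_le (a b : ℝ) :
    ‖Complex.exp (a * Complex.I) - Complex.exp (b * Complex.I)‖ ≤ |a - b| := by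
  have h : Complex.exp (a * Complex.I) - Complex.exp (b * Complex.I) =
      Complex.exp (b * Complex.I) * (Complex.exp (Complex.I * ((a - b : ℝ) : ℂ)) - 1) := by
    rw [mul_sub, ← Complex.exp_add, mul_one]
    congr 2
    push_cast
    ring
  rw [h, norm_mul, Complex.norm_exp_ofReal_mul_I, one_mul]
  exact Real.norm_exp_I_mul_ofReal_sub_one_le

lemma norm_exp_mul_I_sub_taylor_le {y : ℝ} (hy : |y| ≤ 1) :
    ‖Complex.exp (y * Complex.I) - 1 - y * Complex.I + (y : ℂ) ^ 2 / 2‖ ≤ |y| ^ 3 := by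
  have hn : ‖(y : ℂ) * Complex.I‖ = |y| := by simp
  have h := Complex.exp_bound (x := y * Complex.I) (by rwa [hn]) (n := 3) (by norm_num)
  rw [hn] at h
  have e : ∑ m ∈ Finset.range 3, ((y : ℂ) * Complex.I) ^ m / (m ! : ℂ) =
      1 + y * Complex.I - (y : ℂ) ^ 2 / 2 := by
    simp only [Finset.sum_range_succ, Finset.sum_range_zero, mul_pow, Complex.I_sq]
    norm_num
    ring
  rw [e] at h
  have e2 : Complex.exp (y * Complex.I) - 1 - y * Complex.I + (y : ℂ) ^ 2 / 2 =
      Complex.exp (y * Complex.I) - (1 + y * Complex.I - (y : ℂ) ^ 2 / 2) := by ring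
  rw [e2]
  refine h.trans (mul_le_of_le_one_right (by positivity) ?_)
  norm_num [Nat.factorial]

lemma norm_exponent_le {S : Type*} [MeasurableSpace S] (μ : Measure S) [IsProbabilityMeasure μ]
    {G : S → ℝ} (hG : Measurable G) {B : ℝ} (hB : ∀ x, |G x| ≤ B) {t : ℝ} (ht : 0 < t)
    (hBt : B ≤ √t) :
    ‖t * ∫ x, (Complex.exp (((√t)⁻¹ * G x : ℝ) * Complex.I) - 1) ∂μ -
      ((√t * ∫ x, G x ∂μ : ℝ) : ℂ) * Complex.I + ((∫ x, G x ^ 2 ∂μ : ℝ) : ℂ) / 2‖ ≤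
      B ^ 3 / √t := by
  have hs : 0 < √t := Real.sqrt_pos.2 ht
  have hst : √t * √t = t := Real.mul_self_sqrt ht.le
  have hI1 : Integrable (fun x => Complex.exp (((√t)⁻¹ * G x : ℝ) * Complex.I) - 1) μ := by
    refine Integrable.of_bound (C := 2) (Measurable.aestronglyMeasurable (by fun_prop))
      (.of_forall fun x => (norm_sub_le _ _).trans ?_)
    rw [Complex.norm_exp_ofReal_mul_I, norm_one]
    norm_num
  have hIG : Integrable G μ :=
    Integrable.of_bound (C := B) hG.aestronglyMeasurable (.of_forall hB)
  have hI2 : Integrable (fun x => (((√t)⁻¹ * G x : ℝ) : ℂ) * Complex.I) μ :=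
    ((hIG.const_mul _).ofReal).mul_const _
  have hIG2 : Integrable (fun x => G x ^ 2) μ := by
    refine Integrable.of_bound (C := B ^ 2) (by fun_prop) (.of_forall fun x => ?_)
    rw [norm_pow]
    exact pow_le_pow_left₀ (norm_nonneg _) (hB x) 2
  have hI3 : Integrable (fun x => (((√t)⁻¹ * G x : ℝ) : ℂ) ^ 2 / 2) μ := by
    have := ((hIG2.const_mul ((√t)⁻¹ ^ 2)).ofReal (𝕜 := ℂ)).div_const 2
    refine this.congr (.of_forall fun x => ?_)
    change (((√t)⁻¹ ^ 2 * G x ^ 2 : ℝ) : ℂ) / 2 = _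
    push_cast
    ring
  have e0 : ∫ x, (Complex.exp (((√t)⁻¹ * G x : ℝ) * Complex.I) - 1 -
        (((√t)⁻¹ * G x : ℝ) : ℂ) * Complex.I + (((√t)⁻¹ * G x : ℝ) : ℂ) ^ 2 / 2) ∂μ =
      ∫ x, (Complex.exp (((√t)⁻¹ * G x : ℝ) * Complex.I) - 1) ∂μ -
        ∫ x, (((√t)⁻¹ * G x : ℝ) : ℂ) * Complex.I ∂μ +
        ∫ x, (((√t)⁻¹ * G x : ℝ) : ℂ) ^ 2 / 2 ∂μ :=
    (integral_add (hI1.sub hI2) hI3).trans (congrArg (· + _) (integral_sub hI1 hI2))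
  have e : t * ∫ x, (Complex.exp (((√t)⁻¹ * G x : ℝ) * Complex.I) - 1) ∂μ -
      ((√t * ∫ x, G x ∂μ : ℝ) : ℂ) * Complex.I + ((∫ x, G x ^ 2 ∂μ : ℝ) : ℂ) / 2 =
      t * ∫ x, (Complex.exp (((√t)⁻¹ * G x : ℝ) * Complex.I) - 1 -
        (((√t)⁻¹ * G x : ℝ) : ℂ) * Complex.I + (((√t)⁻¹ * G x : ℝ) : ℂ) ^ 2 / 2) ∂μ := by
    rw [e0, integral_mul_const, integral_div]
    have e1 : ∫ x, (((√t)⁻¹ * G x : ℝ) : ℂ) ∂μ = (((√t)⁻¹ * ∫ x, G x ∂μ : ℝ) : ℂ) := by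
      rw [integral_complex_ofReal, integral_const_mul]
    have e2 : ∫ x, (((√t)⁻¹ * G x : ℝ) : ℂ) ^ 2 ∂μ =
        (((√t)⁻¹ ^ 2 * ∫ x, G x ^ 2 ∂μ : ℝ) : ℂ) := by
      rw [← integral_const_mul, ← integral_complex_ofReal]
      refine integral_congr_ae (.of_forall fun x => ?_)
      push_cast
      ring
    rw [e1, e2]
    generalize ∫ x, (Complex.exp (((√t)⁻¹ * G x : ℝ) * Complex.I) - 1) ∂μ = A
    have hs0 : (√t : ℂ) ≠ 0 := by exact_mod_cast hs.ne'
    have hst' : (t : ℂ) = √t * √t := by exact_mod_cast hst.symm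
    push_cast
    rw [hst']
    field_simp
  rw [e, norm_mul, Complex.norm_real, Real.norm_of_nonneg ht.le]
  have hy : ∀ x, |(√t)⁻¹ * G x| ≤ (√t)⁻¹ * B := fun x => by
    rw [abs_mul, abs_of_pos (inv_pos.2 hs)]
    exact mul_le_mul_of_nonneg_left (hB x) (inv_pos.2 hs).le
  have hy1 : (√t)⁻¹ * B ≤ 1 := by
    rw [inv_mul_le_iff₀ hs, mul_one]
    exact hBt
  have hbound := norm_integral_le_of_norm_le_const (μ := μ) (C := ((√t)⁻¹ * B) ^ 3)
    (f := fun x => Complex.exp (((√t)⁻¹ * G x : ℝ) * Complex.I) - 1 -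
        (((√t)⁻¹ * G x : ℝ) : ℂ) * Complex.I + (((√t)⁻¹ * G x : ℝ) : ℂ) ^ 2 / 2)
    (.of_forall fun x => (norm_exp_mul_I_sub_taylor_le ((hy x).trans hy1)).trans
      (pow_le_pow_left₀ (abs_nonneg _) (hy x) 3))
  rw [probReal_univ, mul_one] at hbound
  calc t * _ ≤ t * ((√t)⁻¹ * B) ^ 3 := by gcongr
    _ = (√t * √t) * ((√t)⁻¹ * B) ^ 3 := by rw [hst]
    _ = B ^ 3 / √t := by field_simp

section Linear

variable {Ω S : Type*} [MeasurableSpace Ω] [MeasurableSpace S]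

/-- A function as a kernel of order one. -/
abbrev linearKernel (g : S → ℝ≥0∞) : (Fin (0 + 1) → S) → ℝ≥0∞ := fun x => g (x 0)

omit [MeasurableSpace Ω] [MeasurableSpace S] in
lemma tupleSum_linearKernel (X : ℕ → Ω → S) (g : S → ℝ≥0∞) (ω : Ω) :
    tupleSum X (linearKernel g) ω = ∑' j, g (X j ω) :=
  ((Equiv.uniqueEmbeddingEquivResult (α := Fin 1) (β := ℕ)).symm.tsum_eq
    fun I => linearKernel g fun a => X (I a) ω).symm

lemma isProjection_linearKernel {μ : Measure S} [IsProbabilityMeasure μ] {g : S → ℝ≥0∞}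
    (hg : Measurable g) : IsProjection μ (linearKernel g) g where
  measurable := hg
  eq a s := by
    have ha : a = 0 := Subsingleton.elim (α := Fin 1) _ _
    subst ha
    simp [linearKernel]

lemma isWindowKernel_linearKernel {W : Set S} {C : ℝ≥0} {g : S → ℝ≥0∞} (hg : Measurable g)
    (hC : ∀ x, g x ≤ C) (h0 : ∀ x, x ∉ W → g x = 0) : IsWindowKernel W C (linearKernel g) where
  measurable := hg.comp (measurable_pi_apply 0)
  le x := hC _
  zero := by
    rintro x ⟨i, hi⟩
    have hi0 : i = 0 := Subsingleton.elim (α := Fin 1) _ _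
    exact h0 _ (hi0 ▸ hi)

variable {P : Measure Ω}
  [IsProbabilityMeasure P] {X : ℕ → Ω → S} {Λ : Measure S} [SigmaFinite Λ] {W : Set S} {t : ℝ≥0}
  {μ : Measure S} [IsProbabilityMeasure μ]

lemma IsPoissonWindow.integral_exp_linear (hX : IsPoissonWindow P X Λ W t μ) (ht : 0 < t)
    {κ : Type*} [Fintype κ] {g : κ → S → ℝ≥0∞} {C : κ → ℝ≥0} (hg : ∀ k, Measurable (g k))
    (hC : ∀ k x, g k x ≤ C k) (h0 : ∀ k x, x ∉ W → g k x = 0) (s : κ → ℝ) :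
    ∫ ω, Complex.exp ((∑ k, s k * normalizedSum P X t (linearKernel (g k)) ω : ℝ) *
      Complex.I) ∂P =
    Complex.exp (t * ∫ x, (Complex.exp (((√t)⁻¹ * ∑ k, s k * (g k x).toReal : ℝ) * Complex.I) - 1)
      ∂μ - ((√t * ∫ x, ∑ k, s k * (g k x).toReal ∂μ : ℝ) : ℂ) * Complex.I) := by
  have hs : 0 < √(t : ℝ) := Real.sqrt_pos.2 (by exact_mod_cast ht)
  have hst : √(t : ℝ) * √t = t := Real.mul_self_sqrt t.2
  have hWk := fun k => isWindowKernel_linearKernel (hg k) (hC k) (h0 k)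
  have hgint : ∀ k, Integrable (fun x => (g k x).toReal) μ := fun k => by
    refine Integrable.of_bound (C := C k) (hg k).ennreal_toReal.aestronglyMeasurable
      (.of_forall fun x => ?_)
    rw [Real.norm_of_nonneg ENNReal.toReal_nonneg]
    exact ENNReal.toReal_le_coe_of_le_coe (hC k x)
  let G : S → ℝ := fun x => (√(t : ℝ))⁻¹ * ∑ k, s k * (g k x).toReal
  have hGm : Measurable G := by
    have := fun k => (hg k).ennreal_toReal
    fun_prop
  have hG0 : ∀ x, x ∉ W → G x = 0 := fun x hx => by simp [G, h0 _ x hx]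
  have hmean : ∀ k, ∫ ω, (tupleSum X (linearKernel (g k)) ω).toReal ∂P =
      t * ∫ x, (g k x).toReal ∂μ := by
    intro k
    rw [hX.integral_tupleSum (hWk k),
      ← lintegral_projection (isProjection_linearKernel (hg k)) (hWk k).measurable,
      integral_toReal (hg k).aemeasurable
        (.of_forall fun x => (hC k x).trans_lt ENNReal.coe_lt_top)]
    simp
  have hsum : ∀ᵐ ω ∂P, ∑ k, s k * normalizedSum P X t (linearKernel (g k)) ω =
      ∑' j, G (X j ω) - √t * ∫ x, ∑ k, s k * (g k x).toReal ∂μ := by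
    filter_upwards [hX.ae_exists_window] with ω ⟨A, hA⟩
    have h1 : ∀ k, (tupleSum X (linearKernel (g k)) ω).toReal =
        ∑ j ∈ A, (g k (X j ω)).toReal := by
      intro k
      rw [tupleSum_linearKernel, tsum_eq_sum (s := A), ENNReal.toReal_sum]
      · exact fun j _ => ((hC k _).trans_lt ENNReal.coe_lt_top).ne
      · exact fun j hj => h0 k _ fun h => hj ((hA j).1 h)
    rw [tsum_eq_sum (s := A) fun j hj => hG0 _ fun h => hj ((hA j).1 h),
      integral_finsetSum _ fun k _ => (hgint k).const_mul _]
    simp_rw [integral_const_mul]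
    have h2 : ∀ k, normalizedSum P X t (linearKernel (g k)) ω =
        (√(t : ℝ))⁻¹ * ∑ j ∈ A, (g k (X j ω)).toReal - √t * ∫ x, (g k x).toReal ∂μ := by
      intro k
      rw [normalizedSum, h1, hmean]
      simp only [CharP.cast_eq_zero, zero_add, pow_zero, one_mul]
      rw [sub_div, inv_mul_eq_div]
      congr 1
      rw [div_eq_iff hs.ne', mul_right_comm, hst]
    simp_rw [h2, mul_sub, Finset.sum_sub_distrib]
    congr 1
    · simp only [G, Finset.mul_sum]
      rw [Finset.sum_comm]
      exact Finset.sum_congr rfl fun j _ => Finset.sum_congr rfl fun k _ => by ring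
    · rw [Finset.mul_sum]
      exact Finset.sum_congr rfl fun k _ => by ring
  have hint : ∫ x, (Complex.exp ((G x : ℂ) * Complex.I) - 1) ∂Λ =
      t * ∫ x, (Complex.exp ((G x : ℂ) * Complex.I) - 1) ∂μ := by
    rw [← setIntegral_eq_integral_of_forall_compl_eq_zero (s := W) fun x hx => by simp [hG0 x hx],
      hX.restrict, integral_smul_nnreal_measure]
    rfl
  have hchar := hX.process.integral_exp_tsum hX.measurableSet
    (by rw [hX.measure_window]; exact ENNReal.coe_ne_top) hGm hG0
  rw [hint] at hchar
  rw [Complex.exp_sub, ← hchar, ← integral_div]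
  refine integral_congr_ae ?_
  filter_upwards [hsum] with ω hω
  rw [hω, ← Complex.exp_sub]
  congr 1
  push_cast
  ring

end Linear

/-! ### The central limit theorem for vectors of `U`-statistics -/

lemma posSemidef_of_eq_integral_mul {S κ : Type*} [MeasurableSpace S] [Fintype κ] {μ : Measure S}
    {g : κ → S → ℝ} (hg : ∀ k, MemLp (g k) 2 μ) {M : Matrix κ κ ℝ}
    (hM : ∀ k l, M k l = ∫ x, g k x * g l x ∂μ) :
    M.PosSemidef ∧ ∀ s : κ → ℝ, s ⬝ᵥ M.mulVec s = ∫ x, (∑ k, s k * g k x) ^ 2 ∂μ := by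
  have h : ∀ s : κ → ℝ, s ⬝ᵥ M.mulVec s = ∫ x, (∑ k, s k * g k x) ^ 2 ∂μ := by
    intro s
    have hint : ∀ k l, Integrable (fun x => s k * g k x * (s l * g l x)) μ := fun k l =>
      (((hg k).const_mul (s k)).integrable_mul ((hg l).const_mul (s l)))
    simp_rw [pow_two, Finset.sum_mul_sum]
    rw [integral_finsetSum _ fun k _ => integrable_finsetSum _ fun l _ => hint k l]
    simp_rw [integral_finsetSum _ fun l _ => hint _ l, dotProduct, Matrix.mulVec, dotProduct,
      Finset.mul_sum, hM]
    refine Finset.sum_congr rfl fun k _ => Finset.sum_congr rfl fun l _ => ?_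
    rw [← integral_mul_const, ← integral_const_mul]
    exact integral_congr_ae (.of_forall fun x => by ring)
  refine ⟨Matrix.PosSemidef.of_dotProduct_mulVec_nonneg ?_ fun s => ?_, h⟩
  · ext k l
    simp only [Matrix.conjTranspose_apply, star_trivial, hM]
    exact integral_congr_ae (.of_forall fun x => mul_comm _ _)
  · rw [star_trivial, h]
    exact integral_nonneg fun x => sq_nonneg _

lemma integral_abs_le_sqrt {Ω : Type*} [MeasurableSpace Ω] {P : Measure Ω}
    [IsProbabilityMeasure P] {R : Ω → ℝ} (hR : MemLp R 2 P) :
    ∫ ω, |R ω| ∂P ≤ √(∫ ω, R ω ^ 2 ∂P) := by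
  have h := variance_nonneg |R| P
  rw [variance_eq_sub hR.abs] at h
  refine Real.le_sqrt_of_sq_le ?_
  simpa using h

lemma integral_sub_sq {Ω : Type*} [MeasurableSpace Ω] {P : Measure Ω} {a b : Ω → ℝ}
    (ha : MemLp a 2 P) (hb : MemLp b 2 P) :
    ∫ ω, (a ω - b ω) ^ 2 ∂P =
      ∫ ω, a ω * a ω ∂P - 2 * ∫ ω, a ω * b ω ∂P + ∫ ω, b ω * b ω ∂P := by
  have iaa : Integrable (fun ω => a ω * a ω) P := ha.integrable_mul ha
  have iab : Integrable (fun ω => 2 * (a ω * b ω)) P := (ha.integrable_mul hb).const_mul 2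
  have ibb : Integrable (fun ω => b ω * b ω) P := hb.integrable_mul hb
  have h : ∫ ω, (a ω * a ω - 2 * (a ω * b ω) + b ω * b ω) ∂P =
      ∫ ω, a ω * a ω ∂P - ∫ ω, 2 * (a ω * b ω) ∂P + ∫ ω, b ω * b ω ∂P :=
    (integral_add (iaa.sub iab) ibb).trans (congrArg (· + _) (integral_sub iaa iab))
  rw [← integral_const_mul, ← h]
  exact integral_congr_ae (.of_forall fun ω => by ring)

/-- A family of Poisson processes, indexed by a real parameter, that are eventually Poisson in the
window `W` with intensities tending to infinity, together with kernels of `U`-statistics. -/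
structure IsPoissonFamily {Ω S κ : Type*} [MeasurableSpace Ω] [MeasurableSpace S]
    (P : Measure Ω) (X : ℝ → ℕ → Ω → S) (Λ : ℝ → Measure S) (W : Set S) (t : ℝ → ℝ≥0)
    (μ : Measure S) (n : κ → ℕ) (f : ∀ k, (Fin (n k + 1) → S) → ℝ≥0∞) (C : κ → ℝ≥0)
    (f₁ : κ → S → ℝ≥0∞) : Prop where
  tendsto : Tendsto t atTop atTop
  window : ∀ᶠ r in atTop, IsPoissonWindow P (X r) (Λ r) W (t r) μ
  kernel : ∀ k, IsWindowKernel W (C k) (f k)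
  projection : ∀ k, IsProjection μ (f k) (f₁ k)

namespace IsPoissonFamily

variable {Ω S κ : Type*} [MeasurableSpace Ω] [MeasurableSpace S]
  {P : Measure Ω} [IsProbabilityMeasure P] {X : ℝ → ℕ → Ω → S} {Λ : ℝ → Measure S}
  [∀ r, SigmaFinite (Λ r)] {W : Set S} {t : ℝ → ℝ≥0}
  {μ : Measure S} [IsProbabilityMeasure μ] {n : κ → ℕ} {f : ∀ k, (Fin (n k + 1) → S) → ℝ≥0∞}
  {C : κ → ℝ≥0} {f₁ : κ → S → ℝ≥0∞}

omit [∀ r, SigmaFinite (Λ r)] [IsProbabilityMeasure P] in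
lemma memLp_projection (hF : IsPoissonFamily P X Λ W t μ n f C f₁) (k : κ) :
    MemLp (fun x => (f₁ k x).toReal) 2 μ := by
  refine MemLp.of_bound (hF.projection k).measurable.ennreal_toReal.aestronglyMeasurable (C k)
    (.of_forall fun x => ?_)
  rw [Real.norm_of_nonneg ENNReal.toReal_nonneg]
  exact ENNReal.toReal_le_coe_of_le_coe ((hF.projection k).le (hF.kernel k).le x)

omit [∀ r, SigmaFinite (Λ r)] [IsProbabilityMeasure P] [IsProbabilityMeasure μ] in
lemma eventually_one_le (hF : IsPoissonFamily P X Λ W t μ n f C f₁) : ∀ᶠ r in atTop, 1 ≤ t r :=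
  hF.tendsto.eventually_ge_atTop 1

lemma tendsto_moment_aux (ht : Tendsto t atTop atTop)
    (hX : ∀ᶠ r in atTop, IsPoissonWindow P (X r) (Λ r) W (t r) μ) {n n' : ℕ}
    {f : (Fin (n + 1) → S) → ℝ≥0∞} {h : (Fin (n' + 1) → S) → ℝ≥0∞} {f₁ h₁ : S → ℝ≥0∞}
    {C D : ℝ≥0} (hf : IsWindowKernel W C f) (hh : IsWindowKernel W D h)
    (hf₁ : IsProjection μ f f₁) (hh₁ : IsProjection μ h h₁) :
    Tendsto (fun r => ∫ ω, normalizedSum P (X r) (t r) f ω * normalizedSum P (X r) (t r) h ω ∂P)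
      atTop (𝓝 (∫ s, (f₁ s).toReal * (h₁ s).toReal ∂μ)) := by
  rw [tendsto_iff_norm_sub_tendsto_zero]
  have hlim : Tendsto (fun r => (IsPoissonWindow.rateConst n n' C D : ℝ) / t r) atTop (𝓝 0) :=
    tendsto_const_nhds.div_atTop (NNReal.tendsto_coe_atTop.2 ht)
  refine squeeze_zero' (.of_forall fun r => norm_nonneg _) ?_ hlim
  filter_upwards [hX, ht.eventually_ge_atTop 1] with r hr h1
  exact hr.integral_normalizedSum_mul_bound h1 hf hh hf₁ hh₁

lemma tendsto_moment (hF : IsPoissonFamily P X Λ W t μ n f C f₁) (k l : κ) :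
    Tendsto (fun r => ∫ ω, normalizedSum P (X r) (t r) (f k) ω *
      normalizedSum P (X r) (t r) (f l) ω ∂P) atTop
      (𝓝 (∫ s, (f₁ k s).toReal * (f₁ l s).toReal ∂μ)) :=
  tendsto_moment_aux hF.tendsto hF.window (hF.kernel k) (hF.kernel l) (hF.projection k)
    (hF.projection l)

omit [∀ r, SigmaFinite (Λ r)] [IsProbabilityMeasure P] in
lemma isWindowKernel_projection (hF : IsPoissonFamily P X Λ W t μ n f C f₁) (k : κ) :
    IsWindowKernel W (C k) (linearKernel (f₁ k)) :=
  isWindowKernel_linearKernel (hF.projection k).measurable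
    (fun x => (hF.projection k).le (hF.kernel k).le x)
    fun _ hx => (hF.projection k).zero (hF.kernel k) hx

/-- The `U`-statistics are asymptotically equivalent to their linear parts. -/
lemma tendsto_integral_abs_sub (hF : IsPoissonFamily P X Λ W t μ n f C f₁) (k : κ) :
    Tendsto (fun r => ∫ ω, |normalizedSum P (X r) (t r) (f k) ω -
      normalizedSum P (X r) (t r) (linearKernel (f₁ k)) ω| ∂P) atTop (𝓝 0) := by
  have hk := hF.kernel k
  have hp := hF.projection k
  have hk' := hF.isWindowKernel_projection k
  have hp' := isProjection_linearKernel (μ := μ) hp.measurable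
  have hlim : Tendsto (fun r => √(∫ ω, normalizedSum P (X r) (t r) (f k) ω *
      normalizedSum P (X r) (t r) (f k) ω ∂P -
      2 * ∫ ω, normalizedSum P (X r) (t r) (f k) ω *
        normalizedSum P (X r) (t r) (linearKernel (f₁ k)) ω ∂P +
      ∫ ω, normalizedSum P (X r) (t r) (linearKernel (f₁ k)) ω *
        normalizedSum P (X r) (t r) (linearKernel (f₁ k)) ω ∂P)) atTop (𝓝 0) := by
    have h := (((tendsto_moment_aux hF.tendsto hF.window hk hk hp hp).sub
      ((tendsto_moment_aux hF.tendsto hF.window hk hk' hp hp').const_mul 2)).add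
      (tendsto_moment_aux hF.tendsto hF.window hk' hk' hp' hp')).sqrt
    convert h using 2
    rw [eq_comm, Real.sqrt_eq_zero']
    linarith
  refine squeeze_zero' (.of_forall fun r => integral_nonneg fun _ => abs_nonneg _) ?_ hlim
  filter_upwards [hF.window] with r hr
  have h1 := hr.memLp_normalizedSum hk hp
  have h2 := hr.memLp_normalizedSum hk' hp'
  refine (integral_abs_le_sqrt (h1.sub h2)).trans_eq ?_
  exact congrArg _ (integral_sub_sq h1 h2)

variable [Fintype κ]

lemma tendsto_charFun_linear (hF : IsPoissonFamily P X Λ W t μ n f C f₁) (s : κ → ℝ) :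
    Tendsto (fun r => ∫ ω, Complex.exp ((∑ k, s k *
      normalizedSum P (X r) (t r) (linearKernel (f₁ k)) ω : ℝ) * Complex.I) ∂P) atTop
      (𝓝 (Complex.exp (-(((∫ x, (∑ k, s k * (f₁ k x).toReal) ^ 2 ∂μ : ℝ) : ℂ) / 2)))) := by
  have hm := fun k => (hF.projection k).measurable
  have hC := fun k x => (hF.projection k).le (hF.kernel k).le x
  have h0 := fun k x (hx : x ∉ W) => (hF.projection k).zero (hF.kernel k) hx
  let G : S → ℝ := fun x => ∑ k, s k * (f₁ k x).toReal
  have hG : Measurable G := by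
    have := fun k => (hm k).ennreal_toReal
    fun_prop
  let B : ℝ := ∑ k, |s k| * C k
  have hB : ∀ x, |G x| ≤ B := by
    intro x
    refine (Finset.abs_sum_le_sum_abs _ _).trans (Finset.sum_le_sum fun k _ => ?_)
    rw [abs_mul, abs_of_nonneg ENNReal.toReal_nonneg]
    gcongr
    exact ENNReal.toReal_le_coe_of_le_coe (hC k x)
  have hsqrt : Tendsto (fun r => √(t r : ℝ)) atTop atTop :=
    Real.tendsto_sqrt_atTop.comp (NNReal.tendsto_coe_atTop.2 hF.tendsto)
  have hexp : Tendsto (fun r => (t r : ℝ) * ∫ x, (Complex.exp (((√(t r : ℝ))⁻¹ * G x : ℝ) *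
      Complex.I) - 1) ∂μ - ((√(t r : ℝ) * ∫ x, G x ∂μ : ℝ) : ℂ) * Complex.I) atTop
      (𝓝 (-(((∫ x, G x ^ 2 ∂μ : ℝ) : ℂ) / 2))) := by
    rw [tendsto_iff_norm_sub_tendsto_zero]
    refine squeeze_zero' (.of_forall fun r => norm_nonneg _) ?_
      (tendsto_const_nhds.div_atTop hsqrt : Tendsto (fun r => B ^ 3 / √(t r : ℝ)) atTop (𝓝 0))
    filter_upwards [hF.eventually_one_le, hsqrt.eventually_ge_atTop B] with r h1 h2
    rw [sub_neg_eq_add]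
    exact norm_exponent_le μ hG hB (by exact_mod_cast zero_lt_one.trans_le h1) h2
  refine hexp.cexp.congr' ?_
  filter_upwards [hF.window, hF.eventually_one_le] with r hr h1
  exact (hr.integral_exp_linear (zero_lt_one.trans_le h1) hm hC h0 s).symm

lemma tendsto_charFun (hF : IsPoissonFamily P X Λ W t μ n f C f₁) (s : κ → ℝ) :
    Tendsto (fun r => ∫ ω, Complex.exp ((∑ k, s k *
      normalizedSum P (X r) (t r) (f k) ω : ℝ) * Complex.I) ∂P) atTop
      (𝓝 (Complex.exp (-(((∫ x, (∑ k, s k * (f₁ k x).toReal) ^ 2 ∂μ : ℝ) : ℂ) / 2)))) := by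
  refine tendsto_of_tendsto_of_dist (hF.tendsto_charFun_linear s) ?_
  have hlim : Tendsto (fun r => ∑ k, |s k| * ∫ ω, |normalizedSum P (X r) (t r) (f k) ω -
      normalizedSum P (X r) (t r) (linearKernel (f₁ k)) ω| ∂P) atTop (𝓝 0) := by
    have := tendsto_finsetSum Finset.univ fun k _ =>
      (hF.tendsto_integral_abs_sub k).const_mul |s k|
    simpa using this
  refine squeeze_zero' (.of_forall fun r => dist_nonneg) ?_ hlim
  filter_upwards [hF.window] with r hr
  have h1 := fun k => hr.memLp_normalizedSum (hF.kernel k) (hF.projection k)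
  have h2 := fun k => hr.memLp_normalizedSum (hF.isWindowKernel_projection k)
    (isProjection_linearKernel (hF.projection k).measurable)
  have hint : ∀ {Y : κ → Ω → ℝ}, (∀ k, MemLp (Y k) 2 P) →
      Integrable (fun ω => Complex.exp ((∑ k, s k * Y k ω : ℝ) * Complex.I)) P := by
    intro Y hY
    have hYm : AEMeasurable (fun ω => ∑ k, s k * Y k ω) P :=
      Finset.aemeasurable_fun_sum _ fun k _ => (hY k).aemeasurable.const_mul _
    refine Integrable.of_bound (C := 1) (AEMeasurable.aestronglyMeasurable (by fun_prop))
      (.of_forall fun ω => (Complex.norm_exp_ofReal_mul_I _).le)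
  have hR : ∀ k, Integrable (fun ω => |normalizedSum P (X r) (t r) (f k) ω -
      normalizedSum P (X r) (t r) (linearKernel (f₁ k)) ω|) P := fun k =>
    (((h1 k).sub (h2 k)).integrable one_le_two).abs
  rw [dist_comm, dist_eq_norm, ← integral_sub (hint h1) (hint h2)]
  refine (norm_integral_le_integral_norm _).trans ?_
  simp_rw [← integral_const_mul]
  rw [← integral_finsetSum _ fun k _ => (hR k).const_mul _]
  refine integral_mono ((hint h1).sub (hint h2)).norm
    (integrable_finsetSum _ fun k _ => (hR k).const_mul _) fun ω => ?_
  refine (norm_exp_mul_I_sub_exp_mul_I_le _ _).trans ?_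
  rw [← Finset.sum_sub_distrib]
  refine (Finset.abs_sum_le_sum_abs _ _).trans_eq (Finset.sum_congr rfl fun k _ => ?_)
  rw [← mul_sub, abs_mul]

/-- **Central limit theorem** for vectors of `U`-statistics of Poisson processes. -/
theorem tendstoInDistribution [DecidableEq κ] (hF : IsPoissonFamily P X Λ W t μ n f C f₁)
    {Z : ℝ → Ω → EuclideanSpace ℝ κ} (hZm : ∀ r, AEMeasurable (Z r) P)
    (hZ : ∀ᶠ r in atTop, ∀ k, (fun ω => Z r ω k) =ᵐ[P] normalizedSum P (X r) (t r) (f k))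
    {M : Matrix κ κ ℝ} (hM : ∀ k l, M k l = ∫ x, (f₁ k x).toReal * (f₁ l x).toReal ∂μ) :
    TendstoInDistribution Z atTop (id : EuclideanSpace ℝ κ → EuclideanSpace ℝ κ) (fun _ => P)
      (multivariateGaussian 0 M) where
  forall_aemeasurable := hZm
  aemeasurable_limit := aemeasurable_id
  tendsto := by
    obtain ⟨hpos, hquad⟩ := posSemidef_of_eq_integral_mul hF.memLp_projection hM
    refine tendsto_of_seq_tendsto fun u hu => ?_
    refine ProbabilityMeasure.tendsto_iff_tendsto_charFun.2 fun s => ?_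
    have h := (hF.tendsto_charFun s).comp hu
    simp only [ProbabilityMeasure.coe_mk, Measure.map_id]
    rw [charFun_multivariateGaussian hpos, hquad]
    simp only [inner_zero_right, Complex.ofReal_zero, zero_mul, zero_sub]
    refine h.congr' ?_
    filter_upwards [hu.eventually hZ] with i hi
    change _ = charFun (P.map (Z (u i))) s
    rw [charFun_apply, integral_map (hZm _) (by fun_prop)]
    refine integral_congr_ae ?_
    filter_upwards [ae_all_iff.2 hi] with ω hω
    congr 3
    rw [PiLp.inner_apply]
    refine Finset.sum_congr rfl fun k _ => ?_
    rw [← hω k]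
    simp

omit [Fintype κ] in
theorem tendsto_moment_of_ae_eq (hF : IsPoissonFamily P X Λ W t μ n f C f₁)
    {Z : ℝ → Ω → EuclideanSpace ℝ κ}
    (hZ : ∀ᶠ r in atTop, ∀ k, (fun ω => Z r ω k) =ᵐ[P] normalizedSum P (X r) (t r) (f k))
    (k l : κ) :
    Tendsto (fun r => ∫ ω, Z r ω k * Z r ω l ∂P) atTop
      (𝓝 (∫ s, (f₁ k s).toReal * (f₁ l s).toReal ∂μ)) := by
  refine (hF.tendsto_moment k l).congr' ?_
  filter_upwards [hZ] with r hr
  refine integral_congr_ae ?_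
  filter_upwards [hr k, hr l] with ω hk hl
  rw [← hk, ← hl]

end IsPoissonFamily

/-! ### Intersections of hyperplanes -/

section Geometry

variable {d : ℕ} {ι : Type*}

/-- The intersection of the hyperplanes with the given parameters. -/
def meet (x : ι → Mark d) : AffineSubspace ℝ (Space d) := ⨅ i, hyperplane (x i)

/-- The normal vectors are linearly independent. -/
def GeneralNormals (x : ι → Mark d) : Prop :=
  LinearIndependent ℝ fun i => ((x i).2 : Space d)

lemma mem_hyperplane {x : Mark d} {y : Space d} :
    y ∈ hyperplane x ↔ inner ℝ y (x.2 : Space d) = x.1 := Iff.rfl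

lemma mem_meet {x : ι → Mark d} {y : Space d} :
    y ∈ meet x ↔ ∀ i, inner ℝ y ((x i).2 : Space d) = (x i).1 := by
  rw [meet, AffineSubspace.mem_iInf_iff]
  rfl

lemma meet_insertNth {n : ℕ} (a : Fin (n + 1)) (s : Mark d) (y : Fin n → Mark d) :
    meet (Fin.insertNth a s y : Fin (n + 1) → Mark d) = (⨅ i, hyperplane (y i)) ⊓ hyperplane s := by
  ext z
  rw [meet, AffineSubspace.mem_iInf_iff, AffineSubspace.mem_inf_iff,
    AffineSubspace.mem_iInf_iff, Fin.forall_iff_succAbove a]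
  simp [and_comm]

lemma abs_eq_abs_of_hyperplane_eq {x y : Mark d} (h : hyperplane x = hyperplane y) :
    |x.1| = |y.1| := by
  have key : ∀ {x y : Mark d}, hyperplane x = hyperplane y → |y.1| ≤ |x.1| := by
    intro x y h
    have hx : x.1 • (x.2 : Space d) ∈ hyperplane x := by
      rw [mem_hyperplane, inner_smul_left, real_inner_self_eq_norm_sq, x.2.2.1]
      simp
    rw [h, mem_hyperplane] at hx
    rw [← hx]
    refine (abs_real_inner_le_norm _ _).trans ?_
    rw [norm_smul, x.2.2.1, y.2.2.1]
    simp
  exact le_antisymm (key h.symm) (key h)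

lemma abs_le_of_mem_meet {x : ι → Mark d} {y : Space d} (hy : y ∈ meet x) (i : ι) :
    |(x i).1| ≤ ‖y‖ := by
  rw [← mem_meet.1 hy i]
  refine (abs_real_inner_le_norm _ _).trans ?_
  rw [(x i).2.2.1, mul_one]

lemma direction_meet {x : ι → Mark d} {p : Space d} (hp : p ∈ meet x) :
    (meet x).direction = (Submodule.span ℝ (Set.range fun i => ((x i).2 : Space d)))ᗮ := by
  ext w
  rw [← AffineSubspace.vadd_mem_iff_mem_direction w hp, mem_meet]
  have h1 : ∀ i, inner ℝ (w +ᵥ p) ((x i).2 : Space d) = (x i).1 ↔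
      inner ℝ w ((x i).2 : Space d) = 0 := fun i => by
    rw [vadd_eq_add, inner_add_left, mem_meet.1 hp i]
    exact ⟨fun h => by linarith, fun h => by linarith⟩
  simp_rw [h1]
  constructor
  · intro h
    have hle : Submodule.span ℝ (Set.range fun i => ((x i).2 : Space d)) ≤ (ℝ ∙ w)ᗮ := by
      rw [Submodule.span_le]
      rintro _ ⟨i, rfl⟩
      exact Submodule.mem_orthogonal_singleton_iff_inner_right.2 (h i)
    rw [Submodule.mem_orthogonal']
    exact fun u hu => Submodule.mem_orthogonal_singleton_iff_inner_right.1 (hle hu)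
  · intro h i
    exact (Submodule.mem_orthogonal' _ _).1 h _ (Submodule.subset_span ⟨i, rfl⟩)

lemma generalNormals_iff [Fintype ι] {k : ℕ} (hk : k + Fintype.card ι = d) {x : ι → Mark d}
    (hx : ((meet x : AffineSubspace ℝ (Space d)) : Set (Space d)).Nonempty) :
    GeneralNormals x ↔ meet x ∈ kFlats d k := by
  obtain ⟨p, hp⟩ := hx
  have h :=
    (Submodule.span ℝ (Set.range fun i => ((x i).2 : Space d))).finrank_add_finrank_orthogonal
  rw [← direction_meet hp, finrank_euclideanSpace, Fintype.card_fin] at h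
  rw [GeneralNormals, linearIndependent_iff_card_eq_finrank_span, Set.finrank]
  simp only [kFlats, Set.mem_ofPred_eq]
  constructor
  · intro h'
    exact ⟨⟨p, hp⟩, by omega⟩
  · rintro ⟨-, h'⟩
    omega

lemma isOpen_generalNormals [Finite ι] : IsOpen {x : ι → Mark d | GeneralNormals x} := by
  have h : Continuous fun (x : ι → Mark d) (i : ι) => ((x i).2 : Space d) := by fun_prop
  exact isOpen_setOfPred_linearIndependent.preimage h

/-- The intersection of the hyperplanes hits the ball of radius `s` around the origin. -/
def HitsBall (s : ℝ) (x : ι → Mark d) : Prop :=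
  ((meet x : Set (Space d)) ∩ Metric.closedBall 0 s).Nonempty

lemma isClosed_hitsBall (s : ℝ) : IsClosed {x : ι → Mark d | HitsBall s x} := by
  let T : Set ((ι → Mark d) × (Metric.closedBall (0 : Space d) s)) :=
    {z | ∀ i, inner ℝ (z.2 : Space d) ((z.1 i).2 : Space d) = (z.1 i).1}
  have hT : IsClosed T := by
    have : T = ⋂ i, {z | inner ℝ (z.2 : Space d) ((z.1 i).2 : Space d) = (z.1 i).1} := by
      ext z; simp [T]
    rw [this]
    exact isClosed_iInter fun i => isClosed_eq (by fun_prop) (by fun_prop)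
  have : CompactSpace (Metric.closedBall (0 : Space d) s) :=
    isCompact_iff_compactSpace.1 (isCompact_closedBall 0 s)
  convert! isClosedMap_fst_of_compactSpace _ hT
  ext x
  simp only [Set.mem_ofPred_eq, Set.mem_image, Prod.exists, exists_and_right, exists_eq_right]
  constructor
  · rintro ⟨y, hy, hs⟩
    exact ⟨⟨y, hs⟩, mem_meet.1 hy⟩
  · rintro ⟨y, hy⟩
    exact ⟨y, mem_meet.2 hy, y.2⟩

lemma measurableSet_generalNormals [Finite ι] :
    MeasurableSet {x : ι → Mark d | GeneralNormals x} := by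
  have := Fintype.ofFinite ι
  exact isOpen_generalNormals.measurableSet

lemma measurableSet_hitsBall [Finite ι] (s : ℝ) :
    MeasurableSet {x : ι → Mark d | HitsBall s x} := by
  have := Fintype.ofFinite ι
  exact (isClosed_hitsBall s).measurableSet

lemma meet_nonempty_iff {x : ι → Mark d} :
    (meet x : Set (Space d)).Nonempty ↔ ∃ n : ℕ, HitsBall n x := by
  constructor
  · rintro ⟨y, hy⟩
    obtain ⟨n, hn⟩ := exists_nat_ge ‖y‖
    exact ⟨n, y, hy, by simpa using hn⟩
  · rintro ⟨n, y, hy, -⟩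
    exact ⟨y, hy⟩

/-- The distance of the intersection of the hyperplanes to the origin. -/
def distOrigin (x : ι → Mark d) : ℝ := Metric.infDist 0 (meet x : Set (Space d))

lemma exists_mem_meet_norm_eq {x : ι → Mark d} (hx : (meet x : Set (Space d)).Nonempty) :
    ∃ p ∈ meet x, ‖p‖ = distOrigin x := by
  have hc : IsClosed (meet x : Set (Space d)) := AffineSubspace.closed_of_finiteDimensional _
  obtain ⟨p, hp, h⟩ := hc.exists_infDist_eq_dist hx 0
  exact ⟨p, hp, by rw [distOrigin, h, dist_zero_left]⟩

lemma hitsBall_iff {x : ι → Mark d} (hx : (meet x : Set (Space d)).Nonempty) {s : ℝ} :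
    HitsBall s x ↔ distOrigin x ≤ s := by
  constructor
  · rintro ⟨y, hy, hs⟩
    refine (Metric.infDist_le_dist_of_mem hy).trans ?_
    simpa using hs
  · intro h
    obtain ⟨p, hp, hpd⟩ := exists_mem_meet_norm_eq hx
    exact ⟨p, hp, by simpa [hpd] using h⟩

open Classical in
lemma measurable_distOrigin [Finite ι] (r : ℝ) :
    Measurable fun x : ι → Mark d => if HitsBall r x then distOrigin x else 0 := by
  refine measurable_of_Iic fun s => ?_
  have h : (fun x : ι → Mark d => if HitsBall r x then distOrigin x else 0) ⁻¹' Set.Iic s =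
      ({x | HitsBall r x} ∩ {x | HitsBall s x}) ∪
        ({x | HitsBall r x}ᶜ ∩ {_x | 0 ≤ s}) := by
    ext x
    simp only [Set.mem_preimage, Set.mem_Iic, Set.mem_union, Set.mem_inter_iff, Set.mem_ofPred_eq,
      Set.mem_compl_iff]
    by_cases hx : HitsBall r x
    · simp [hx, hitsBall_iff (hx.mono Set.inter_subset_left)]
    · simp [hx]
  rw [h]
  exact ((measurableSet_hitsBall r).inter (measurableSet_hitsBall s)).union
    ((measurableSet_hitsBall r).compl.inter (MeasurableSet.const _))

lemma meet_inter_ball {x : ι → Mark d} {p : Space d} (hp : p ∈ meet x)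
    (hpd : ‖p‖ = distOrigin x) {r : ℝ} (hr : distOrigin x ≤ r) :
    (meet x : Set (Space d)) ∩ Metric.closedBall 0 r =
      (fun w : (meet x).direction => (w : Space d) + p) ''
        Metric.closedBall 0 √(r ^ 2 - distOrigin x ^ 2) := by
  have hd0 : 0 ≤ distOrigin x := Metric.infDist_nonneg
  have horth : ∀ w ∈ (meet x).direction, inner ℝ w p = 0 := by
    intro w hw
    have hmin : ∀ y ∈ (meet x).direction, ‖p‖ ≤ ‖p - y‖ := by
      intro y hy
      rw [hpd]
      have : (-y) +ᵥ p ∈ meet x :=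
        (AffineSubspace.vadd_mem_iff_mem_direction _ hp).2 (Submodule.neg_mem _ hy)
      refine (Metric.infDist_le_dist_of_mem this).trans ?_
      rw [dist_zero_left, vadd_eq_add, neg_add_eq_sub]
    have h0 : ‖p - 0‖ = ⨅ y : (meet x).direction, ‖p - y‖ := by
      refine le_antisymm (le_ciInf fun y => by simpa using hmin y y.2) ?_
      exact ciInf_le ⟨0, by rintro _ ⟨y, rfl⟩; exact norm_nonneg _⟩
        (0 : (meet x).direction)
    have := (Submodule.norm_eq_iInf_iff_real_inner_eq_zero _ (Submodule.zero_mem _)).1 h0 w hw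
    rw [real_inner_comm]
    simpa using this
  have hnorm : ∀ w ∈ (meet x).direction, ‖w + p‖ ^ 2 = ‖w‖ ^ 2 + distOrigin x ^ 2 := by
    intro w hw
    rw [norm_add_sq_real, horth w hw, hpd]
    ring
  have hball : ∀ w ∈ (meet x).direction,
      ‖w + p‖ ≤ r ↔ ‖w‖ ≤ √(r ^ 2 - distOrigin x ^ 2) := by
    intro w hw
    rw [Real.le_sqrt (norm_nonneg _) (by nlinarith),
      ← sq_le_sq₀ (norm_nonneg _) (hd0.trans hr), hnorm w hw, le_sub_iff_add_le]
  ext y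
  simp only [Set.mem_inter_iff, SetLike.mem_coe, mem_closedBall_zero_iff, Set.mem_image,
    Subtype.exists]
  constructor
  · rintro ⟨hy, hyr⟩
    have hw : y - p ∈ (meet x).direction := AffineSubspace.vsub_mem_direction hy hp
    refine ⟨y - p, hw, ?_, by simp⟩
    have := (hball _ hw).1 (by simpa using hyr)
    simpa using this
  · rintro ⟨w, hw, hwr, rfl⟩
    refine ⟨(AffineSubspace.vadd_mem_iff_mem_direction _ hp).2 hw, (hball w hw).2 ?_⟩
    simpa using hwr

/-- The volume of the `k`-dimensional ball of radius `s`. -/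
def ballVolume (k : ℕ) (s : ℝ) : ℝ≥0∞ :=
  volume (Metric.closedBall (0 : EuclideanSpace ℝ (Fin k)) s)

lemma monotone_ballVolume (k : ℕ) : Monotone (ballVolume k) := fun _ _ h =>
  measure_mono (Metric.closedBall_subset_closedBall h)

lemma ballVolume_lt_top (k : ℕ) (s : ℝ) : ballVolume k s < ∞ :=
  measure_closedBall_lt_top

lemma volume_meet_inter_ball {k : ℕ} {x : ι → Mark d} (hk : meet x ∈ kFlats d k) {r : ℝ}
    (hr : HitsBall r x) :
    μHE[k] ((meet x : Set (Space d)) ∩ Metric.closedBall 0 r) =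
      ballVolume k √(r ^ 2 - distOrigin x ^ 2) := by
  obtain ⟨p, hp, hpd⟩ := exists_mem_meet_norm_eq hk.1
  rw [meet_inter_ball hp hpd ((hitsBall_iff hk.1).1 hr)]
  let e : EuclideanSpace ℝ (Fin k) ≃ₗᵢ[ℝ] (meet x).direction :=
    ((stdOrthonormalBasis ℝ (meet x).direction).reindex (finCongr hk.2)).repr.symm
  have hf : Isometry fun w : (meet x).direction => (w : Space d) + p :=
    (IsometryEquiv.addRight p).isometry.comp isometry_subtype_coe
  have hb : Metric.closedBall (0 : (meet x).direction) √(r ^ 2 - distOrigin x ^ 2) =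
      e '' Metric.closedBall 0 √(r ^ 2 - distOrigin x ^ 2) := by
    rw [e.image_closedBall, map_zero]
  rw [hf.euclideanHausdorffMeasure_image, hb,
    e.isometry.euclideanHausdorffMeasure_image,
    EuclideanSpace.euclideanHausdorffMeasure_eq_volume]
  rfl

end Geometry

/-! ### Hyperplanes in general position -/

lemma pi_smul_nnreal {ι S : Type*} [Fintype ι] [MeasurableSpace S] (c : ℝ≥0) (m : Measure S)
    [SigmaFinite m] :
    (Measure.pi fun _ : ι => c • m) = (c : ℝ≥0∞) ^ Fintype.card ι • Measure.pi fun _ : ι => m := by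
  refine Measure.pi_eq fun s hs => ?_
  have h2 : ∀ A, (c • m) A = c * m A := fun A => rfl
  simp_rw [h2]
  rw [Measure.smul_apply, Measure.pi_pi, Finset.prod_mul_distrib, Finset.prod_const,
    Finset.card_univ, smul_eq_mul]

lemma ae_pi_smul_restrict {ι S : Type*} [Fintype ι] [MeasurableSpace S] {c : ℝ≥0} {m : Measure S}
    [SigmaFinite m] {W : Set S} {p : (ι → S) → Prop} (h : ∀ᵐ x ∂(Measure.pi fun _ : ι => m), p x) :
    ∀ᵐ x ∂(Measure.pi fun _ : ι => c • m.restrict W), p x := by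
  rw [pi_smul_nnreal]
  refine Measure.ae_smul_measure ?_ _
  rw [← Measure.restrict_pi_pi]
  exact ae_restrict_of_ae h

section MarkSpace

variable {d : ℕ} {ι : Type*} [Fintype ι] (Θ : Measure (upperHemisphere d))

/-- The hyperplanes with positions in `[-ρ, ρ]`. -/
def markWindow (d : ℕ) (ρ : ℝ) : Set (Mark d) := Set.Icc (-ρ) ρ ×ˢ Set.univ

lemma measurableSet_markWindow (ρ : ℝ) : MeasurableSet (markWindow d ρ) :=
  measurableSet_Icc.prod MeasurableSet.univ

lemma mem_markWindow {ρ : ℝ} {x : Mark d} : x ∈ markWindow d ρ ↔ |x.1| ≤ ρ := by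
  simp [markWindow, abs_le]

/-- Almost surely, intersecting hyperplanes have linearly independent normal vectors. -/
lemma ae_generalNormals [IsProbabilityMeasure Θ] :
    ∀ᵐ x ∂(Measure.pi fun _ : ι => (volume : Measure ℝ).prod Θ),
      ((meet x : AffineSubspace ℝ (Space d)) : Set (Space d)).Nonempty → GeneralNormals x := by
  have he := measurePreserving_arrowProdEquivProdArrow ℝ (upperHemisphere d) ι
    (fun _ => volume) (fun _ => Θ)
  let e := MeasurableEquiv.arrowProdEquivProdArrow ℝ (upperHemisphere d) ι
  let N : Set (ι → Mark d) := {x | (meet x : Set (Space d)).Nonempty ∧ ¬ GeneralNormals x}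
  have hN : MeasurableSet N := by
    have h1 : MeasurableSet {x : ι → Mark d | (meet x : Set (Space d)).Nonempty} := by
      simp_rw [meet_nonempty_iff, Set.ofPred_exists]
      exact MeasurableSet.iUnion fun n => measurableSet_hitsBall _
    exact h1.inter measurableSet_generalNormals.compl
  have hset : {x : ι → Mark d | ¬ ((meet x : Set (Space d)).Nonempty → GeneralNormals x)} = N := by
    ext x; simp [N]
  rw [ae_iff, hset, ← he.symm.measure_preimage hN.nullMeasurableSet,
    Measure.prod_apply_symm (he.symm.measurable hN)]
  refine lintegral_eq_zero_of_ae_eq_zero (.of_forall fun v => ?_)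
  simp only [Pi.zero_apply]
  by_cases hv : LinearIndependent ℝ fun i => (v i : Space d)
  · convert measure_empty (μ := Measure.pi fun _ : ι => (volume : Measure ℝ))
    ext p
    simp only [Set.mem_preimage, Set.mem_empty_iff_false, iff_false]
    exact fun hp => hp.2 hv
  · rw [Fintype.not_linearIndependent_iff] at hv
    obtain ⟨c, hc, i, hi⟩ := hv
    let ℓ : (ι → ℝ) →ₗ[ℝ] ℝ := ∑ j, c j • LinearMap.proj j
    have hℓ : ∀ p, ℓ p = ∑ j, c j * p j := fun p => by simp [ℓ]
    have hker : LinearMap.ker ℓ ≠ ⊤ := by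
      classical
      intro h
      have : ℓ (Pi.single i 1) = 0 := LinearMap.mem_ker.1 (h ▸ Submodule.mem_top)
      rw [hℓ] at this
      simp [Pi.single_apply, hi] at this
    refine measure_mono_null (fun p hp => ?_)
      (Measure.addHaar_submodule (volume : Measure (ι → ℝ)) (LinearMap.ker ℓ) hker)
    obtain ⟨⟨y, hy⟩, -⟩ := hp
    rw [SetLike.mem_coe, LinearMap.mem_ker, hℓ]
    have hyi : ∀ j, inner ℝ y (v j : Space d) = p j := mem_meet.1 hy
    simp_rw [← hyi, ← inner_smul_right]
    rw [← inner_sum, hc, inner_zero_right]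

lemma volume_abs_slab_le (n : ℕ) (c : ℤ) :
    volume {p : ℝ | ⌊((n + 1 : ℕ) : ℝ) * |p|⌋ = c} ≤ 2 / (n + 1 : ℕ) := by
  have hn : (0 : ℝ) < ((n + 1 : ℕ) : ℝ) := by positivity
  have hsub : {p : ℝ | ⌊((n + 1 : ℕ) : ℝ) * |p|⌋ = c} ⊆
      Set.Icc (c / (n + 1 : ℕ)) ((c + 1) / (n + 1 : ℕ)) ∪
        Set.Icc (-((c + 1) / (n + 1 : ℕ))) (-(c / (n + 1 : ℕ))) := by
    intro p hp
    rw [Set.mem_ofPred_eq, Int.floor_eq_iff] at hp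
    have h1 : (c : ℝ) / (n + 1 : ℕ) ≤ |p| := by rw [div_le_iff₀ hn]; linarith [hp.1]
    have h2 : |p| ≤ ((c : ℝ) + 1) / (n + 1 : ℕ) := by rw [le_div_iff₀ hn]; linarith [hp.2]
    rcases abs_cases p with ⟨h, -⟩ | ⟨h, -⟩
    · exact .inl ⟨by linarith, by linarith⟩
    · exact .inr ⟨by linarith, by linarith⟩
  refine (measure_mono hsub).trans ((measure_union_le _ _).trans ?_)
  rw [Real.volume_Icc, Real.volume_Icc, ← ENNReal.ofReal_natCast,
    show (2 : ℝ≥0∞) = ENNReal.ofReal 2 by simp, ← ENNReal.ofReal_div_of_pos hn,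
    ← ENNReal.ofReal_add]
  · refine ENNReal.ofReal_le_ofReal (le_of_eq ?_)
    field_simp
    ring
  · rw [← sub_div, add_sub_cancel_left]; positivity
  · rw [sub_neg_eq_add, neg_add_eq_sub, ← sub_div, add_sub_cancel_left]; positivity

lemma isDiffuseFor_abs [IsProbabilityMeasure Θ] (c : ℝ≥0) :
    IsDiffuseFor (c • (volume : Measure ℝ).prod Θ) fun x : Mark d => |x.1| where
  measurable := by fun_prop
  exists_bound := by
    refine ⟨c * 2, fun n k => ?_⟩
    have h : slab (fun x : Mark d => |x.1|) (n + 1) k =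
        {p : ℝ | ⌊((n + 1 : ℕ) : ℝ) * |p|⌋ = k} ×ˢ Set.univ := by
      ext x; simp [slab]
    rw [h]
    change (c : ℝ≥0∞) * ((volume : Measure ℝ).prod Θ) _ ≤ _
    rw [Measure.prod_prod, measure_univ, mul_one, ENNReal.coe_mul, mul_div_assoc]
    gcongr
    exact volume_abs_slab_le n k

lemma markLaw_eq [IsProbabilityMeasure Θ] {ρ : ℝ} (hρ : 0 < ρ) :
    markLaw Θ ρ = (2 * ρ).toNNReal⁻¹ • ((volume : Measure ℝ).prod Θ).restrict (markWindow d ρ) := by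
  rw [markLaw, ProbabilityTheory.cond, Real.volume_Icc, sub_neg_eq_add, ← two_mul,
    Measure.prod_smul_left, markWindow, ← Measure.prod_restrict, Measure.restrict_univ]
  rw [show (ENNReal.ofReal (2 * ρ))⁻¹ = (((2 * ρ).toNNReal⁻¹ : ℝ≥0) : ℝ≥0∞) from
    (ENNReal.coe_inv (by simpa using hρ)).symm]
  rfl

lemma isProbabilityMeasure_markLaw [IsProbabilityMeasure Θ] {ρ : ℝ} (hρ : 0 < ρ) :
    IsProbabilityMeasure (markLaw Θ ρ) := by
  have : IsProbabilityMeasure (ProbabilityTheory.cond (volume : Measure ℝ) (Set.Icc (-ρ) ρ)) := by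
    refine cond_isProbabilityMeasure_of_finite ?_ ?_
    · simpa using hρ
    · simp
  rw [markLaw]
  infer_instance

lemma restrict_markWindow [IsProbabilityMeasure Θ] {ρ : ℝ} (hρ : 0 < ρ) (c : ℝ≥0) :
    (c • (volume : Measure ℝ).prod Θ).restrict (markWindow d ρ) =
      (c * (2 * ρ).toNNReal) • markLaw Θ ρ := by
  have h : (2 * ρ).toNNReal ≠ 0 := by simpa using hρ
  rw [markLaw_eq Θ hρ, smul_smul, mul_assoc, mul_inv_cancel₀ h, mul_one, Measure.restrict_smul]

lemma ae_generalNormals_markLaw [IsProbabilityMeasure Θ] {ρ : ℝ} (hρ : 0 < ρ) :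
    ∀ᵐ x ∂(Measure.pi fun _ : ι => markLaw Θ ρ),
      ((meet x : AffineSubspace ℝ (Space d)) : Set (Space d)).Nonempty → GeneralNormals x := by
  rw [markLaw_eq Θ hρ]
  exact ae_pi_smul_restrict (ae_generalNormals Θ)

variable {Ω : Type*} [MeasurableSpace Ω] {P : Measure Ω} {X : ℕ → Ω → Mark d}

lemma IsPoissonProcess.comp {S T : Type*} [MeasurableSpace S] [MeasurableSpace T]
    {X : ℕ → Ω → S} {Λ : Measure S} (hX : IsPoissonProcess P X Λ) {F : S → T}
    (hF : Measurable F) : IsPoissonProcess P (fun i ω => F (X i ω)) (Λ.map F) := by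
  have hcount : ∀ ω {A : Set T}, MeasurableSet A →
      countingMeasure (fun i ω => F (X i ω)) ω A = countingMeasure X ω (F ⁻¹' A) := by
    intro ω A hA
    rw [countingMeasure_apply _ _ hA, countingMeasure_apply _ _ (hF hA)]
    rfl
  refine ⟨fun i => hF.comp (hX.measurable i), fun A hA hfin => ?_, fun n A hA hd => ?_⟩
  · rw [Measure.map_apply hF hA] at hfin ⊢
    simp_rw [hcount _ hA]
    exact hX.law_count _ (hF hA) hfin
  · simp_rw [hcount _ (hA _)]
    exact hX.indep_count n _ (fun i => hF (hA i)) fun i j hij => (hd hij).preimage F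

/-- Dilation of hyperplanes by the factor `a`. -/
def dilate (a : ℝ) (x : Mark d) : Mark d := (a * x.1, x.2)

lemma measurable_dilate (a : ℝ) : Measurable (dilate a : Mark d → Mark d) := by
  unfold dilate; fun_prop

lemma IsPoissonProcess.dilate [IsProbabilityMeasure Θ] {c : ℝ≥0}
    (hX : IsPoissonProcess P X (c • (volume : Measure ℝ).prod Θ)) {a : ℝ} (ha : 0 < a) :
    IsPoissonProcess P (fun i ω => dilate a (X i ω))
      ((c * a⁻¹.toNNReal) • (volume : Measure ℝ).prod Θ) := by
  have h := hX.comp (measurable_dilate a)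
  have h2 : ((volume : Measure ℝ).prod Θ).map (PoissonFlats.dilate a : Mark d → Mark d) =
      a⁻¹.toNNReal • (volume : Measure ℝ).prod Θ := by
    have h3 := Measure.map_prod_map (volume : Measure ℝ) Θ (measurable_const_mul a) measurable_id
    rw [Real.map_volume_mul_left ha.ne', Measure.map_id, Measure.prod_smul_left,
      abs_of_pos (inv_pos.2 ha)] at h3
    exact h3.symm
  rw [Measure.map_smul, h2, smul_smul] at h
  exact h

end MarkSpace

/-! ### The kernels of flat counts and flat volumes -/

section FlatKernels

variable {d : ℕ} {ι : Type*}

/-- The indicator of the `k`-flats that hit the ball of radius `r`. -/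
def countFunctional (d k : ℕ) (r : ℝ) : AffineSubspace ℝ (Space d) → ℝ≥0∞ :=
  {L | L ∈ kFlats d k ∧ ((L : Set (Space d)) ∩ Metric.closedBall 0 r).Nonempty}.indicator 1

/-- The volume of `k`-flats in the ball of radius `r`. -/
def volumeFunctional (d k : ℕ) (r : ℝ) : AffineSubspace ℝ (Space d) → ℝ≥0∞ :=
  (kFlats d k).indicator fun L => μHE[k] ((L : Set (Space d)) ∩ Metric.closedBall 0 r)

lemma countFunctional_meet [Fintype ι] {k : ℕ} (hk : k + Fintype.card ι = d) (r : ℝ) :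
    (fun x : ι → Mark d => countFunctional d k r (meet x)) =
      {x | GeneralNormals x ∧ HitsBall r x}.indicator 1 := by
  classical
  ext x
  rw [countFunctional, Set.indicator_apply, Set.indicator_apply]
  refine if_congr ?_ rfl rfl
  exact and_congr_left fun hx => (generalNormals_iff hk (hx.mono Set.inter_subset_left)).symm

open Classical in
lemma volumeFunctional_meet [Fintype ι] {k : ℕ} (hk : k + Fintype.card ι = d) (r : ℝ) :
    (fun x : ι → Mark d => volumeFunctional d k r (meet x)) =
      {x | GeneralNormals x ∧ HitsBall r x}.indicator fun x =>
        ballVolume k √(r ^ 2 - (if HitsBall r x then distOrigin x else 0) ^ 2) := by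
  ext x
  rw [volumeFunctional]
  by_cases hx : HitsBall r x
  · have h := generalNormals_iff hk (hx.mono Set.inter_subset_left)
    by_cases hg : GeneralNormals x
    · rw [Set.indicator_of_mem (s := {x | GeneralNormals x ∧ HitsBall r x}) ⟨hg, hx⟩,
        Set.indicator_of_mem (h.1 hg), volume_meet_inter_ball (h.1 hg) hx, if_pos hx]
    · rw [Set.indicator_of_notMem (s := {x | GeneralNormals x ∧ HitsBall r x})
        fun h' => hg h'.1, Set.indicator_of_notMem fun h' => hg (h.2 h')]
  · rw [Set.indicator_of_notMem (s := {x | GeneralNormals x ∧ HitsBall r x}) fun h' => hx h'.2]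
    refine Set.indicator_apply_eq_zero.2 fun _ => ?_
    rw [Set.not_nonempty_iff_eq_empty.1 hx, measure_empty]

lemma measurableSet_generalNormals_hitsBall [Finite ι] (r : ℝ) :
    MeasurableSet {x : ι → Mark d | GeneralNormals x ∧ HitsBall r x} :=
  measurableSet_generalNormals.inter (measurableSet_hitsBall r)

lemma notMem_of_notMem_window {r : ℝ} {x : ι → Mark d} (h : ∃ i, x i ∉ markWindow d r) :
    ¬ HitsBall r x := by
  rintro ⟨y, hy, hyr⟩
  obtain ⟨i, hi⟩ := h
  exact hi (mem_markWindow.2 ((abs_le_of_mem_meet hy i).trans (by simpa using hyr)))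

lemma isWindowKernel_count [Fintype ι] {k : ℕ} (hk : k + Fintype.card ι = d) (r : ℝ) :
    IsWindowKernel (markWindow d r) 1
      (fun x : ι → Mark d => countFunctional d k r (meet x)) := by
  rw [countFunctional_meet hk]
  refine ⟨measurable_one.indicator (measurableSet_generalNormals_hitsBall r), fun x => ?_,
    fun x hx => Set.indicator_of_notMem (fun h => notMem_of_notMem_window hx h.2) _⟩
  exact Set.indicator_le_self' (by simp) x

lemma isWindowKernel_volume [Fintype ι] {k : ℕ} (hk : k + Fintype.card ι = d) (r : ℝ) :
    IsWindowKernel (markWindow d r) (ballVolume k |r|).toNNReal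
      (fun x : ι → Mark d => volumeFunctional d k r (meet x)) := by
  classical
  rw [volumeFunctional_meet hk]
  refine ⟨Measurable.indicator ?_ (measurableSet_generalNormals_hitsBall r), fun x => ?_,
    fun x hx => Set.indicator_of_notMem (fun h => notMem_of_notMem_window hx h.2) _⟩
  · refine (monotone_ballVolume k).measurable.comp (Measurable.sqrt ?_)
    exact measurable_const.sub ((measurable_distOrigin r).pow_const 2)
  · rw [ENNReal.coe_toNNReal (ballVolume_lt_top k _).ne]
    refine (Set.indicator_le_self' (by simp) x).trans (monotone_ballVolume k ?_)
    refine (Real.sqrt_le_sqrt (sub_le_self _ (sq_nonneg _))).trans_eq (Real.sqrt_sq_eq_abs r)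

lemma isProjection_meet {μ : Measure (Mark d)} [IsProbabilityMeasure μ] {n : ℕ}
    {F : AffineSubspace ℝ (Space d) → ℝ≥0∞}
    (hF : Measurable fun x : Fin (n + 1) → Mark d => F (meet x)) :
    IsProjection μ (fun x : Fin (n + 1) → Mark d => F (meet x)) fun s =>
      ∫⁻ y : Fin n → Mark d, F ((⨅ i, hyperplane (y i)) ⊓ hyperplane s) ∂(Measure.pi fun _ => μ)
      where
  measurable := by
    have h := (hF.comp (measurable_insertNth 0)).lintegral_prod_right' (ν := Measure.pi fun _ => μ)
    simpa only [Function.comp_apply, meet_insertNth] using h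
  eq a s := by simp_rw [meet_insertNth]

lemma mem_meet_dilate {a : ℝ} (ha : 0 < a) {x : ι → Mark d} {y : Space d} :
    a • y ∈ meet (fun i => dilate a (x i)) ↔ y ∈ meet x := by
  simp only [mem_meet, dilate, inner_smul_left, RCLike.conj_to_real]
  exact forall_congr' fun i => mul_right_inj' ha.ne'

open scoped Pointwise in
lemma meet_dilate_inter_ball {a : ℝ} (ha : 0 < a) (x : ι → Mark d) (r : ℝ) :
    (meet (fun i => dilate a (x i)) : Set (Space d)) ∩ Metric.closedBall 0 (a * r) =
      a • ((meet x : Set (Space d)) ∩ Metric.closedBall 0 r) := by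
  ext y
  obtain ⟨z, rfl⟩ : ∃ z, y = a • z := ⟨a⁻¹ • y, by rw [smul_inv_smul₀ ha.ne']⟩
  rw [Set.smul_mem_smul_set_iff₀ ha.ne']
  simp only [Set.mem_inter_iff, SetLike.mem_coe, mem_meet_dilate ha, mem_closedBall_zero_iff,
    norm_smul, Real.norm_of_nonneg ha.le, mul_le_mul_iff_right₀ ha]

lemma hitsBall_dilate {a : ℝ} (ha : 0 < a) {x : ι → Mark d} {r : ℝ} :
    HitsBall (a * r) (fun i => dilate a (x i)) ↔ HitsBall r x := by
  rw [HitsBall, meet_dilate_inter_ball ha, Set.smul_set_nonempty]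
  rfl

lemma countFunctional_dilate [Fintype ι] {k : ℕ} (hk : k + Fintype.card ι = d) {a : ℝ} (ha : 0 < a)
    (x : ι → Mark d) (r : ℝ) :
    countFunctional d k (a * r) (meet fun i => dilate a (x i)) =
      countFunctional d k r (meet x) := by
  have h := congrFun (countFunctional_meet (ι := ι) hk (a * r)) fun i => dilate a (x i)
  have h' := congrFun (countFunctional_meet (ι := ι) hk r) x
  classical
  rw [h, h', Set.indicator_apply, Set.indicator_apply]
  refine if_congr ?_ rfl rfl
  exact and_congr Iff.rfl (hitsBall_dilate ha)

lemma volumeFunctional_dilate [Fintype ι] {k : ℕ} (hk : k + Fintype.card ι = d) {a : ℝ}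
    (ha : 0 < a) (x : ι → Mark d) (r : ℝ) :
    volumeFunctional d k (a * r) (meet fun i => dilate a (x i)) =
      ENNReal.ofReal (a ^ k) * volumeFunctional d k r (meet x) := by
  have hμ : μHE[k] ((meet (fun i => dilate a (x i)) : Set (Space d)) ∩
      Metric.closedBall 0 (a * r)) =
      ENNReal.ofReal (a ^ k) * μHE[k] ((meet x : Set (Space d)) ∩ Metric.closedBall 0 r) := by
    rw [meet_dilate_inter_ball ha, Measure.euclideanHausdorffMeasure_smul₀ k ha.ne']
    rw [ENNReal.ofReal_pow ha.le, ← Real.enorm_of_nonneg ha.le]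
    rfl
  by_cases hx : HitsBall r x
  · have h := generalNormals_iff hk (hx.mono Set.inter_subset_left)
    have h' := generalNormals_iff hk (((hitsBall_dilate ha).2 hx).mono Set.inter_subset_left)
    have hiff : meet (fun i => dilate a (x i)) ∈ kFlats d k ↔ meet x ∈ kFlats d k :=
      h'.symm.trans h
    rw [volumeFunctional, volumeFunctional]
    by_cases hm : meet x ∈ kFlats d k
    · rw [Set.indicator_of_mem hm, Set.indicator_of_mem (hiff.2 hm), hμ]
    · rw [Set.indicator_of_notMem hm, Set.indicator_of_notMem (fun h => hm (hiff.1 h)), mul_zero]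
  · have h0 : ∀ {r : ℝ} {z : ι → Mark d}, ¬ HitsBall r z →
        volumeFunctional d k r (meet z) = 0 := by
      intro r z hz
      refine Set.indicator_apply_eq_zero.2 fun _ => ?_
      rw [Set.not_nonempty_iff_eq_empty.1 hz, measure_empty]
    rw [h0 hx, h0 fun h => hx ((hitsBall_dilate ha).1 h), mul_zero]

end FlatKernels

/-! ### Sums over flats as sums over tuples -/

section FlatSums

variable {d : ℕ} {Ω : Type*} {X : ℕ → Ω → Mark d}

lemma flatSum_eq_tupleSum {k : ℕ} {ω : Ω} (h : Function.Injective fun i => hyperplane (X i ω))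
    (F : AffineSubspace ℝ (Space d) → ℝ≥0∞) :
    flatSum k (hyperplanes X ω) F =
      ((d - k)! : ℝ≥0∞)⁻¹ * tupleSum X (fun x : Fin (d - k) → Mark d => F (meet x)) ω := by
  rw [flatSum, tupleSum]
  congr 1
  let e : (Fin (d - k) ↪ ℕ) → {H : Fin (d - k) → AffineSubspace ℝ (Space d) //
      Function.Injective H ∧ ∀ i, H i ∈ hyperplanes X ω} := fun I =>
    ⟨fun a => hyperplane (X (I a) ω), h.comp I.injective, fun i => ⟨I i, rfl⟩⟩
  have he : Function.Bijective e := by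
    constructor
    · intro I J hIJ
      ext a
      exact h (congrFun (congrArg Subtype.val hIJ) a)
    · rintro ⟨H, hH, hr⟩
      have hr' := hr
      choose I hI using hr'
      refine ⟨⟨I, fun a b hab => hH ?_⟩, Subtype.ext (funext hI)⟩
      rw [← hI a, ← hI b, hab]
  exact ((Equiv.ofBijective e he).tsum_eq fun H => F (⨅ i, H.1 i)).symm

lemma tupleSum_meet_congr {m m' : ℕ} (h : m = m') (F : AffineSubspace ℝ (Space d) → ℝ≥0∞) (ω : Ω) :
    tupleSum X (fun x : Fin m → Mark d => F (meet x)) ω =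
      tupleSum X (fun x : Fin m' → Mark d => F (meet x)) ω := by
  subst h; rfl

lemma IsPoissonProcess.ae_tuple {S ι : Type*} [Fintype ι] [MeasurableSpace Ω] [MeasurableSpace S]
    {P : Measure Ω} {Y : ℕ → Ω → S} {Λ : Measure S} [SigmaFinite Λ] (hY : IsPoissonProcess P Y Λ)
    {q : S → ℝ} (hq : IsDiffuseFor Λ q) {p : (ι → S) → Prop}
    (hp : ∀ᵐ x ∂(Measure.pi fun _ : ι => Λ), p x) :
    ∀ᵐ ω ∂P, ∀ I : ι ↪ ℕ, p fun a => Y (I a) ω := by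
  obtain ⟨N, hsub, hN, hN0⟩ := exists_measurable_superset_of_null (ae_iff.1 hp)
  have h := hY.lintegral_tupleSum hq (f := N.indicator 1) (measurable_one.indicator hN)
  rw [lintegral_indicator_one hN, hN0,
    lintegral_eq_zero_iff (measurable_tupleSum hY.measurable (measurable_one.indicator hN))] at h
  filter_upwards [h] with ω hω I
  have h0 := ENNReal.tsum_eq_zero.1 hω I
  by_contra hI
  rw [Set.indicator_of_mem (hsub hI)] at h0
  exact one_ne_zero h0

variable [MeasurableSpace Ω] {P : Measure Ω} {Θ : Measure (upperHemisphere d)}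
  [IsProbabilityMeasure Θ] {c : ℝ≥0}

lemma ae_injective_hyperplane
    (hX : IsPoissonProcess P X (c • (volume : Measure ℝ).prod Θ)) :
    ∀ᵐ ω ∂P, Function.Injective fun i => hyperplane (X i ω) := by
  filter_upwards [hX.ae_injective (isDiffuseFor_abs Θ c)] with ω hω i j hij
  exact hω (abs_eq_abs_of_hyperplane_eq hij)

lemma flatCount_ae_eq (hX : IsPoissonProcess P X (c • (volume : Measure ℝ).prod Θ)) {k n : ℕ}
    (hn : d - k = n + 1) (r : ℝ) :
    flatCount X k r =ᵐ[P] fun ω => (((n + 1)! : ℕ) : ℝ)⁻¹ *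
      (tupleSum X (fun x : Fin (n + 1) → Mark d => countFunctional d k r (meet x)) ω).toReal := by
  filter_upwards [ae_injective_hyperplane hX] with ω hω
  rw [flatCount, flatSum_eq_tupleSum hω, ← tupleSum_meet_congr hn, ENNReal.toReal_mul, hn]
  simp [countFunctional]

lemma flatVolume_ae_eq (hX : IsPoissonProcess P X (c • (volume : Measure ℝ).prod Θ)) {k n : ℕ}
    (hn : d - k = n + 1) (r : ℝ) :
    flatVolume X k r =ᵐ[P] fun ω => (((n + 1)! : ℕ) : ℝ)⁻¹ *
      (tupleSum X (fun x : Fin (n + 1) → Mark d => volumeFunctional d k r (meet x)) ω).toReal := by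
  have hgen : ∀ᵐ x ∂(Measure.pi fun _ : Fin (d - k) => c • (volume : Measure ℝ).prod Θ),
      ((meet x : AffineSubspace ℝ (Space d)) : Set (Space d)).Nonempty → GeneralNormals x := by
    have := ae_pi_smul_restrict (c := c) (W := Set.univ) (ae_generalNormals (ι := Fin (d - k)) Θ)
    rwa [Measure.restrict_univ] at this
  filter_upwards [ae_injective_hyperplane hX, hX.ae_tuple (isDiffuseFor_abs Θ c) hgen]
    with ω hω hgω
  have h : tupleSum X (fun x : Fin (d - k) → Mark d =>
      μHE[k] ((meet x : Set (Space d)) ∩ Metric.closedBall 0 r)) ω =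
      tupleSum X (fun x : Fin (d - k) → Mark d => volumeFunctional d k r (meet x)) ω := by
    refine tsum_congr fun I => ?_
    simp only [volumeFunctional]
    by_cases hne : (meet (fun a => X (I a) ω) : Set (Space d)).Nonempty
    · rw [Set.indicator_of_mem ((generalNormals_iff (by rw [Fintype.card_fin]; omega) hne).1
        (hgω I hne))]
    · rw [Set.not_nonempty_iff_eq_empty.1 hne, Set.empty_inter, measure_empty, eq_comm]
      exact Set.indicator_of_notMem (fun hk => hne hk.1) _
  rw [flatVolume, flatSum_eq_tupleSum hω, h, tupleSum_meet_congr hn, ENNReal.toReal_mul, hn]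
  simp

end FlatSums

/-! ### The limit theorem for sums over flats -/

section FlatLimit

variable {d : ℕ}

/-- Functionals of flats that are supported by the flats hitting a ball and that are homogeneous
of degree `e k` under dilations. -/
structure IsFlatFunctional (F : Fin d → ℝ → AffineSubspace ℝ (Space d) → ℝ≥0∞) (e : Fin d → ℕ) :
    Prop where
  kernel : ∀ (k : Fin d) r, ∃ C, IsWindowKernel (markWindow d r) C
    fun x : Fin (d - (k : ℕ) - 1 + 1) → Mark d => F k r (meet x)
  homogeneous : ∀ (k : Fin d) {a : ℝ}, 0 < a → ∀ (x : Fin (d - (k : ℕ) - 1 + 1) → Mark d) (r : ℝ),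
    F k (a * r) (meet fun i => dilate a (x i)) = ENNReal.ofReal (a ^ e k) * F k r (meet x)

lemma IsWindowKernel.const_mul {S ι : Type*} [MeasurableSpace S] {W : Set S} {C : ℝ≥0}
    {f : (ι → S) → ℝ≥0∞} (hf : IsWindowKernel W C f) (c : ℝ≥0) :
    IsWindowKernel W (c * C) fun x => c * f x where
  measurable := hf.measurable.const_mul _
  le x := by rw [ENNReal.coe_mul]; gcongr; exact hf.le x
  zero x hx := by rw [hf.zero x hx, mul_zero]

lemma IsProjection.const_mul {S : Type*} [MeasurableSpace S] {μ : Measure S} {n : ℕ}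
    {f : (Fin (n + 1) → S) → ℝ≥0∞} {f₁ : S → ℝ≥0∞} (hf : IsProjection μ f f₁) (c : ℝ≥0) :
    IsProjection μ (fun x => c * f x) fun s => c * f₁ s where
  measurable := hf.measurable.const_mul _
  eq a s := by rw [lintegral_const_mul' _ _ ENNReal.coe_ne_top, hf.eq]

variable {Ω : Type*} [MeasurableSpace Ω] {P : Measure Ω}
  {X : ℕ → Ω → Mark d} {Θ : Measure (upperHemisphere d)} [IsProbabilityMeasure Θ]

lemma IsPoissonProcess.isPoissonWindow {c : ℝ≥0}
    (hX : IsPoissonProcess P X (c • (volume : Measure ℝ).prod Θ)) {ρ : ℝ} (hρ : 0 < ρ) :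
    IsPoissonWindow P X (c • (volume : Measure ℝ).prod Θ) (markWindow d ρ) (c * (2 * ρ).toNNReal)
      (markLaw Θ ρ) :=
  ⟨hX, ⟨_, isDiffuseFor_abs Θ c⟩, measurableSet_markWindow ρ, restrict_markWindow Θ hρ c⟩

variable {F : Fin d → ℝ → AffineSubspace ℝ (Space d) → ℝ≥0∞} {e : Fin d → ℕ}

lemma IsFlatFunctional.memLp [IsProbabilityMeasure P] (hF : IsFlatFunctional F e) {c : ℝ≥0}
    (hX : IsPoissonProcess P X (c • (volume : Measure ℝ).prod Θ)) (k : Fin d) {r : ℝ}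
    (hr : 0 < r) :
    MemLp (fun ω => (tupleSum X
      (fun x : Fin (d - (k : ℕ) - 1 + 1) → Mark d => F k r (meet x)) ω).toReal) 2 P := by
  obtain ⟨C, hC⟩ := hF.kernel k r
  have := isProbabilityMeasure_markLaw Θ hr
  have : SigmaFinite (c • (volume : Measure ℝ).prod Θ) := SMul.sigmaFinite _
  exact (hX.isPoissonWindow hr).memLp_tupleSum hC (isProjection_meet hC.measurable)

omit [MeasurableSpace Ω] in
lemma IsFlatFunctional.tupleSum_dilate (hF : IsFlatFunctional F e) (k : Fin d) {r ρ : ℝ}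
    (hr : 0 < r) (hρ : 0 < ρ) (ω : Ω) :
    tupleSum (fun i ω => PoissonFlats.dilate (ρ / r) (X i ω))
      (fun x : Fin (d - (k : ℕ) - 1 + 1) → Mark d =>
        (((ρ ^ e k)⁻¹.toNNReal : ℝ≥0) : ℝ≥0∞) * F k ρ (meet x)) ω =
    ENNReal.ofReal (r ^ e k)⁻¹ *
      tupleSum X (fun x : Fin (d - (k : ℕ) - 1 + 1) → Mark d => F k r (meet x)) ω := by
  rw [tupleSum, tupleSum, ← ENNReal.tsum_mul_left]
  refine tsum_congr fun I => ?_
  have h := hF.homogeneous k (div_pos hρ hr) (fun a => X (I a) ω) r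
  rw [div_mul_cancel₀ _ hr.ne'] at h
  rw [h, ← mul_assoc]
  congr 1
  change ENNReal.ofReal _ * _ = _
  rw [← ENNReal.ofReal_mul (by positivity), div_pow]
  congr 1
  field_simp

lemma IsFlatFunctional.isPoissonFamily (hF : IsFlatFunctional F e) {lam ρ : ℝ} (hlam : 0 < lam)
    (hρ : 0 < ρ)
    (hX : IsPoissonProcess P X (lam.toNNReal • (volume : Measure ℝ).prod Θ)) :
    ∃ C, IsPoissonFamily P (fun r i ω => PoissonFlats.dilate (ρ / r) (X i ω))
      (fun r => (lam.toNNReal * (ρ / r)⁻¹.toNNReal) • (volume : Measure ℝ).prod Θ)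
      (markWindow d ρ) (fun r => (2 * lam * r).toNNReal) (markLaw Θ ρ)
      (fun k : Fin d => d - (k : ℕ) - 1)
      (fun k x => (((ρ ^ e k)⁻¹.toNNReal : ℝ≥0) : ℝ≥0∞) * F k ρ (meet x)) C
      (fun k s => (((ρ ^ e k)⁻¹.toNNReal : ℝ≥0) : ℝ≥0∞) *
        ∫⁻ y : Fin (d - (k : ℕ) - 1) → Mark d, F k ρ ((⨅ i, hyperplane (y i)) ⊓ hyperplane s)
          ∂(Measure.pi fun _ => markLaw Θ ρ)) := by
  have := isProbabilityMeasure_markLaw Θ hρ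
  choose C hC using fun k => hF.kernel k ρ
  refine ⟨fun k => (ρ ^ e k)⁻¹.toNNReal * C k, ?_, ?_, fun k => (hC k).const_mul _,
    fun k => (isProjection_meet (hC k).measurable).const_mul _⟩
  · exact tendsto_real_toNNReal_atTop.comp (tendsto_id.const_mul_atTop (by positivity))
  · filter_upwards [eventually_gt_atTop 0] with r hr
    have h := (IsPoissonProcess.dilate Θ hX (div_pos hρ hr)).isPoissonWindow hρ
    have ht : lam.toNNReal * (ρ / r)⁻¹.toNNReal * (2 * ρ).toNNReal = (2 * lam * r).toNNReal := by
      rw [← Real.toNNReal_mul hlam.le, ← Real.toNNReal_mul (by positivity)]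
      congr 1
      field_simp
    rwa [ht] at h

lemma IsFlatFunctional.ae_eq_normalizedSum (hF : IsFlatFunctional F e) {lam ρ r : ℝ}
    (hlam : 0 < lam) (hρ : 0 < ρ) (hr : 0 < r) (k : Fin d) {U : Ω → ℝ}
    (hU : U =ᵐ[P] fun ω => (((d - (k : ℕ) - 1 + 1)! : ℕ) : ℝ)⁻¹ * (tupleSum X
      (fun x : Fin (d - (k : ℕ) - 1 + 1) → Mark d => F k r (meet x)) ω).toReal) :
    (fun ω => ((d - (k : ℕ) - 1)! : ℝ) * (r ^ e k)⁻¹ /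
      (2 * lam * r : ℝ) ^ ((d : ℝ) - (k : ℕ) - 1 / 2) * (U ω - ∫ ω', U ω' ∂P)) =ᵐ[P]
    normalizedSum P (fun i ω => PoissonFlats.dilate (ρ / r) (X i ω)) (2 * lam * r).toNNReal
      (fun x : Fin (d - (k : ℕ) - 1 + 1) → Mark d =>
        (((ρ ^ e k)⁻¹.toNNReal : ℝ≥0) : ℝ≥0∞) * F k ρ (meet x)) := by
  have ht : 0 < 2 * lam * r := by positivity
  have hpow : (2 * lam * r : ℝ) ^ ((d : ℝ) - (k : ℕ) - 1 / 2) =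
      (2 * lam * r) ^ (d - (k : ℕ) - 1) * √(2 * lam * r) := by
    rw [Real.sqrt_eq_rpow, ← Real.rpow_natCast, ← Real.rpow_add ht]
    congr 1
    have h : ((d - (k : ℕ) - 1 : ℕ) : ℝ) = d - (k : ℕ) - 1 := by
      have : d - (k : ℕ) - 1 + (k + 1) = d := by omega
      rw [eq_sub_iff_add_eq, eq_sub_iff_add_eq]
      exact_mod_cast (by omega : d - (k : ℕ) - 1 + 1 + k = d)
    rw [h]
    ring
  filter_upwards [hU] with ω hω
  rw [integral_congr_ae hU, hω, normalizedSum]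
  simp_rw [hF.tupleSum_dilate k hr hρ, ENNReal.toReal_mul, integral_const_mul,
    ENNReal.toReal_ofReal (show 0 ≤ (r ^ e k)⁻¹ by positivity)]
  rw [hpow, Real.coe_toNNReal _ ht.le, Nat.factorial_succ]
  have h1 : ((d - (k : ℕ) - 1)! : ℝ) ≠ 0 := by positivity
  have h2 : √(2 * lam * r) ≠ 0 := by positivity
  push_cast
  field_simp

/-- The central limit theorem for sums over flats. -/
theorem IsFlatFunctional.limit_theorem [IsProbabilityMeasure P] (hF : IsFlatFunctional F e)
    {lam ρ : ℝ} (hlam : 0 < lam)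
    (hρ : 0 < ρ) (hX : IsPoissonProcess P X (lam.toNNReal • (volume : Measure ℝ).prod Θ))
    {U : Fin d → ℝ → Ω → ℝ}
    (hU : ∀ k r, U k r =ᵐ[P] fun ω => (((d - (k : ℕ) - 1 + 1)! : ℕ) : ℝ)⁻¹ * (tupleSum X
      (fun x : Fin (d - (k : ℕ) - 1 + 1) → Mark d => F k r (meet x)) ω).toReal)
    {Z : ℝ → Ω → Space d}
    (hZ : ∀ r ω k, Z r ω k = ((d - (k : ℕ) - 1)! : ℝ) * (r ^ e k)⁻¹ /
      (2 * lam * r : ℝ) ^ ((d : ℝ) - (k : ℕ) - 1 / 2) * (U k r ω - ∫ ω', U k r ω' ∂P))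
    {g : Fin d → Mark d → ℝ}
    (hg : ∀ k, g k =ᵐ[markLaw Θ ρ] fun s => (ρ ^ e k)⁻¹ *
      (∫⁻ y : Fin (d - (k : ℕ) - 1) → Mark d, F k ρ ((⨅ i, hyperplane (y i)) ⊓ hyperplane s)
        ∂(Measure.pi fun _ => markLaw Θ ρ)).toReal)
    {M : Matrix (Fin d) (Fin d) ℝ} (hM : ∀ k l, M k l = ∫ x, g k x * g l x ∂(markLaw Θ ρ)) :
    (∀ k (r : ℝ), 0 < r → MemLp (U k r) 2 P) ∧ M.PosSemidef ∧
    TendstoInDistribution Z atTop (id : Space d → Space d) (fun _ => P)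
      (multivariateGaussian 0 M) ∧
    ∀ k l : Fin d, Tendsto (fun r : ℝ => ∫ ω, Z r ω k * Z r ω l ∂P) atTop (𝓝 (M k l)) := by
  have := isProbabilityMeasure_markLaw Θ hρ
  have : ∀ r, SigmaFinite ((lam.toNNReal * (ρ / r)⁻¹.toNNReal) • (volume : Measure ℝ).prod Θ) :=
    fun r => SMul.sigmaFinite _
  obtain ⟨C, hfam⟩ := hF.isPoissonFamily hlam hρ hX
  have hM' : ∀ k l, M k l = ∫ s, ((((ρ ^ e k)⁻¹.toNNReal : ℝ≥0) : ℝ≥0∞) *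
      ∫⁻ y : Fin (d - (k : ℕ) - 1) → Mark d, F k ρ ((⨅ i, hyperplane (y i)) ⊓ hyperplane s)
          ∂(Measure.pi fun _ => markLaw Θ ρ)).toReal * ((((ρ ^ e l)⁻¹.toNNReal : ℝ≥0) : ℝ≥0∞) *
      ∫⁻ y : Fin (d - (l : ℕ) - 1) → Mark d, F l ρ ((⨅ i, hyperplane (y i)) ⊓ hyperplane s)
          ∂(Measure.pi fun _ => markLaw Θ ρ)).toReal ∂(markLaw Θ ρ) := by
    intro k l
    rw [hM]
    refine integral_congr_ae ?_
    filter_upwards [hg k, hg l] with s hk hl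
    rw [hk, hl, ENNReal.toReal_mul, ENNReal.toReal_mul, ENNReal.coe_toReal, ENNReal.coe_toReal,
      Real.coe_toNNReal _ (by positivity), Real.coe_toNNReal _ (by positivity)]
  have hZn : ∀ᶠ r in atTop, ∀ k, (fun ω => Z r ω k) =ᵐ[P]
      normalizedSum P (fun i ω => PoissonFlats.dilate (ρ / r) (X i ω)) (2 * lam * r).toNNReal
      (fun x : Fin (d - (k : ℕ) - 1 + 1) → Mark d =>
        (((ρ ^ e k)⁻¹.toNNReal : ℝ≥0) : ℝ≥0∞) * F k ρ (meet x)) := by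
    filter_upwards [eventually_gt_atTop 0] with r hr k
    simp_rw [hZ]
    exact hF.ae_eq_normalizedSum hlam hρ hr k (hU k r)
  have hZm : ∀ r, AEMeasurable (Z r) P := by
    intro r
    have hUm : ∀ k, AEMeasurable (U k r) P := fun k =>
      (((measurable_tupleSum hX.measurable
        (hF.kernel k r).choose_spec.measurable).ennreal_toReal.const_mul _).aemeasurable).congr
        (hU k r).symm
    have hZe : Z r = fun ω => WithLp.toLp 2 fun k => Z r ω k := rfl
    rw [hZe]
    refine (WithLp.measurable_toLp 2 _).comp_aemeasurable (aemeasurable_pi_lambda _ fun k => ?_)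
    simp_rw [hZ]
    exact ((hUm k).sub_const _).const_mul _
  refine ⟨fun k r hr => ((hF.memLp hX k hr).const_mul _).ae_eq (hU k r).symm,
    (posSemidef_of_eq_integral_mul hfam.memLp_projection hM').1,
    hfam.tendstoInDistribution hZm hZn hM', fun k l => ?_⟩
  rw [hM']
  exact hfam.tendsto_moment_of_ae_eq hZn k l

end FlatLimit

/-! ### The limiting covariances -/

section Covariance

variable {d : ℕ} {Θ : Measure (upperHemisphere d)} [IsProbabilityMeasure Θ]

lemma ae_ae_generalNormals {ρ : ℝ} (hρ : 0 < ρ) (n : ℕ) :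
    ∀ᵐ s ∂(markLaw Θ ρ), ∀ᵐ y ∂(Measure.pi fun _ : Fin n => markLaw Θ ρ),
      ((meet (Fin.insertNth 0 s y : Fin (n + 1) → Mark d) : AffineSubspace ℝ (Space d)) :
        Set (Space d)).Nonempty → GeneralNormals (Fin.insertNth 0 s y : Fin (n + 1) → Mark d) := by
  have := isProbabilityMeasure_markLaw Θ hρ
  have h := (measurePreserving_piFinSuccAbove (fun _ : Fin (n + 1) => markLaw Θ ρ) 0).symm
  exact Measure.ae_ae_of_ae_prod
    (h.quasiMeasurePreserving.ae (ae_generalNormals_markLaw (ι := Fin (n + 1)) Θ hρ))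

/-- Integrals of a functional of intersections of hyperplanes only depend on its values at flats. -/
lemma integral_meet_ae_eq {ρ : ℝ} (hρ : 0 < ρ) {k n : ℕ} (hk : k + (n + 1) = d)
    {F : AffineSubspace ℝ (Space d) → ℝ≥0∞} {G : AffineSubspace ℝ (Space d) → ℝ} {C : ℝ≥0}
    (hF : IsWindowKernel (markWindow d ρ) C fun x : Fin (n + 1) → Mark d => F (meet x))
    (h0 : ∀ L : AffineSubspace ℝ (Space d), ¬ (L : Set (Space d)).Nonempty → G L = (F L).toReal)
    (h1 : ∀ L ∈ kFlats d k, G L = (F L).toReal) :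
    (fun s => ∫ y : Fin n → Mark d, G ((⨅ i, hyperplane (y i)) ⊓ hyperplane s)
      ∂(Measure.pi fun _ => markLaw Θ ρ)) =ᵐ[markLaw Θ ρ]
    fun s => (∫⁻ y : Fin n → Mark d, F ((⨅ i, hyperplane (y i)) ⊓ hyperplane s)
      ∂(Measure.pi fun _ => markLaw Θ ρ)).toReal := by
  filter_upwards [ae_ae_generalNormals hρ n] with s hs
  simp_rw [← meet_insertNth 0]
  rw [← integral_toReal]
  · refine integral_congr_ae ?_
    filter_upwards [hs] with y hy
    by_cases hne : (meet (Fin.insertNth 0 s y : Fin (n + 1) → Mark d) : Set (Space d)).Nonempty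
    · exact h1 _ ((generalNormals_iff (by rwa [Fintype.card_fin]) hne).1 (hy hne))
    · exact h0 _ hne
  · exact ((hF.measurable.comp (measurable_insertNth 0)).comp measurable_prodMk_left).aemeasurable
  · exact .of_forall fun y => (hF.le _).trans_lt ENNReal.coe_lt_top

lemma add_card_fin (k : Fin d) : (k : ℕ) + Fintype.card (Fin (d - (k : ℕ) - 1 + 1)) = d := by
  rw [Fintype.card_fin]
  omega

lemma gCount_ae_eq {ρ : ℝ} (hρ : 0 < ρ) (k : Fin d) :
    gCount Θ ρ k =ᵐ[markLaw Θ ρ] fun s =>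
      (∫⁻ y : Fin (d - (k : ℕ) - 1) → Mark d,
        countFunctional d k ρ ((⨅ i, hyperplane (y i)) ⊓ hyperplane s)
        ∂(Measure.pi fun _ => markLaw Θ ρ)).toReal := by
  refine integral_meet_ae_eq (Θ := Θ) hρ (k := k) (by omega)
    (isWindowKernel_count (add_card_fin k) ρ)
    (G := fun L => chi ((L : Set (Space d)) ∩ Metric.closedBall 0 ρ)) ?_ ?_
  · intro L hL
    rw [chi, if_neg fun h => hL (h.mono Set.inter_subset_left), countFunctional,
      Set.indicator_of_notMem fun h => hL h.1.1, ENNReal.toReal_zero]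
  · intro L hL
    by_cases h : ((L : Set (Space d)) ∩ Metric.closedBall 0 ρ).Nonempty
    · have hmem : L ∈ {L | L ∈ kFlats d k ∧
          ((L : Set (Space d)) ∩ Metric.closedBall 0 ρ).Nonempty} := ⟨hL, h⟩
      rw [chi, if_pos h, countFunctional, Set.indicator_of_mem hmem, Pi.one_apply,
        ENNReal.toReal_one]
    · rw [chi, if_neg h, countFunctional, Set.indicator_of_notMem fun h' => h h'.2,
        ENNReal.toReal_zero]

lemma gVolume_ae_eq {ρ : ℝ} (hρ : 0 < ρ) (k : Fin d) :
    gVolume Θ ρ k =ᵐ[markLaw Θ ρ] fun s =>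
      (ρ ^ (k : ℕ))⁻¹ * (∫⁻ y : Fin (d - (k : ℕ) - 1) → Mark d,
        volumeFunctional d k ρ ((⨅ i, hyperplane (y i)) ⊓ hyperplane s)
        ∂(Measure.pi fun _ => markLaw Θ ρ)).toReal := by
  refine (integral_meet_ae_eq (Θ := Θ) hρ (k := k) (by omega)
    (isWindowKernel_volume (add_card_fin k) ρ)
    (G := fun L => (μHE[k] ((L : Set (Space d)) ∩ Metric.closedBall 0 ρ)).toReal) ?_ ?_).mono
    fun s hs => congrArg ((ρ ^ (k : ℕ))⁻¹ * ·) hs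
  · intro L hL
    rw [volumeFunctional, Set.indicator_of_notMem fun h => hL h.1,
      Set.not_nonempty_iff_eq_empty.1 hL, Set.empty_inter, measure_empty]
  · intro L hL
    rw [volumeFunctional, Set.indicator_of_mem hL]

lemma isFlatFunctional_count :
    IsFlatFunctional (fun (k : Fin d) r => countFunctional d k r) fun _ => 0 where
  kernel k r := ⟨_, isWindowKernel_count (add_card_fin k) r⟩
  homogeneous k a ha x r := by
    rw [countFunctional_dilate (add_card_fin k) ha, pow_zero, ENNReal.ofReal_one, one_mul]

lemma isFlatFunctional_volume :
    IsFlatFunctional (fun (k : Fin d) r => volumeFunctional d k r) fun k => k where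
  kernel k r := ⟨_, isWindowKernel_volume (add_card_fin k) r⟩
  homogeneous k _ ha x r := volumeFunctional_dilate (add_card_fin k) ha x r

end Covariance

end PoissonFlats

end

theorem theorem4p3 {d : ℕ} {Ω : Type*} [MeasurableSpace Ω] (P : Measure Ω)
    [IsProbabilityMeasure P] (lam : ℝ) (hlam : 0 < lam)
    (Θ : Measure (PoissonFlats.upperHemisphere d)) [IsProbabilityMeasure Θ]
    (hΘ : ∀ L : Submodule ℝ (PoissonFlats.Space d), Module.finrank ℝ L + 1 = d →
      Θ {v | (v : PoissonFlats.Space d) ∈ L} < 1)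
    (X : ℕ → Ω → PoissonFlats.Mark d)
    (hX : PoissonFlats.IsPoissonHyperplaneProcess P X lam Θ)
    (ρ : ℝ) (hρ : 0 < ρ) :
    -- the counts and volumes are square integrable, so all moments below are genuine
    (∀ (k : Fin d) (r : ℝ), 0 < r →
      MemLp (PoissonFlats.flatCount X k r) 2 P ∧ MemLp (PoissonFlats.flatVolume X k r) 2 P) ∧
    -- the limit theorem for the numbers of flats
    (PoissonFlats.covCount Θ ρ).PosSemidef ∧
    TendstoInDistribution (fun r : ℝ => PoissonFlats.ZCount P X lam r) atTop
      (id : PoissonFlats.Space d → PoissonFlats.Space d) (fun _ => P)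
      (multivariateGaussian 0 (PoissonFlats.covCount Θ ρ)) ∧
    (∀ k l : Fin d, Tendsto
      (fun r : ℝ => ∫ ω, PoissonFlats.ZCount P X lam r ω k * PoissonFlats.ZCount P X lam r ω l ∂P)
      atTop (𝓝 (PoissonFlats.covCount Θ ρ k l))) ∧
    -- the limit theorem for the volumes of flats
    (PoissonFlats.covVolume Θ ρ).PosSemidef ∧
    TendstoInDistribution (fun r : ℝ => PoissonFlats.ZVolume P X lam r) atTop
      (id : PoissonFlats.Space d → PoissonFlats.Space d) (fun _ => P)
      (multivariateGaussian 0 (PoissonFlats.covVolume Θ ρ)) ∧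
    (∀ k l : Fin d, Tendsto
      (fun r : ℝ => ∫ ω, PoissonFlats.ZVolume P X lam r ω k * PoissonFlats.ZVolume P X lam r ω l ∂P)
      atTop (𝓝 (PoissonFlats.covVolume Θ ρ k l))) := by
  have hX' : PoissonFlats.IsPoissonProcess P X
      (lam.toNNReal • (volume : Measure ℝ).prod Θ) := hX
  obtain ⟨h1, h2, h3, h4⟩ := PoissonFlats.isFlatFunctional_count.limit_theorem hlam hρ hX'
    (U := fun k r => PoissonFlats.flatCount X k r)
    (fun k r => PoissonFlats.flatCount_ae_eq hX' (by omega) r)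
    (Z := PoissonFlats.ZCount P X lam) (fun r ω k => by simp [PoissonFlats.ZCount])
    (g := fun k => PoissonFlats.gCount Θ ρ k)
    (fun k => by simpa using PoissonFlats.gCount_ae_eq hρ k)
    (M := PoissonFlats.covCount Θ ρ) (fun _ _ => rfl)
  obtain ⟨h5, h6, h7, h8⟩ := PoissonFlats.isFlatFunctional_volume.limit_theorem hlam hρ hX'
    (U := fun k r => PoissonFlats.flatVolume X k r)
    (fun k r => PoissonFlats.flatVolume_ae_eq hX' (by omega) r)
    (Z := PoissonFlats.ZVolume P X lam) (fun _ _ _ => rfl)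
    (g := fun k => PoissonFlats.gVolume Θ ρ k) (PoissonFlats.gVolume_ae_eq hρ)
    (M := PoissonFlats.covVolume Θ ρ) (fun _ _ => rfl)
  exact ⟨fun k r hr => ⟨h1 k r hr, h5 k r hr⟩, h2, h3, h4, h6, h7, h8⟩
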